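/- Let $k$ be a field with algebraic closure $\bar k$. A curve over $k$ is a proper, smooth, geometrically irreducible $k$-scheme of dimension $1$. Let $C$ be a curve over $k$ and let $(D,\pi_1,\pi_2)$ be a self-correspondence on $C$: $D$ is a noetherian reduced $k$-scheme whose connected components $D_i$ are curves over $k$, and $\pi_1,\pi_2:D\to C$ are $k$-morphisms whose restrictions to each $D_i$ are non-constant and separable. Put $d_j=\deg \pi_j=\sum_i \deg(\pi_j|_{D_i})$, let $g_C$ be the genus of $C$ and let $g_D$ be the sum of the genera of the $D_i$. For $z\in D(\bar k)$ let $e_{j,z}$ be the ramification index at $z$ of $\pi_j$ (over $\bar k$). A subset $S\subseteq C(\bar k)$ is forward-complete if $\pi_1^{-1}(S)\subseteq\pi_2^{-1}(S)$, backward-complete if $\pi_2^{-1}(S)\subseteq\pi_1^{-1}(S)$ (preimages in $D(\bar k)$), and complete if it is both. It is ramification-decreasing (resp. equiramified, resp. étale) if $e_{1,z}\ge e_{2,z}$ (resp. $e_{1,z}=e_{2,z}$, resp. $e_{1,z}=e_{2,z}=1$) for all $z\in D(\bar k)$ with $\pi_1(z)\in S$ and $\pi_2(z)\in S$. 1. If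 $d_1<d_2$, every finite backward-complete set $S\subseteq C(\bar k)$ satisfies $$|S|\le 2\,\frac{g_D-d_2g_C+d_2-1}{d_2-d_1},$$ and if such an $S$ is moreover ramification-decreasing, then $S=\emptyset$. 2. If $d_1\le d_2$, every finite, backward-complete, ramification-decreasing set $S\subseteq C(\bar k)$ is complete and equiramified. Moreover (for arbitrary $d_1,d_2$), if there is a finite non-empty complete equiramified set $S\subseteq C(\bar k)$, then $d_1=d_2$. 3. If $d_1\neq d_2$ and $d=\max(d_1,d_2)$, then every finite complete set $S\subseteq C(\bar k)$ satisfies $$|S|\le 2\,\frac{g_D-dg_C+d-1}{|d_2-d_1|},$$ and if $S$ is non-empty, then $S$ is not equiramified, in particular not étale. -/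

import Mathlib

open CategoryTheory CategoryTheory.Limits AlgebraicGeometry TopologicalSpace

universe u

noncomputable section

namespace CurveCorr

/-! ### Curves and their genus -/

/-- A curve over a field `k`: a proper, smooth, geometrically irreducible `k`-scheme of
dimension `1`. -/
class IsCurve {k : Type u} [Field k] {X : Scheme.{u}} (f : X ⟶ Spec (.of k)) : Prop where
  isProper : IsProper f
  smooth : SmoothOfRelativeDimension 1 f
  geometricallyIrreducible : GeometricallyIrreducible f

lemma IsCurve.irreducibleSpace {k : Type u} [Field k] {X : Scheme.{u}} (f : X ⟶ Spec (.of k))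
    [h : IsCurve f] : IrreducibleSpace X :=
  haveI := h.geometricallyIrreducible
  GeometricallyIrreducible.irreducibleSpace_of_subsingleton f

section Genus

variable {k : Type u} [Field k] {X : Scheme.{u}} (f : X ⟶ Spec (.of k))

/-- The structure map of the stalk of a `k`-scheme at `x`. -/
def toStalk (x : X) : k →+* X.presheaf.stalk x :=
  (X.presheaf.germ ⊤ x (Opens.mem_top x)).hom.comp
    ((Scheme.Hom.appTop f).hom.comp (Scheme.ΓSpecIso (.of k)).inv.hom)

variable [IrreducibleSpace X]

/-- The function field of a `k`-scheme as a `k`-algebra. -/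
@[reducible] def functionFieldAlgebra : Algebra k X.functionField :=
  (toStalk f (genericPoint X)).toAlgebra

lemma algebraMap_toStalk (x : X) (a : k) :
    algebraMap (X.presheaf.stalk x) X.functionField (toStalk f x a) =
      toStalk f (genericPoint X) a := by
  simp only [toStalk, RingHom.comp_apply, RingHom.algebraMap_toAlgebra]
  rw [← CommRingCat.comp_apply, TopCat.Presheaf.germ_stalkSpecializes]

/-- The local ring `𝒪_{X,x}` as a `k`-subspace of the function field. -/
def localSubspace (x : X) :
    letI := functionFieldAlgebra f
    Submodule k X.functionField :=
  letI := functionFieldAlgebra f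
  { carrier := Set.range (algebraMap (X.presheaf.stalk x) X.functionField)
    add_mem' := by
      rintro _ _ ⟨a, rfl⟩ ⟨b, rfl⟩
      exact ⟨a + b, map_add _ _ _⟩
    zero_mem' := ⟨0, map_zero _⟩
    smul_mem' := by
      rintro c _ ⟨a, rfl⟩
      refine ⟨toStalk f x c * a, ?_⟩
      rw [map_mul, algebraMap_toStalk, Algebra.smul_def]
      rfl }

/-- Repartitions on `X`: families of rational functions indexed by the closed points of `X`,
all but finitely many members of which are regular at the corresponding point. -/
def repartitions :
    letI := functionFieldAlgebra f
    Submodule k (closedPoints X → X.functionField) :=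
  letI := functionFieldAlgebra f
  { carrier := {r | {x : closedPoints X | r x ∉ localSubspace f x}.Finite}
    add_mem' := by
      intro r s hr hs
      refine (hr.union hs).subset fun x hx => ?_
      by_contra h
      simp only [Set.mem_union, Set.mem_ofPred_eq, not_or, not_not] at h
      exact hx (Submodule.add_mem _ h.1 h.2)
    zero_mem' := by
      simp
    smul_mem' := by
      intro c r hr
      exact hr.subset fun x hx h => hx (Submodule.smul_mem _ c h) }

/-- Families of rational functions, each regular at its point. -/
def regularRepartitions :
    letI := functionFieldAlgebra f
    Submodule k (closedPoints X → X.functionField) :=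
  letI := functionFieldAlgebra f
  Submodule.pi Set.univ fun x => localSubspace f x

/-- Constant families of rational functions. -/
def constantRepartitions :
    letI := functionFieldAlgebra f
    Submodule k (closedPoints X → X.functionField) :=
  letI := functionFieldAlgebra f
  LinearMap.range (LinearMap.pi fun _ : closedPoints X =>
    (LinearMap.id : X.functionField →ₗ[k] X.functionField))

/-- `H¹(X, 𝒪_X)` of a curve `X` over `k`, as the space `R / (R(0) + k(X))` of repartitions modulo
the regular and the constant ones. This is the cokernel of `k(X) → ⨁ₓ k(X) / 𝒪_{X,x}`, that is
the first cohomology of the flasque resolution of `𝒪_X` by rational functions and principal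
parts. -/
abbrev H1 : Type u :=
  letI := functionFieldAlgebra f
  repartitions f ⧸
    (regularRepartitions f ⊔ constantRepartitions f).comap (repartitions f).subtype

/-- `dim_k H¹(X, 𝒪_X)`. -/
def genusOver : ℕ :=
  letI := functionFieldAlgebra f
  Module.finrank k (H1 f)

end Genus

section BaseChange

variable {k : Type u} [Field k] (K : Type u) [Field K] [Algebra k K]

/-- `Spec K ⟶ Spec k`. -/
abbrev specMap (k : Type u) [Field k] (K : Type u) [Field K] [Algebra k K] :
    Spec (.of K) ⟶ Spec (.of k) :=
  Spec.map (CommRingCat.ofHom (algebraMap k K))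

/-- The base change `X_K` of a `k`-scheme. -/
abbrev baseChange {X : Scheme.{u}} (f : X ⟶ Spec (.of k)) : Scheme.{u} :=
  pullback f (specMap k K)

/-- The structure morphism of `X_K`. -/
abbrev baseChangeHom {X : Scheme.{u}} (f : X ⟶ Spec (.of k)) :
    baseChange K f ⟶ Spec (.of K) :=
  pullback.snd f (specMap k K)

/-- The base change `π_K : X_K ⟶ Y_K` of a `k`-morphism. -/
abbrev baseChangeMap {X Y : Scheme.{u}} (f : X ⟶ Spec (.of k)) (g : Y ⟶ Spec (.of k))
    (π : X ⟶ Y) (hπ : π ≫ g = f) : baseChange K f ⟶ baseChange K g :=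
  pullback.lift (pullback.fst f (specMap k K) ≫ π) (pullback.snd f (specMap k K))
    (by rw [Category.assoc, hπ, pullback.condition])

/-- The genus of a curve `X` over `k`, `K` being an algebraic closure of `k`: the dimension of
`H¹(X_K, 𝒪)` over `K`. -/
def genus {X : Scheme.{u}} (f : X ⟶ Spec (.of k)) [h : IsCurve f] : ℕ :=
  haveI := h.geometricallyIrreducible
  haveI : IrreducibleSpace (baseChange K f) :=
    GeometricallyIrreducible.irreducibleSpace_of_subsingleton (baseChangeHom K f)
  genusOver (baseChangeHom K f)

/-- The set `X(K)` of `K`-points of a `k`-scheme. -/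
abbrev Pt {X : Scheme.{u}} (f : X ⟶ Spec (.of k)) : Type u :=
  {z : Spec (.of K) ⟶ X // z ≫ f = specMap k K}

variable {K}

/-- The map `X(K) → Y(K)` given by a `k`-morphism. -/
def Pt.map {X Y : Scheme.{u}} {f : X ⟶ Spec (.of k)} {g : Y ⟶ Spec (.of k)}
    (π : X ⟶ Y) (hπ : π ≫ g = f) (z : Pt K f) : Pt K g :=
  ⟨z.1 ≫ π, by rw [Category.assoc, hπ, z.2]⟩

/-- The point of the scheme `X_K` given by a `K`-point of `X`. -/
def Pt.geom {X : Scheme.{u}} {f : X ⟶ Spec (.of k)} (z : Pt K f) : baseChange K f :=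
  pullback.lift (f := f) (g := specMap k K) z.1 (𝟙 _) (by rw [z.2, Category.id_comp])
    (IsLocalRing.closedPoint K)

/-- The ramification index at a point `x` of a morphism of schemes: the largest `n` such that the
maximal ideal of `π x` generates an ideal of `𝒪_{X,x}` contained in the `n`-th power of the
maximal ideal. -/
def ramIdx {X Y : Scheme.{u}} (π : X ⟶ Y) (x : X) : ℕ :=
  letI : Algebra (Y.presheaf.stalk (π x)) (X.presheaf.stalk x) := (π.stalkMap x).hom.toAlgebra
  Ideal.ramificationIdx' (IsLocalRing.maximalIdeal (Y.presheaf.stalk (π x)))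
    (IsLocalRing.maximalIdeal (X.presheaf.stalk x))

/-- The ramification index of `π` at `z ∈ X(K)`: that of `π_K : X_K ⟶ Y_K` at `z`. -/
def Pt.ramIdx {X Y : Scheme.{u}} {f : X ⟶ Spec (.of k)} {g : Y ⟶ Spec (.of k)}
    (π : X ⟶ Y) (hπ : π ≫ g = f) (z : Pt K f) : ℕ :=
  CurveCorr.ramIdx (baseChangeMap K f g π hπ) z.geom

end BaseChange

/-! ### Degree and separability -/

section Degree

variable {X Y : Scheme.{u}} (π : X ⟶ Y) [IrreducibleSpace X]

/-- The extension of function fields given by a non-constant morphism of curves. (Such a morphism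
sends the generic point to the generic point.) -/
@[reducible] def functionFieldExt :
    Algebra (Y.presheaf.stalk (π (genericPoint X))) X.functionField :=
  (π.stalkMap (genericPoint X)).hom.toAlgebra

/-- The degree `[k(X) : k(Y)]` of a non-constant morphism of curves. -/
def degree : ℕ :=
  letI := functionFieldExt π
  Module.finrank (Y.presheaf.stalk (π (genericPoint X))) X.functionField

/-- `k(X)` is separable over `k(Y)`. -/
def IsSeparableMap : Prop :=
  letI := functionFieldExt π
  Algebra.IsSeparable (Y.presheaf.stalk (π (genericPoint X))) X.functionField

/-- The morphism does not map all of `X` to one point. -/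
def IsNonconstant {X Y : Scheme.{u}} (π : X ⟶ Y) : Prop := ¬ ∃ y : Y, ∀ x : X, π x = y

end Degree

/-! ### Self-correspondences -/

lemma isOpen_connectedComponent_of_noetherian (D : Scheme.{u}) [IsNoetherian D] (x : D) :
    IsOpen (connectedComponent x) := by
  have hfin : (irreducibleComponents D).Finite := NoetherianSpace.finite_irreducibleComponents
  have key : (connectedComponent x)ᶜ =
      ⋃ Z ∈ {Z ∈ irreducibleComponents D | Disjoint Z (connectedComponent x)}, Z := by
    ext y
    simp only [Set.mem_compl_iff, Set.mem_iUnion, Set.mem_ofPred_eq, exists_prop]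
    constructor
    · intro hy
      refine ⟨irreducibleComponent y, ⟨irreducibleComponent_mem_irreducibleComponents y, ?_⟩,
        mem_irreducibleComponent⟩
      rw [Set.disjoint_left]
      intro z hz hzx
      have h1 : irreducibleComponent y ⊆ connectedComponent y :=
        isIrreducible_irreducibleComponent.isConnected.isPreconnected.subset_connectedComponent
          mem_irreducibleComponent
      have h2 := connectedComponent_eq (h1 hz)
      have h3 := connectedComponent_eq hzx
      rw [h3, ← h2] at hy
      exact hy mem_connectedComponent
    · rintro ⟨Z, ⟨_, hZ⟩, hy⟩ hyx
      exact Set.disjoint_left.mp hZ hy hyx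
  rw [← isClosed_compl_iff, key]
  exact (hfin.subset fun Z hZ => hZ.1).isClosed_biUnion
    fun Z hZ => isClosed_of_mem_irreducibleComponents Z hZ.1

/-- A connected component of a noetherian scheme, as an open subscheme. -/
def component (D : Scheme.{u}) [IsNoetherian D] (c : _root_.ConnectedComponents D) : D.Opens where
  carrier := _root_.ConnectedComponents.mk ⁻¹' {c}
  is_open' := by
    obtain ⟨x, rfl⟩ := _root_.ConnectedComponents.surjective_coe c
    rw [connectedComponents_preimage_singleton]
    exact isOpen_connectedComponent_of_noetherian D x

/-- A self-correspondence on a curve `C` over `k`: a noetherian reduced `k`-scheme `D` whose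
connected components are curves over `k`, with two `k`-morphisms `D ⟶ C` which are non-constant
and separable on every connected component. -/
structure SelfCorrespondence {k : Type u} [Field k] {C : Scheme.{u}} (f : C ⟶ Spec (.of k)) where
  /-- the scheme `D` -/
  D : Scheme.{u}
  /-- its structure morphism -/
  str : D ⟶ Spec (.of k)
  isNoetherian : IsNoetherian D
  isReduced : IsReduced D
  isCurve : ∀ c : _root_.ConnectedComponents D, IsCurve ((component D c).ι ≫ str)
  /-- the first morphism -/
  π₁ : D ⟶ C
  /-- the second morphism -/
  π₂ : D ⟶ C
  π₁_comp : π₁ ≫ f = str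
  π₂_comp : π₂ ≫ f = str
  nonconstant₁ : ∀ c : _root_.ConnectedComponents D, IsNonconstant ((component D c).ι ≫ π₁)
  nonconstant₂ : ∀ c : _root_.ConnectedComponents D, IsNonconstant ((component D c).ι ≫ π₂)
  separable₁ : ∀ c : _root_.ConnectedComponents D,
    haveI := (isCurve c).irreducibleSpace
    IsSeparableMap ((component D c).ι ≫ π₁)
  separable₂ : ∀ c : _root_.ConnectedComponents D,
    haveI := (isCurve c).irreducibleSpace
    IsSeparableMap ((component D c).ι ≫ π₂)

namespace SelfCorrespondence

variable {k : Type u} [Field k] {C : Scheme.{u}} {f : C ⟶ Spec (.of k)}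
  (T : SelfCorrespondence f)

attribute [instance] SelfCorrespondence.isNoetherian SelfCorrespondence.isCurve

/-- `deg π₁`, the sum of the degrees of `π₁` on the (finitely many) connected components. -/
def d₁ : ℕ :=
  ∑ᶠ c : _root_.ConnectedComponents T.D,
    haveI := (T.isCurve c).irreducibleSpace
    degree ((component T.D c).ι ≫ T.π₁)

/-- `deg π₂`, the sum of the degrees of `π₂` on the (finitely many) connected components. -/
def d₂ : ℕ :=
  ∑ᶠ c : _root_.ConnectedComponents T.D,
    haveI := (T.isCurve c).irreducibleSpace
    degree ((component T.D c).ι ≫ T.π₂)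

variable (K : Type u) [Field K] [Algebra k K]

/-- The genus of `D`: the sum of the genera of its connected components. -/
def genusD : ℕ :=
  ∑ᶠ c : _root_.ConnectedComponents T.D, genus K ((component T.D c).ι ≫ T.str)

variable {K}

/-- `π₁` on `K`-points. -/
def source (z : Pt K T.str) : Pt K f := z.map T.π₁ T.π₁_comp

/-- `π₂` on `K`-points. -/
def target (z : Pt K T.str) : Pt K f := z.map T.π₂ T.π₂_comp

/-- `e_{1,z}`. -/
def e₁ (z : Pt K T.str) : ℕ := z.ramIdx T.π₁ T.π₁_comp

/-- `e_{2,z}`. -/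
def e₂ (z : Pt K T.str) : ℕ := z.ramIdx T.π₂ T.π₂_comp

variable (S : Set (Pt K f))

/-- `π₁⁻¹(S) ⊆ π₂⁻¹(S)`. -/
def ForwardComplete : Prop := T.source ⁻¹' S ⊆ T.target ⁻¹' S

/-- `π₂⁻¹(S) ⊆ π₁⁻¹(S)`. -/
def BackwardComplete : Prop := T.target ⁻¹' S ⊆ T.source ⁻¹' S

/-- `S` is forward-complete and backward-complete. -/
def Complete : Prop := T.ForwardComplete S ∧ T.BackwardComplete S

/-- `e_{1,z} ≥ e_{2,z}` for every `z` with source and target in `S`. -/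
def RamificationDecreasing : Prop :=
  ∀ z : Pt K T.str, T.source z ∈ S → T.target z ∈ S → T.e₂ z ≤ T.e₁ z

/-- `e_{1,z} = e_{2,z}` for every `z` with source and target in `S`. -/
def Equiramified : Prop :=
  ∀ z : Pt K T.str, T.source z ∈ S → T.target z ∈ S → T.e₁ z = T.e₂ z

/-- `e_{1,z} = e_{2,z} = 1` for every `z` with source and target in `S`. -/
def Etale : Prop :=
  ∀ z : Pt K T.str, T.source z ∈ S → T.target z ∈ S → T.e₁ z = 1 ∧ T.e₂ z = 1

end SelfCorrespondence

end CurveCorr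

end

/-! The theorem is a count of preimages. Each fibre of `π_j` has total ramification `d_j`, so
`π₁⁻¹(S)` has at most `d₁|S|` points, while `d₂|S| = |π₂⁻¹(S)| + ∑ (e₂ - 1)`, the sum running over
`π₂⁻¹(S)`. Backward completeness gives `|π₂⁻¹(S)| ≤ |π₁⁻¹(S)|`, hence `(d₂ - d₁)|S| ≤ ∑ (e₂ - 1)`.
Riemann-Hurwitz on the `c` components of `D` bounds the right side by `2g_D - 2c - d₂(2g_C - 2)`,
and `c ≥ 1` since `d₂ > 0` (`mul_card_sub_mul_card_le`). If `e₂ ≤ e₁` on `S`, then `d₂|S| = ∑ e₂ ≤ ∑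
e₁ ≤ d₁|S|`, the middle sums running over `π₂⁻¹(S)`: this forces `S = ∅` when `d₁ < d₂`, and
equality throughout when `d₁ ≤ d₂` (`eq_of_le_of_decreasing`). The remaining claims follow by
exchanging `π₁` and `π₂`.

Two facts about curves are needed, `∑ e = deg` (`Place.sum_ram`) and the inequality half of
Riemann-Hurwitz (`hurwitz`). Both are proved for a finite separable extension `F/E` of function
fields over an algebraically closed field, points being valuation rings. Differentials and
Riemann-Roch are avoided: `hurwitz` compares Euler characteristics of families of lattices in `F`
over the places of `E`. The integral closures `L` have `χ(L) = 1 - g_F`; the lattices `L₀` spanned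
by a basis and their trace duals both have `χ = [F:E](1 - g_E)`. Local duality
(`relLength_dualSubmodule_le`) gives `χ(L) + χ(L^∨) ≤ χ(L₀) + χ(L₀^∨)`, and `χ(L^∨) - χ(L)` is the
degree of the different, at least `∑ (e - 1)` even under wild ramification (`sum_ram_sub_one_le`).
The same argument, started from `K(t)`, shows that the genus is finite.

Curves are brought to this setting as follows. Smoothness gives étale coordinates, hence discrete
valuation rings as local rings at the non-generic points, and a function field finite separable over
`k(t)`. Properness identifies closed points with places (`closedPointsEquiv`). Passing from `k` to
`K` preserves degree and separability (`isFieldBaseChange`, `IsFieldBaseChange.finrank_eq`). -/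

noncomputable section

namespace CurveCorr

/-! ### Relative lengths of subspaces. -/

section RelLength

variable {K X Y : Type*} [Field K] [AddCommGroup X] [Module K X] [AddCommGroup Y] [Module K Y]

/-- The length of `N / (M ∩ N)`. -/
def relLength (M N : Submodule K X) : ℕ∞ := Module.length K (N ⧸ M.comap N.subtype)

lemma relLength_eq_length_of_surjective {M N : Submodule K X} (φ : N →ₗ[K] Y)
    (hφ : Function.Surjective φ) (h : ∀ x : N, φ x = 0 ↔ (x : X) ∈ M) :
    relLength M N = Module.length K Y := by
  have hk : LinearMap.ker φ = M.comap N.subtype := by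
    ext x
    simp [h]
  rw [relLength, ← hk]
  exact (φ.quotKerEquivOfSurjective hφ).length_eq

/-- Transport of relative lengths along a linear map. -/
lemma relLength_eq_of_map (φ : X →ₗ[K] Y) {M N : Submodule K X} {M' N' : Submodule K Y}
    (h₁ : ∀ x ∈ N, φ x ∈ N') (h₂ : ∀ x ∈ N, φ x ∈ M' ↔ x ∈ M)
    (h₃ : ∀ y ∈ N', ∃ x ∈ N, y - φ x ∈ M') : relLength M N = relLength M' N' := by
  refine relLength_eq_length_of_surjective ((M'.comap N'.subtype).mkQ ∘ₗ φ.restrict h₁) ?_ ?_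
  · intro y
    obtain ⟨⟨y, hy⟩, rfl⟩ := Submodule.mkQ_surjective _ y
    obtain ⟨x, hx, hxy⟩ := h₃ y hy
    refine ⟨⟨x, hx⟩, ?_⟩
    rw [LinearMap.comp_apply, ← sub_eq_zero, ← map_sub, Submodule.mkQ_apply,
      Submodule.Quotient.mk_eq_zero, ← neg_mem_iff]
    simpa [neg_sub] using hxy
  · rintro ⟨x, hx⟩
    simp [LinearMap.restrict_apply, h₂ x hx]

lemma relLength_inf_left (M N : Submodule K X) : relLength (M ⊓ N) N = relLength M N := by
  unfold relLength
  have : (M ⊓ N).comap N.subtype = M.comap N.subtype := by ext; simp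
  rw [this]

lemma relLength_sup_right (M N : Submodule K X) : relLength M (M ⊔ N) = relLength M N := by
  refine (relLength_eq_of_map LinearMap.id (fun x hx => Submodule.mem_sup_right hx)
    (fun x _ => Iff.rfl) fun y hy => ?_).symm
  obtain ⟨m, hm, n, hn, rfl⟩ := Submodule.mem_sup.mp hy
  exact ⟨n, hn, by simpa using hm⟩

lemma relLength_self_of_le {M N : Submodule K X} (h : N ≤ M) : relLength M N = 0 := by
  rw [relLength, Submodule.comap_subtype_eq_top.mpr h]
  exact Module.length_eq_zero

lemma relLength_mono_left {M M' N : Submodule K X} (h : M ≤ M') :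
    relLength M' N ≤ relLength M N :=
  Module.length_le_of_surjective (Submodule.factor (Submodule.comap_mono h))
    (Submodule.factor_surjective _)

lemma relLength_le_of_map (φ : X →ₗ[K] Y) {M N : Submodule K X} {M' N' : Submodule K Y}
    (h₁ : ∀ x ∈ N, φ x ∈ N') (h₂ : ∀ x ∈ N, φ x ∈ M' → x ∈ M) :
    relLength M N ≤ relLength M' N' := by
  have h : relLength M N ≤ relLength (M'.comap φ) N := by
    rw [← relLength_inf_left (M'.comap φ)]
    exact relLength_mono_left fun x hx => h₂ x hx.2 hx.1
  refine h.trans (Module.length_le_of_injective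
    (Submodule.mapQ _ (M'.comap N'.subtype) (φ.restrict h₁)
      (show _ ≤ Submodule.comap _ _ from fun x hx => hx)) ?_)
  rw [← LinearMap.ker_eq_bot, LinearMap.ker_eq_bot']
  intro y hy
  obtain ⟨y, rfl⟩ := Submodule.Quotient.mk_surjective _ y
  rw [Submodule.mapQ_apply, Submodule.Quotient.mk_eq_zero] at hy
  exact (Submodule.Quotient.mk_eq_zero _).mpr hy

lemma relLength_add {M N P : Submodule K X} (h : M ≤ N) (h' : N ≤ P) :
    relLength M P = relLength M N + relLength N P := by
  refine Module.length_eq_add_of_exact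
    (Submodule.mapQ (M.comap N.subtype) (M.comap P.subtype) (Submodule.inclusion h')
      (show _ ≤ Submodule.comap _ _ from fun x hx => hx))
    (Submodule.factor (Submodule.comap_mono h)) ?_ (Submodule.factor_surjective _) ?_
  · rw [← LinearMap.ker_eq_bot, LinearMap.ker_eq_bot']
    intro y hy
    obtain ⟨y, rfl⟩ := Submodule.Quotient.mk_surjective _ y
    rw [Submodule.mapQ_apply, Submodule.Quotient.mk_eq_zero] at hy
    exact (Submodule.Quotient.mk_eq_zero _).mpr hy
  · intro y
    obtain ⟨⟨y, hy⟩, rfl⟩ := Submodule.Quotient.mk_surjective _ y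
    rw [← Submodule.mkQ_apply, Submodule.factor_mk, Submodule.mkQ_apply,
      Submodule.Quotient.mk_eq_zero]
    constructor
    · exact fun hy' => ⟨Submodule.Quotient.mk ⟨y, hy'⟩, rfl⟩
    · rintro ⟨z, hz⟩
      obtain ⟨z, rfl⟩ := Submodule.Quotient.mk_surjective _ z
      rw [Submodule.mapQ_apply, Submodule.mkQ_apply, Submodule.Quotient.eq] at hz
      have : y = z.1 - (z.1 - y) := by simp
      change y ∈ N
      rw [this]
      exact sub_mem z.2 (h hz)

/-- Additivity of the index of a pair of subspaces in the first subspace. -/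
lemma relLength_euler {Λ Λ' A : Submodule K X} (W : Submodule K X) (h : Λ ≤ Λ') (h' : Λ' ≤ A)
    (hW : W ≤ A) :
    relLength ⊥ (Λ' ⊓ W) + relLength (Λ ⊔ W) A =
      relLength ⊥ (Λ ⊓ W) + relLength Λ Λ' + relLength (Λ' ⊔ W) A := by
  have e₁ : relLength (Λ ⊔ W) A = relLength (Λ ⊔ W) (Λ' ⊔ W) + relLength (Λ' ⊔ W) A :=
    relLength_add (sup_le_sup_right h W) (sup_le h' hW)
  -- The step from `Λ` to `Λ'` is cut at `Λ ⊔ (Λ' ⊓ W)`: the lower piece is the growth of the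
  -- intersection with `W` (`e₃`), the upper one the growth of the sum with `W` (`e₄`, by the
  -- modular law).
  have e₂ : relLength Λ Λ' = relLength Λ (Λ ⊔ (Λ' ⊓ W)) + relLength (Λ ⊔ (Λ' ⊓ W)) Λ' :=
    relLength_add le_sup_left (sup_le h inf_le_left)
  have e₃ : relLength Λ (Λ ⊔ (Λ' ⊓ W)) = relLength (Λ ⊓ W) (Λ' ⊓ W) := by
    rw [relLength_sup_right, ← relLength_inf_left]
    congr 1
    rw [← inf_assoc, inf_eq_left.mpr h]
  have e₄ : relLength (Λ ⊔ (Λ' ⊓ W)) Λ' = relLength (Λ ⊔ W) (Λ' ⊔ W) := by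
    have e : Λ' ⊔ W = (Λ ⊔ W) ⊔ Λ' := by
      rw [sup_right_comm, sup_eq_right.mpr h]
    rw [e, relLength_sup_right, ← relLength_inf_left (Λ ⊔ W)]
    congr 1
    rw [inf_comm Λ' W, sup_inf_assoc_of_le W h]
  have e₅ : relLength ⊥ (Λ' ⊓ W) = relLength ⊥ (Λ ⊓ W) + relLength (Λ ⊓ W) (Λ' ⊓ W) :=
    relLength_add bot_le (inf_le_inf_right W h)
  rw [e₁, e₂, e₃, e₄, e₅]
  ring

lemma relLength_pi {P : Type*} {L L' : P → Submodule K X} (s : Finset P)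
    (hs : ∀ p ∉ s, L' p ≤ L p) :
    relLength (Submodule.pi Set.univ L) (Submodule.pi Set.univ L') =
      ∑ p ∈ s, relLength (L p) (L' p) := by
  classical
  rw [← Finset.sum_coe_sort, show ∑ p : s, relLength (L p) (L' p) =
    Module.length K (∀ p : s, (L' p) ⧸ (L p).comap (L' p).subtype) from
      (Module.length_pi_of_fintype ..).symm]
  refine relLength_eq_length_of_surjective
    (LinearMap.pi fun p : s => ((L p).comap (L' p).subtype).mkQ ∘ₗ
      ((LinearMap.proj p.1).restrict fun x hx => hx p.1 trivial)) ?_ ?_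
  · intro y
    choose z hz using fun p => Submodule.mkQ_surjective _ (y p)
    refine ⟨⟨fun p => if hp : p ∈ s then z ⟨p, hp⟩ else 0, fun p _ => ?_⟩, ?_⟩
    · dsimp only
      split_ifs with hp
      · exact (z ⟨p, hp⟩).2
      · exact zero_mem _
    · ext p
      rw [← hz p]
      simp only [LinearMap.pi_apply, LinearMap.comp_apply]
      congr 1
      exact Subtype.ext (dif_pos p.2)
  · rintro ⟨x, hx⟩
    simp only [LinearMap.pi_apply, funext_iff, LinearMap.comp_apply, Submodule.mkQ_apply,
      Pi.zero_apply, Submodule.Quotient.mk_eq_zero, Submodule.mem_comap, Submodule.mem_pi,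
      Submodule.subtype_apply, Subtype.forall, Set.mem_univ, true_implies]
    refine ⟨fun h p => ?_, fun h p _ => h p⟩
    by_cases hp : p ∈ s
    · exact h p hp
    · exact hs p hp (hx p trivial)

end RelLength

/-! ### Euler characteristics of families of lattices -/

section Euler

variable {K V : Type*} [Field K] [AddCommGroup V] [Module K V] {P : Type*}

/-- The restricted product of copies of `V` with respect to a family of subspaces. -/
def restricted (L : P → Submodule K V) : Submodule K (P → V) where
  carrier := {r | {p | r p ∉ L p}.Finite}
  add_mem' := by
    intro r s hr hs
    refine (hr.union hs).subset fun x hx => ?_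
    by_contra h
    simp only [Set.mem_union, Set.mem_ofPred_eq, not_or, not_not] at h
    exact hx (add_mem h.1 h.2)
  zero_mem' := by simp
  smul_mem' := by
    intro c r hr
    exact hr.subset fun x hx h => hx (Submodule.smul_mem _ c h)

lemma mem_restricted {L : P → Submodule K V} {r : P → V} :
    r ∈ restricted L ↔ {p | r p ∉ L p}.Finite := Iff.rfl

lemma pi_le_restricted (L : P → Submodule K V) : Submodule.pi Set.univ L ≤ restricted L := by
  intro r hr
  have : {p | r p ∉ L p} = ∅ := by
    ext p
    simpa using hr p trivial
  rw [mem_restricted, this]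
  exact Set.finite_empty

lemma restricted_congr {L L' : P → Submodule K V} {s : Set P} (hs : s.Finite)
    (h : ∀ p ∉ s, L p = L' p) : restricted L = restricted L' := by
  ext r
  simp only [mem_restricted]
  constructor <;> intro hr <;> refine (hs.union hr).subset fun p hp => ?_ <;>
    by_cases hps : p ∈ s <;> simp_all

variable (K V P) in
/-- The constant families. -/
def constants : Submodule K (P → V) :=
  LinearMap.range (LinearMap.pi fun _ : P => (LinearMap.id : V →ₗ[K] V))

lemma mem_constants {r : P → V} : r ∈ constants K V P ↔ ∃ v, (fun _ => v) = r := Iff.rfl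

/-- The dimension of the space of global sections of a family of lattices. -/
def hZero (L : P → Submodule K V) : ℕ∞ := relLength ⊥ (Submodule.pi Set.univ L ⊓ constants K V P)

/-- The dimension of the first cohomology of a family of lattices. -/
def hOne (L : P → Submodule K V) : ℕ∞ :=
  relLength (Submodule.pi Set.univ L ⊔ constants K V P) (restricted L)

/-- Every vector lies in almost all members of the family. -/
def AlmostAll (L : P → Submodule K V) : Prop := ∀ v : V, {p | v ∉ L p}.Finite

lemma AlmostAll.constants_le {L : P → Submodule K V} (h : AlmostAll L) :
    constants K V P ≤ restricted L := by
  rintro _ ⟨v, rfl⟩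
  exact h v

/-- Additivity of the Euler characteristic. -/
lemma hZero_add_hOne {L L' : P → Submodule K V} (h : ∀ p, L p ≤ L' p) (s : Finset P)
    (hs : ∀ p ∉ s, L p = L' p) (hL : AlmostAll L) :
    hZero L' + hOne L = hZero L + ∑ p ∈ s, relLength (L p) (L' p) + hOne L' := by
  -- Changing finitely many members leaves the restricted product unchanged, so both `hOne` are
  -- indices in the same ambient space.
  have e : restricted L' = restricted L :=
    (restricted_congr s.finite_toSet fun p hp => hs p hp).symm
  have hLL' : Submodule.pi Set.univ L ≤ Submodule.pi Set.univ L' := fun r hr p hp => h p (hr p hp)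
  rw [hZero, hOne, hZero, hOne, e, ← relLength_pi s fun p hp => (hs p hp).ge]
  exact relLength_euler _ hLL' (e ▸ pi_le_restricted L') hL.constants_le

lemma pi_relLength_const_eq {ι : Type*} [Fintype ι] {X : Type*} [AddCommGroup X] [Module K X]
    (M N : Submodule K X) :
    relLength (Submodule.pi Set.univ fun _ : ι => M) (Submodule.pi Set.univ fun _ : ι => N) =
      Fintype.card ι * relLength M N := by
  classical
  rw [relLength_pi Finset.univ (by simp)]
  simp

variable {Q V' : Type*} [AddCommGroup V'] [Module K V']

/-- Transport of cohomology along a map of index sets and of vector spaces. -/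
lemma hOne_eq_of_map {L : P → Submodule K V} {L' : Q → Submodule K V'}
    (e : V ≃ₗ[K] V') (σ : Q → P) (hσ : ∀ p, (σ ⁻¹' {p}).Finite)
    (hL : ∀ v p, v ∈ L p ↔ ∀ q, σ q = p → e v ∈ L' q)
    (happrox : ∀ p (r : Q → V'), (∃ q, σ q = p ∧ r q ∉ L' q) →
      ∃ v, ∀ q, σ q = p → r q - e v ∈ L' q) :
    hOne L = hOne L' := by
  refine relLength_eq_of_map (LinearMap.pi fun q => e.toLinearMap ∘ₗ LinearMap.proj (σ q))
    ?_ ?_ ?_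
  · intro r hr
    rw [mem_restricted] at hr ⊢
    refine (hr.biUnion fun p _ => hσ p).subset fun q hq => ?_
    simp only [Set.mem_iUnion]
    exact ⟨σ q, fun h => hq ((hL _ _).mp h q rfl), rfl⟩
  · intro r _
    constructor
    · intro h
      obtain ⟨a, ha, b, ⟨v, rfl⟩, hab⟩ := Submodule.mem_sup.mp h
      refine Submodule.mem_sup.mpr ⟨r - (fun _ => e.symm v), fun p _ => ?_, fun _ => e.symm v,
        ⟨_, rfl⟩, by simp⟩
      refine (hL _ _).mpr ?_
      rintro q rfl
      have := congrFun hab q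
      simp only [Pi.add_apply, LinearMap.pi_apply, LinearMap.id_apply, LinearMap.comp_apply,
        LinearMap.proj_apply, LinearEquiv.coe_coe] at this
      simp only [Pi.sub_apply, map_sub, LinearEquiv.apply_symm_apply, ← this, add_sub_cancel_right]
      exact ha q trivial
    · intro h
      obtain ⟨a, ha, b, ⟨v, rfl⟩, rfl⟩ := Submodule.mem_sup.mp h
      rw [map_add]
      refine Submodule.add_mem_sup (fun q _ => ?_) ⟨e v, by ext; simp⟩
      exact (hL _ _).mp (ha (σ q) trivial) q rfl
  · intro r hr
    classical
    choose v hv using fun p (h : ∃ q, σ q = p ∧ r q ∉ L' q) => happrox p r h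
    -- Correcting only over those `p` with an irregular `q` above keeps the family in the restricted
    -- product; over the other `p` the value `0` suffices.
    refine ⟨fun p => if h : ∃ q, σ q = p ∧ r q ∉ L' q then v p h else 0, ?_, ?_⟩
    · rw [mem_restricted] at hr ⊢
      refine (hr.image σ).subset fun p hp => ?_
      by_contra h
      have h' : ¬ ∃ q, σ q = p ∧ r q ∉ L' q := fun ⟨q, hq, hq'⟩ => h ⟨q, hq', hq⟩
      exact hp (by simp [dif_neg h'])
    · refine Submodule.mem_sup_left fun q _ => ?_
      simp only [Pi.sub_apply, LinearMap.pi_apply, LinearMap.comp_apply, LinearMap.proj_apply,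
        LinearEquiv.coe_coe]
      split_ifs with h
      · exact hv (σ q) h q rfl
      · simpa using not_exists.mp h q

lemma hZero_eq_of_map {L : P → Submodule K V} {L' : Q → Submodule K V'} [Nonempty P]
    (e : V ≃ₗ[K] V') (σ : Q → P) (hσ : Function.Surjective σ)
    (hL : ∀ v p, v ∈ L p ↔ ∀ q, σ q = p → e v ∈ L' q) :
    hZero L = hZero L' := by
  refine relLength_eq_of_map (LinearMap.pi fun q => e.toLinearMap ∘ₗ LinearMap.proj (σ q))
    ?_ ?_ ?_
  · rintro _ ⟨hr, ⟨v, rfl⟩⟩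
    exact ⟨fun q _ => (hL _ _).mp (hr (σ q) trivial) q rfl, ⟨e v, by ext; simp⟩⟩
  · intro r _
    simp only [Submodule.mem_bot, funext_iff, LinearMap.pi_apply, LinearMap.comp_apply,
      LinearMap.proj_apply, LinearEquiv.coe_coe, Pi.zero_apply, map_eq_zero_iff e e.injective]
    exact ⟨fun h p => by obtain ⟨q, rfl⟩ := hσ p; exact h q, fun h q => h _⟩
  · rintro _ ⟨hr, ⟨v, rfl⟩⟩
    refine ⟨fun _ => e.symm v, ⟨fun p _ => (hL _ _).mpr fun q _ => ?_, ⟨_, rfl⟩⟩, ?_⟩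
    · simpa using hr q trivial
    · rw [Submodule.mem_bot]
      ext
      simp

/-- A family of product lattices in `ι → V`. -/
lemma hZero_pi {ι : Type*} [Fintype ι] (L : P → Submodule K V) :
    hZero (fun p => Submodule.pi Set.univ fun _ : ι => L p) = Fintype.card ι * hZero L := by
  rw [hZero, hZero, ← pi_relLength_const_eq]
  refine relLength_eq_of_map (LinearMap.pi fun i => LinearMap.pi fun p =>
    (LinearMap.proj i : (ι → V) →ₗ[K] V) ∘ₗ (LinearMap.proj p : (P → ι → V) →ₗ[K] ι → V)) ?_ ?_ ?_
  · rintro _ ⟨hr, ⟨v, rfl⟩⟩ i _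
    exact ⟨fun p _ => hr p trivial i trivial, ⟨v i, rfl⟩⟩
  · intro r _
    simp only [Submodule.mem_pi, Set.mem_univ, true_implies, Submodule.mem_bot, funext_iff]
    exact ⟨fun h p i => h i p, fun h i p => h p i⟩
  · intro r hr
    choose hr v hv using fun i => hr i trivial
    refine ⟨fun p i => r i p, ⟨fun p _ i _ => hr i p trivial, ⟨v, ?_⟩⟩, ?_⟩
    · ext p i
      exact congrFun (hv i) p
    · exact (sub_self r).symm ▸ zero_mem (Submodule.pi Set.univ fun _ : ι => _)

lemma hOne_pi {ι : Type*} [Fintype ι] (L : P → Submodule K V) :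
    hOne (fun p => Submodule.pi Set.univ fun _ : ι => L p) = Fintype.card ι * hOne L := by
  rw [hOne, hOne, ← pi_relLength_const_eq]
  refine relLength_eq_of_map (LinearMap.pi fun i => LinearMap.pi fun p =>
    (LinearMap.proj i : (ι → V) →ₗ[K] V) ∘ₗ (LinearMap.proj p : (P → ι → V) →ₗ[K] ι → V)) ?_ ?_ ?_
  · intro r hr i _
    exact (mem_restricted.mp hr).subset fun p hp h => hp (h i trivial)
  · intro r _
    constructor
    · intro h
      choose a ha b hb hab using fun i => Submodule.mem_sup.mp (h i trivial)
      choose v hv using hb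
      refine Submodule.mem_sup.mpr ⟨fun p i => a i p, fun p _ i _ => ha i p trivial,
        fun p i => b i p, ⟨v, ?_⟩, ?_⟩
      · ext p i
        exact congrFun (hv i) p
      · ext p i
        exact congrFun (hab i) p
    · intro h
      obtain ⟨a, ha, b, ⟨v, rfl⟩, rfl⟩ := Submodule.mem_sup.mp h
      intro i _
      exact Submodule.mem_sup.mpr ⟨fun p => a p i, fun p _ => ha p trivial i trivial,
        fun _ => v i, ⟨v i, rfl⟩, rfl⟩
  · intro r hr
    refine ⟨fun p i => r i p, ?_, ?_⟩
    · rw [mem_restricted]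
      refine (Set.finite_iUnion fun i => mem_restricted.mp (hr i trivial)).subset fun p hp => ?_
      by_contra h
      simp only [Set.mem_iUnion, Set.mem_ofPred_eq, not_exists, not_not] at h
      exact hp fun i _ => h i
    · exact (sub_self r).symm ▸ zero_mem (Submodule.pi Set.univ fun _ : ι => _)

end Euler

/-! ### Places of fields -/

/-- A valuation ring contained in a valuation subring that dominates it fills it up. -/
lemma exists_algebraMap_eq_of_dominates {R F : Type*} [CommRing R] [IsDomain R] [ValuationRing R]
    [Field F] [Algebra R F] [IsFractionRing R F] (V : ValuationSubring F)
    (h : ∀ r ∈ IsLocalRing.maximalIdeal R, algebraMap R F r ∈ V.nonunits) {x : F} (hx : x ∈ V) :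
    ∃ r : R, algebraMap R F r = x := by
  rcases ValuationRing.isInteger_or_isInteger R x with ⟨r, hr⟩ | ⟨r, hr⟩
  · exact ⟨r, hr⟩
  · by_cases hu : IsUnit r
    · obtain ⟨u, rfl⟩ := hu
      refine ⟨(u⁻¹ : Rˣ), ?_⟩
      have h₁ : algebraMap R F u * algebraMap R F (u⁻¹ : Rˣ) = 1 := by
        rw [← map_mul, Units.mul_inv, map_one]
      rw [hr] at h₁
      exact (eq_of_inv_mul_eq_one h₁).symm
    · have h₁ := h r ((IsLocalRing.mem_maximalIdeal r).mpr hu)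
      rw [hr, ValuationSubring.mem_nonunits_iff, map_inv₀] at h₁
      have h₂ := (V.valuation_le_one_iff x).mpr hx
      by_cases hx0 : x = 0
      · exact ⟨0, by rw [hx0, map_zero]⟩
      · have h₃ : 0 < V.valuation x := zero_lt_iff.mpr ((map_ne_zero _).mpr hx0)
        exact absurd h₂ (not_le.mpr ((inv_lt_one₀ h₃).mp h₁))

lemma _root_.ValuationSubring.mem_of_isIntegral {F : Type*} [Field F] (V : ValuationSubring F)
    {x : F} (hx : IsIntegral V x) : x ∈ V := by
  obtain ⟨y, rfl⟩ := IsIntegrallyClosed.isIntegral_iff.mp hx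
  exact y.2

/-- A place of `F` over `K`: a valuation ring of `F` containing `K` and different from `F`. -/
@[ext]
structure Place (K F : Type*) [Field K] [Field F] [Algebra K F] where
  /-- the valuation ring -/
  ring : ValuationSubring F
  algebraMap_mem : ∀ a : K, algebraMap K F a ∈ ring
  ne_top : ring ≠ ⊤

namespace Place

variable {K F : Type*} [Field K] [Field F] [Algebra K F]

/-- The valuation ring of a place as a subspace. -/
def lattice (w : Place K F) : Submodule K F where
  carrier := w.ring
  add_mem' := w.ring.add_mem _ _
  zero_mem' := w.ring.zero_mem
  smul_mem' c x hx := by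
    rw [Algebra.smul_def]
    exact w.ring.mul_mem _ _ (w.algebraMap_mem c) hx

lemma exists_notMem (w : Place K F) : ∃ x, x ∉ w.ring := by
  by_contra! h
  exact w.ne_top (SetLike.ext fun x => ⟨fun _ => ValuationSubring.mem_top x, fun _ => h x⟩)

/-- If a nonunit of `V` became invertible in `W`, so would the uniformizer, and `W` would be all of
`F`. Hence `W` dominates `V`, and a valuation ring has no proper domination. -/
lemma eq_of_le {V : Place K F} [IsDiscreteValuationRing V.ring] {W : Place K F}
    (h : V.ring ≤ W.ring) : V = W := by
  have key : ∀ r ∈ IsLocalRing.maximalIdeal V.ring, algebraMap V.ring F r ∈ W.ring.nonunits := by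
    intro r hr
    by_contra hn
    obtain ⟨ϖ, hϖ⟩ := IsDiscreteValuationRing.exists_irreducible V.ring
    have hϖ0 : (ϖ : F) ≠ 0 := by simpa using hϖ.ne_zero
    have hrW : (algebraMap V.ring F r)⁻¹ ∈ W.ring := by
      rw [ValuationSubring.mem_nonunits_iff, not_lt] at hn
      rw [← W.ring.valuation_le_one_iff, map_inv₀]
      exact inv_le_one_of_one_le₀ hn
    rw [hϖ.maximalIdeal_eq, Ideal.mem_span_singleton] at hr
    obtain ⟨s, rfl⟩ := hr
    have hs0 : (s : F) ≠ 0 := by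
      rintro hs
      have : (s : V.ring) = 0 := by exact_mod_cast hs
      rw [this] at hn
      simp at hn
    have hinv : (ϖ : F)⁻¹ ∈ W.ring := by
      have : (ϖ : F)⁻¹ = (algebraMap V.ring F (ϖ * s))⁻¹ * s := by
        change _ = ((ϖ : F) * s)⁻¹ * s
        field_simp
      rw [this]
      exact W.ring.mul_mem _ _ hrW (h s.2)
    obtain ⟨y, hy⟩ := W.exists_notMem
    refine hy ?_
    rcases V.ring.mem_or_inv_mem y with hyV | hyV
    · exact h hyV
    · by_cases hy0 : y = 0
      · rw [hy0]
        exact W.ring.zero_mem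
      · obtain ⟨n, u, hu⟩ := IsDiscreteValuationRing.eq_unit_mul_pow_irreducible
          (x := (⟨y⁻¹, hyV⟩ : V.ring)) (by simpa [Subtype.ext_iff] using hy0) hϖ
        have hu' : y⁻¹ = (u : V.ring) * (ϖ : F) ^ n := congrArg Subtype.val hu
        have huu : ((u : V.ring) : F) * ((u⁻¹ : V.ringˣ) : V.ring) = 1 := by
          exact_mod_cast u.mul_inv
        have : y = ((u⁻¹ : V.ringˣ) : V.ring) * ((ϖ : F)⁻¹) ^ n := by
          rw [← inv_inv y, hu', mul_inv, inv_pow, eq_inv_of_mul_eq_one_right huu]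
        rw [this]
        exact W.ring.mul_mem _ _ (h (Subtype.prop _)) (pow_mem hinv n)
  refine Place.ext (le_antisymm h fun x hx => ?_)
  obtain ⟨r, rfl⟩ := exists_algebraMap_eq_of_dominates (R := V.ring) W.ring key hx
  exact r.2

section Comap

variable (E : Type*) [Field E] [Algebra K E] [Algebra E F] [IsScalarTower K E F]
  [Algebra.IsAlgebraic E F]

/-- The restriction of a place to a subfield. -/
def comap (w : Place K F) : Place K E where
  ring := w.ring.comap (algebraMap E F)
  algebraMap_mem a := by
    rw [ValuationSubring.mem_comap, ← IsScalarTower.algebraMap_apply]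
    exact w.algebraMap_mem a
  ne_top h := by
    obtain ⟨x, hx⟩ := w.exists_notMem
    have hE : ∀ y : E, algebraMap E F y ∈ w.ring := fun y => by
      rw [← ValuationSubring.mem_comap, h]
      exact ValuationSubring.mem_top y
    -- `F` is algebraic over `E`: a valuation ring containing `E` would, being integrally closed,
    -- contain `F`.
    refine hx (w.ring.mem_of_isIntegral ?_)
    exact (Algebra.IsIntegral.isIntegral (R := E) x).map_of_comp_eq
      ((algebraMap E F).codRestrict w.ring.toSubring hE) (RingHom.id F) rfl

variable {E}

lemma mem_comap {w : Place K F} {x : E} : x ∈ (w.comap E).ring ↔ algebraMap E F x ∈ w.ring :=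
  Iff.rfl

/-- The ramification index of a place over its restriction. -/
def ram (E : Type*) [Field E] [Algebra E F] (w : Place K F) : ℕ :=
  sSup {n | ∀ (x : E) (hx : algebraMap E F x ∈ w.ring),
    ¬ IsUnit (⟨_, hx⟩ : w.ring) → (⟨_, hx⟩ : w.ring) ∈ IsLocalRing.maximalIdeal w.ring ^ n}

end Comap

end Place

/-- The properties of the places of an algebraic function field in one variable over an
algebraically closed field. -/
class IsCurveField (K F : Type*) [Field K] [Field F] [Algebra K F] : Prop where
  dvr (w : Place K F) : IsDiscreteValuationRing w.ring
  residue (w : Place K F) : ∀ x ∈ w.ring, ∃ a : K, x - algebraMap K F a ∈ w.ring.nonunits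
  finite (x : F) : {w : Place K F | x ∉ w.ring}.Finite

attribute [instance] IsCurveField.dvr

namespace Place

variable {K E F : Type*} [Field K] [Field E] [Field F] [Algebra K E] [Algebra K F]
  [Algebra E F] [IsScalarTower K E F] [FiniteDimensional E F]

/-! ### Places above a given place and primes of the integral closure. -/

section Separable

variable [Algebra.IsSeparable E F]

variable (F) in
/-- The integral closure of the valuation ring of a place in an extension. -/
abbrev intCl (v : Place K E) : Subalgebra v.ring F := integralClosure v.ring F

variable (v : Place K E) [IsDiscreteValuationRing v.ring]

instance : IsDedekindDomain (v.intCl F) := integralClosure.isDedekindDomain v.ring E F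

instance : IsFractionRing (v.intCl F) F :=
  integralClosure.isFractionRing_of_finite_extension E F

instance : Module.Finite v.ring (v.intCl F) := IsIntegralClosure.finite v.ring E F _

instance : Module.Free v.ring (v.intCl F) := IsIntegralClosure.module_free v.ring E F _

variable {v}

omit [FiniteDimensional E F] [IsDiscreteValuationRing v.ring] in
lemma intCl_le {w : Place K F} (hw : w.comap E = v) (b : v.intCl F) : (b : F) ∈ w.ring := by
  refine w.ring.mem_of_isIntegral ?_
  have h : ∀ y : v.ring, algebraMap v.ring F y ∈ w.ring := fun y =>
    (congrArg Place.ring hw).ge y.2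
  exact b.2.map_of_comp_eq ((algebraMap v.ring F).codRestrict w.ring.toSubring h)
    (RingHom.id F) rfl

/-- The inclusion of the integral closure in the valuation ring of a place above. -/
def intClToRing {w : Place K F} (hw : w.comap E = v) : v.intCl F →+* w.ring :=
  (algebraMap (v.intCl F) F).codRestrict w.ring.toSubring (intCl_le hw)

/-- The center of a place on the integral closure. -/
def center {w : Place K F} (hw : w.comap E = v) : Ideal (v.intCl F) :=
  (IsLocalRing.maximalIdeal w.ring).comap (intClToRing hw)

instance {w : Place K F} (hw : w.comap E = v) : (center hw).IsPrime :=
  Ideal.IsPrime.comap _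

omit [FiniteDimensional E F] [IsDiscreteValuationRing v.ring] in
lemma mem_center {w : Place K F} (hw : w.comap E = v) (b : v.intCl F) :
    b ∈ center hw ↔ (b : F) ∈ w.ring.nonunits := by
  rw [center, Ideal.mem_comap, ValuationSubring.mem_nonunits_iff_exists_mem_maximalIdeal]
  constructor
  · exact fun h => ⟨intCl_le hw b, h⟩
  · exact fun ⟨_, h⟩ => h

omit [IsDiscreteValuationRing v.ring] in
-- Otherwise every nonzero integral element would be invertible at `w`, and `w.ring` would contain
-- their quotients, that is all of `F`.
lemma center_ne_bot {w : Place K F} (hw : w.comap E = v) : center hw ≠ ⊥ := by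
  intro h
  obtain ⟨x, hx⟩ := w.exists_notMem
  obtain ⟨a, b, hb, rfl⟩ := IsFractionRing.div_surjective (A := v.intCl F) x
  have hb0 : b ≠ 0 := nonZeroDivisors.ne_zero hb
  have : b ∉ center hw := by
    rw [h]
    exact hb0
  rw [mem_center, ValuationSubring.mem_nonunits_iff, not_lt] at this
  refine hx ?_
  rw [div_eq_mul_inv]
  refine w.ring.mul_mem _ _ (intCl_le hw a) ?_
  rw [← w.ring.valuation_le_one_iff, map_inv₀]
  exact inv_le_one_of_one_le₀ this

/-- The localization of the Dedekind domain at the center is a discrete valuation ring dominated by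
`w.ring`, hence fills it up. -/
lemma exists_div_of_mem {w : Place K F} (hw : w.comap E = v) {x : F} (hx : x ∈ w.ring) :
    ∃ a b : v.intCl F, b ∉ center hw ∧ x * b = a := by
  let S := (center hw).primeCompl
  have hS : S ≤ nonZeroDivisors (v.intCl F) := (center hw).primeCompl_le_nonZeroDivisors
  let R := Localization.subalgebra.ofField F S hS
  have : IsLocalization.AtPrime R (center hw) :=
    inferInstanceAs (IsLocalization S (Localization.subalgebra.ofField F S hS))
  have : IsDiscreteValuationRing R :=
    IsLocalization.AtPrime.isDiscreteValuationRing_of_dedekind_domain _ (center_ne_bot hw) R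
  have : IsLocalRing R := IsLocalization.AtPrime.isLocalRing R (center hw)
  have hR : ∀ r : R, ∃ a b : v.intCl F, b ∉ center hw ∧ (r : F) * b = a ∧
      (r ∈ IsLocalRing.maximalIdeal R → a ∈ center hw) := by
    intro r
    obtain ⟨⟨a, b⟩, h⟩ := IsLocalization.surj (M := S) r
    refine ⟨a, b, b.2, congrArg Subtype.val h, fun hr => ?_⟩
    rw [← IsLocalization.AtPrime.to_map_mem_maximal_iff R (center hw), ← h]
    exact Ideal.mul_mem_right _ _ hr
  have key : ∀ r ∈ IsLocalRing.maximalIdeal R, algebraMap R F r ∈ w.ring.nonunits := by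
    intro r hr
    obtain ⟨a, b, hb, h, ha⟩ := hR r
    have ha := (mem_center hw a).mp (ha hr)
    rw [mem_center, ValuationSubring.mem_nonunits_iff, not_lt] at hb
    rw [ValuationSubring.mem_nonunits_iff, ← h, map_mul] at ha
    rw [ValuationSubring.mem_nonunits_iff]
    exact lt_of_le_of_lt (le_mul_of_one_le_right' hb) ha
  obtain ⟨r, rfl⟩ := exists_algebraMap_eq_of_dominates (R := R) w.ring key hx
  obtain ⟨a, b, hb, h, -⟩ := hR r
  exact ⟨a, b, hb, h⟩

lemma isLocalization_center {w : Place K F} (hw : w.comap E = v) :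
    letI := (intClToRing hw).toAlgebra
    IsLocalization.AtPrime w.ring (center hw) := by
  let := (intClToRing hw).toAlgebra
  refine (isLocalization_iff _ _).mpr ⟨fun b => ?_, fun x => ?_, fun {x y} h => ⟨1, ?_⟩⟩
  · by_contra h
    exact b.2 ((IsLocalRing.mem_maximalIdeal _).mpr h)
  · obtain ⟨a, b, hb, h⟩ := exists_div_of_mem hw x.2
    exact ⟨⟨a, b, hb⟩, Subtype.ext h⟩
  · have : x = y := Subtype.ext (congrArg (Subtype.val : w.ring → F) h)
    rw [this]

lemma isDiscreteValuationRing {w : Place K F} (hw : w.comap E = v) :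
    IsDiscreteValuationRing w.ring := by
  let := (intClToRing hw).toAlgebra
  have := isLocalization_center hw
  exact IsLocalization.AtPrime.isDiscreteValuationRing_of_dedekind_domain _ (center_ne_bot hw) _

instance {w : Place K F} (hw : w.comap E = v) : (center hw).IsMaximal :=
  Ideal.IsPrime.isMaximal inferInstance (center_ne_bot hw)

lemma mem_center_pow {w : Place K F} (hw : w.comap E = v) (n : ℕ) (b : v.intCl F) :
    b ∈ center hw ^ n ↔ intClToRing hw b ∈ IsLocalRing.maximalIdeal w.ring ^ n := by
  let := (intClToRing hw).toAlgebra
  have := isLocalization_center hw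
  rw [← IsLocalization.AtPrime.under_maximalIdeal_pow (center hw) w.ring n]
  rfl

lemma eq_of_center_eq {w w' : Place K F} (hw : w.comap E = v) (hw' : w'.comap E = v)
    (h : center hw = center hw') : w = w' := by
  have := isDiscreteValuationRing hw
  refine eq_of_le fun x hx => ?_
  obtain ⟨a, b, hb, hab⟩ := exists_div_of_mem hw hx
  have hb0 : (b : F) ≠ 0 := by
    rintro hb0
    have : b = 0 := Subtype.ext hb0
    exact hb (this ▸ zero_mem _)
  rw [h, mem_center, ValuationSubring.mem_nonunits_iff, not_lt] at hb
  rw [eq_div_of_mul_eq hb0 hab, div_eq_mul_inv]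
  refine w'.ring.mul_mem _ _ (intCl_le hw' a) ?_
  rw [← w'.ring.valuation_le_one_iff, map_inv₀]
  exact inv_le_one_of_one_le₀ hb

omit [FiniteDimensional E F] in
-- Some valuation ring contains the integral closure and has `P` among its nonunits. It restricts to
-- `v` because `v.ring`, being discrete, cannot be enlarged, and its center contains the maximal
-- ideal `P`.
lemma exists_center_eq (P : Ideal (v.intCl F)) [hP : P.IsPrime] (hP0 : P ≠ ⊥) :
    ∃ (w : Place K F) (hw : w.comap E = v), center hw = P := by
  obtain ⟨V, hV, hPV⟩ := Ideal.image_subset_nonunits_valuationSubring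
    (A := (v.intCl F).toSubring) P hP.ne_top
  have hE : ∀ y ∈ v.ring, algebraMap E F y ∈ V := fun y hy =>
    hV ((v.intCl F).algebraMap_mem ⟨y, hy⟩)
  obtain ⟨x, hx, hx0⟩ := Submodule.exists_mem_ne_zero_of_ne_bot hP0
  have hxV : (x : F) ∈ V.nonunits := hPV ⟨x, hx, rfl⟩
  let w : Place K F :=
    { ring := V
      algebraMap_mem := fun a => by
        rw [IsScalarTower.algebraMap_apply K E F]
        exact hE _ (v.algebraMap_mem a)
      ne_top := by
        rintro rfl
        have hx0' : (x : F) ≠ 0 := fun h => hx0 (Subtype.ext h)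
        obtain ⟨h, h'⟩ := ValuationSubring.mem_nonunits_iff_exists_mem_maximalIdeal.mp hxV
        exact (IsLocalRing.mem_maximalIdeal _).mp h' (IsUnit.of_mul_eq_one
          ⟨(x : F)⁻¹, ValuationSubring.mem_top _⟩ (Subtype.ext (mul_inv_cancel₀ hx0'))) }
  have hw : w.comap E = v := (eq_of_le (V := v) (W := w.comap E) hE).symm
  have hPm : P.IsMaximal := hP.isMaximal hP0
  refine ⟨w, hw, (hPm.eq_of_le (Ideal.IsPrime.ne_top inferInstance) fun b hb => ?_).symm⟩
  exact (mem_center hw b).mpr (hPV ⟨b, hb, rfl⟩)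

variable (v)

lemma maximalIdeal_ne_bot : IsLocalRing.maximalIdeal v.ring ≠ ⊥ :=
  IsDiscreteValuationRing.not_a_field _

variable {v}

instance {w : Place K F} (hw : w.comap E = v) :
    (center hw).LiesOver (IsLocalRing.maximalIdeal v.ring) := by
  refine ⟨(IsLocalRing.eq_maximalIdeal ?_).symm⟩
  have : ((center hw).under v.ring).IsMaximal := Ideal.IsMaximal.under _ _
  infer_instance

/-- Powers of the center are the preimages of powers of the maximal ideal of `w.ring`, so the index
may be computed in a Dedekind domain, where `∑ e f = n` is available. -/
lemma ram_eq {w : Place K F} (hw : w.comap E = v) :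
    w.ram E = Ideal.ramificationIdx' (IsLocalRing.maximalIdeal v.ring) (center hw) := by
  subst hw
  unfold ram Ideal.ramificationIdx'
  congr 1
  ext n
  simp only [Set.mem_ofPred_eq, Ideal.map_le_iff_le_comap]
  constructor
  · intro h x hx
    rw [Ideal.mem_comap, mem_center_pow]
    refine h x x.2 fun hu => (IsLocalRing.mem_maximalIdeal _).mp hx ?_
    rw [isUnit_iff_exists_inv] at hu ⊢
    obtain ⟨⟨y, hy⟩, hxy⟩ := hu
    have hxy' : algebraMap E F x * y = 1 := congrArg Subtype.val hxy
    have hy' : y = algebraMap E F (x : E)⁻¹ := by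
      rw [map_inv₀]
      exact (inv_eq_of_mul_eq_one_right hxy').symm
    have hx0 : (x : E) ≠ 0 := by
      rintro h0
      rw [h0, map_zero, zero_mul] at hxy'
      exact zero_ne_one hxy'
    exact ⟨⟨(x : E)⁻¹, by rw [mem_comap, ← hy']; exact hy⟩, Subtype.ext (mul_inv_cancel₀ hx0)⟩
  · intro h x hx hu
    have := h (x := (⟨x, hx⟩ : (w.comap E).ring)) ((IsLocalRing.mem_maximalIdeal _).mpr ?_)
    · rwa [Ideal.mem_comap, mem_center_pow] at this
    · intro hu'
      refine hu ?_
      rw [isUnit_iff_exists_inv] at hu' ⊢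
      obtain ⟨⟨y, hy⟩, hxy⟩ := hu'
      refine ⟨⟨algebraMap E F y, hy⟩, Subtype.ext ?_⟩
      have : x * y = 1 := congrArg Subtype.val hxy
      change algebraMap E F x * algebraMap E F y = 1
      rw [← map_mul, this, map_one]

end Separable

end Place

/-- `K` maps onto `A/m`, so the domain `B/P` is integral over the algebraically closed field `K` and
therefore equal to it. -/
lemma exists_sub_mem_of_isAlgClosed {K A B : Type*} [Field K] [IsAlgClosed K] [CommRing A]
    [CommRing B] [Algebra A B] [Algebra.IsIntegral A B] (ι : K →+* A) {m : Ideal A}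
    (hι : ∀ x, ∃ a, x - ι a ∈ m) (P : Ideal B) [P.IsPrime] (h : m ≤ P.comap (algebraMap A B))
    (b : B) : ∃ c, b - algebraMap A B (ι c) ∈ P := by
  have hφ : Function.Surjective ((Ideal.Quotient.mk m).comp ι) := by
    intro y
    obtain ⟨y, rfl⟩ := Ideal.Quotient.mk_surjective y
    obtain ⟨a, ha⟩ := hι y
    exact ⟨a, (Ideal.Quotient.eq.mpr ha).symm⟩
  have hψ : (Ideal.quotientMap P (algebraMap A B) h).IsIntegral := by
    refine RingHom.IsIntegral.tower_top (Ideal.Quotient.mk m) _ ?_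
    rw [Ideal.quotientMap_comp_mk]
    exact RingHom.IsIntegral.trans _ _ Algebra.IsIntegral.isIntegral
      (RingHom.isIntegral_of_surjective _ Ideal.Quotient.mk_surjective)
  obtain ⟨c, hc⟩ := (IsAlgClosed.ringHom_bijective_of_isIntegral _
    (RingHom.IsIntegral.trans _ _ (RingHom.isIntegral_of_surjective _ hφ) hψ)).2
      (Ideal.Quotient.mk _ b)
  refine ⟨c, ?_⟩
  rw [← Ideal.Quotient.eq, ← hc]
  rfl

namespace Place

variable {K E F : Type*} [Field K] [Field E] [Field F] [Algebra K E] [Algebra K F]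
  [Algebra E F] [IsScalarTower K E F] [FiniteDimensional E F] [Algebra.IsSeparable E F]

/-! ### Fibres of places: finiteness, approximation, fundamental identity, residue fields. -/

section Fibre

variable (v : Place K E) [IsDiscreteValuationRing v.ring]

variable (F) in
/-- The places above a place correspond to the maximal ideals of the integral closure. -/
def fibreEquiv : {w : Place K F // w.comap E = v} ≃
    {P : Ideal (v.intCl F) //
      P ∈ IsDedekindDomain.primesOverFinset (IsLocalRing.maximalIdeal v.ring) (v.intCl F)} :=
  Equiv.ofBijective (fun w => ⟨center w.2, by
    rw [IsDedekindDomain.mem_primesOverFinset_iff v.maximalIdeal_ne_bot]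
    exact ⟨inferInstance, inferInstance⟩⟩) <| by
  constructor
  · rintro ⟨w, hw⟩ ⟨w', hw'⟩ h
    exact Subtype.ext (eq_of_center_eq hw hw' (congrArg Subtype.val h))
  · rintro ⟨P, hP⟩
    rw [IsDedekindDomain.mem_primesOverFinset_iff v.maximalIdeal_ne_bot] at hP
    obtain ⟨h, h'⟩ := hP
    obtain ⟨w, hw, rfl⟩ := exists_center_eq P (Ideal.ne_bot_of_liesOver_of_ne_bot
      v.maximalIdeal_ne_bot P)
    exact ⟨⟨w, hw⟩, rfl⟩

lemma coe_fibreEquiv (w : {w : Place K F // w.comap E = v}) :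
    (fibreEquiv F v w : Ideal (v.intCl F)) = center w.2 := rfl

instance : Finite {w : Place K F // w.comap E = v} := .of_equiv _ (fibreEquiv F v).symm

variable (F) in
lemma finite_fibre : {w : Place K F | w.comap E = v}.Finite :=
  Set.finite_coe_iff.mp (inferInstanceAs (Finite {w : Place K F // w.comap E = v}))

variable (F) in
/-- The places above a place. -/
def fibre (v : Place K E) [IsDiscreteValuationRing v.ring] : Finset (Place K F) :=
  (v.finite_fibre F).toFinset

variable {v}

@[simp] lemma mem_fibre {w : Place K F} : w ∈ v.fibre F ↔ w.comap E = v := by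
  simp [fibre]

lemma ram_pos {w : Place K F} (hw : w.comap E = v) : 0 < w.ram E := by
  rw [ram_eq hw]
  exact Nat.pos_of_ne_zero (Ideal.IsDedekindDomain.ramificationIdx'_ne_zero_of_liesOver _
    v.maximalIdeal_ne_bot)

variable (v) in
omit [FiniteDimensional E F] in
-- An integrally closed subring is the intersection of the valuation rings containing it; a
-- valuation ring that omits `x` is proper, hence is a place, and it lies above `v` by maximality of
-- `v.ring`.
lemma mem_intCl_iff {x : F} : x ∈ v.intCl F ↔ ∀ w : Place K F, w.comap E = v → x ∈ w.ring := by
  refine ⟨fun h w hw => intCl_le hw ⟨x, h⟩, fun h => ?_⟩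
  by_contra hx
  have : IsIntegrallyClosedIn (v.intCl F).toSubring F :=
    inferInstanceAs (IsIntegrallyClosedIn (v.intCl F) F)
  obtain ⟨V, hV, hxV⟩ := Subring.exists_le_valuationSubring_of_isIntegrallyClosedIn
    (R := (v.intCl F).toSubring) hx
  have hE : ∀ y ∈ v.ring, algebraMap E F y ∈ V := fun y hy =>
    hV ((v.intCl F).algebraMap_mem ⟨y, hy⟩)
  let w : Place K F :=
    { ring := V
      algebraMap_mem := fun a => by
        rw [IsScalarTower.algebraMap_apply K E F]
        exact hE _ (v.algebraMap_mem a)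
      ne_top := by
        rintro rfl
        exact hxV (ValuationSubring.mem_top _) }
  exact hxV (h w (eq_of_le (V := v) (W := w.comap E) hE).symm)

variable (v) in
/-- Simultaneous approximation at the places above a given one. -/
lemma exists_sub_mem (r : Place K F → F) :
    ∃ f : F, ∀ w : Place K F, w.comap E = v → r w - f ∈ w.ring := by
  classical
  -- A common denominator `s` moves the problem into the integral closure, where the Chinese
  -- remainder theorem applies.
  obtain ⟨⟨s, hs⟩, hsr⟩ := IsLocalization.exist_integer_multiples_of_finset
    (nonZeroDivisors (v.intCl F)) ((v.fibre F).image r)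
  have hs0 : s ≠ 0 := nonZeroDivisors.ne_zero hs
  have hs0' : (s : F) ≠ 0 := fun h => hs0 (Subtype.ext h)
  choose a ha using fun w : {w : Place K F // w.comap E = v} =>
    hsr (r w) (Finset.mem_image_of_mem r (mem_fibre.mpr w.2))
  -- The exponent `n` is the order of `s` at `w`, the precision lost on dividing by `s`.
  have hn : ∀ w : {w : Place K F // w.comap E = v}, ∃ n : ℕ, ∀ b : v.intCl F,
      b ∈ center w.2 ^ n → (b : F) / s ∈ w.1.ring := by
    intro w
    have := isDiscreteValuationRing w.2
    obtain ⟨ϖ, hϖ⟩ := IsDiscreteValuationRing.exists_irreducible w.1.ring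
    obtain ⟨n, u, hu⟩ := IsDiscreteValuationRing.eq_unit_mul_pow_irreducible
      (x := intClToRing w.2 s) (fun h => hs0' (congrArg Subtype.val h)) hϖ
    refine ⟨n, fun b hb => ?_⟩
    rw [mem_center_pow, hϖ.maximalIdeal_eq, Ideal.span_singleton_pow,
      Ideal.mem_span_singleton] at hb
    have : intClToRing w.2 s ∣ intClToRing w.2 b := by
      rw [hu]
      exact (Units.mul_left_dvd).mpr hb
    obtain ⟨c, hc⟩ := this
    have hc' : (b : F) = s * c := congrArg Subtype.val hc
    rw [hc', mul_div_cancel_left₀ _ hs0']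
    exact c.2
  choose n hn using hn
  have := Fintype.ofFinite {w : Place K F // w.comap E = v}
  obtain ⟨y, hy⟩ := IsDedekindDomain.exists_forall_sub_mem_ideal (s := Finset.univ)
    (fun w : {w : Place K F // w.comap E = v} => center w.2) n
    (fun w _ => Ideal.prime_of_isPrime (center_ne_bot w.2) inferInstance)
    (fun w _ w' _ hww' h => hww' (Subtype.ext (eq_of_center_eq w.2 w'.2 h))) (fun w => a w)
  refine ⟨(y : F) / s, fun w hw => ?_⟩
  have h₁ := hn ⟨w, hw⟩ _ (hy ⟨w, hw⟩ (Finset.mem_univ _))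
  have h₂ : (a ⟨w, hw⟩ : F) = s * r w := (ha ⟨w, hw⟩).trans (by rw [Algebra.smul_def]; rfl)
  have h₃ : r w - (y : F) / s = -(((y - a ⟨w, hw⟩ : v.intCl F) : F) / s) := by
    have : ((y - a ⟨w, hw⟩ : v.intCl F) : F) = y - s * r w := by rw [← h₂]; rfl
    rw [this]
    field_simp
    ring
  rw [h₃]
  exact neg_mem h₁

variable [IsAlgClosed K] (hv : ∀ x ∈ v.ring, ∃ a : K, x - algebraMap K E a ∈ v.ring.nonunits)

include hv in
lemma exists_sub_mem_center {w : Place K F} (hw : w.comap E = v) (b : v.intCl F) :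
    ∃ a : v.ring, (∃ c : K, algebraMap K E c = a) ∧
      b - algebraMap v.ring (v.intCl F) a ∈ center hw := by
  let ι : K →+* v.ring := (algebraMap K E).codRestrict v.ring.toSubring v.algebraMap_mem
  obtain ⟨c, hc⟩ := exists_sub_mem_of_isAlgClosed ι (m := IsLocalRing.maximalIdeal v.ring)
    (fun y => (hv y y.2).imp fun a ha =>
      (ValuationSubring.mem_nonunits_iff_exists_mem_maximalIdeal.mp ha).2) (center hw)
    (Ideal.LiesOver.over (P := center hw) (p := IsLocalRing.maximalIdeal v.ring)).le b
  exact ⟨ι c, ⟨c, rfl⟩, hc⟩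

include hv in
lemma inertiaDeg_center {w : Place K F} (hw : w.comap E = v) :
    (IsLocalRing.maximalIdeal v.ring).inertiaDeg' (center hw) = 1 := by
  rw [Ideal.inertiaDeg'_algebraMap]
  let := Ideal.Quotient.field (IsLocalRing.maximalIdeal v.ring)
  rw [finrank_eq_one_iff_of_nonzero' 1 one_ne_zero]
  intro y
  obtain ⟨b, rfl⟩ := Ideal.Quotient.mk_surjective y
  obtain ⟨a, -, ha⟩ := exists_sub_mem_center hv hw b
  refine ⟨Ideal.Quotient.mk _ a, ?_⟩
  rw [← Algebra.algebraMap_eq_smul_one, eq_comm]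
  exact Ideal.Quotient.eq.mpr ha

include hv in
-- The identity `∑ e f = n` for Dedekind extensions, with every `f` equal to `1` because the residue
-- fields are `K`.
lemma sum_ram : ∑ w ∈ v.fibre F, w.ram E = Module.finrank E F := by
  have := Fintype.ofFinite {w : Place K F // w.comap E = v}
  rw [← Ideal.sum_ramification_inertia (v.intCl F) E F v.maximalIdeal_ne_bot,
    ← Finset.sum_coe_sort (IsDedekindDomain.primesOverFinset _ _),
    Finset.sum_subtype (p := fun w => w.comap E = v) (v.fibre F) (fun w => mem_fibre)]
  refine Fintype.sum_equiv (fibreEquiv F v) _ _ fun w => ?_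
  rw [coe_fibreEquiv, inertiaDeg_center hv, mul_one, ram_eq w.2]

include hv in
lemma residue_of_comap {w : Place K F} (hw : w.comap E = v) {x : F} (hx : x ∈ w.ring) :
    ∃ a : K, x - algebraMap K F a ∈ w.ring.nonunits := by
  have h : ∀ b : v.intCl F, ∃ c : K, (b : F) - algebraMap K F c ∈ w.ring.nonunits := by
    intro b
    obtain ⟨a, ⟨c, hc⟩, ha⟩ := exists_sub_mem_center hv hw b
    refine ⟨c, ?_⟩
    rw [mem_center] at ha
    rw [IsScalarTower.algebraMap_apply K E F, hc]
    exact ha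
  obtain ⟨a, b, hb, hab⟩ := exists_div_of_mem hw hx
  obtain ⟨c, hc⟩ := h a
  obtain ⟨d, hd⟩ := h b
  rw [mem_center, ValuationSubring.mem_nonunits_iff, not_lt] at hb
  rw [ValuationSubring.mem_nonunits_iff] at hc hd
  have hd0 : algebraMap K F d ≠ 0 := by
    intro h0
    rw [h0, sub_zero] at hd
    exact absurd hd (not_lt.mpr hb)
  -- The residue of a quotient `a / b` with `b` a unit at `w` is the quotient of the residues.
  refine ⟨c / d, ?_⟩
  rw [ValuationSubring.mem_nonunits_iff]
  have h₁ : (x - algebraMap K F (c / d)) * b =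
      ((a : F) - algebraMap K F c) - algebraMap K F (c / d) * (b - algebraMap K F d) := by
    rw [map_div₀, ← hab]
    field_simp
    ring
  have h₂ : w.ring.valuation ((x - algebraMap K F (c / d)) * b) < 1 := by
    rw [h₁]
    refine Valuation.map_sub_lt _ hc ?_
    rw [map_mul]
    exact mul_lt_one_of_nonneg_of_lt_one_right
      ((w.ring.valuation_le_one_iff _).mpr (w.algebraMap_mem _)) zero_le hd
  rw [map_mul] at h₂
  exact lt_of_le_of_lt (le_mul_of_one_le_right' hb) h₂

end Fibre

end Place

/-! ### Finite separable extensions of function fields and pushforward of the structure lattices. -/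

section CurveField

variable {K E F : Type*} [Field K] [Field E] [Field F] [Algebra K E] [Algebra K F]
  [Algebra E F] [IsScalarTower K E F] [FiniteDimensional E F] [Algebra.IsSeparable E F]
  [IsAlgClosed K]

variable (K E F) in
lemma IsCurveField.of_finite_separable [IsCurveField K E] : IsCurveField K F where
  dvr w := Place.isDiscreteValuationRing (E := E) (w := w) rfl
  residue w x hx := Place.residue_of_comap (E := E) (w := w)
    (IsCurveField.residue (w.comap E)) rfl hx
  finite x := by
    -- A pole of `x` lies above a pole of some coefficient of its minimal polynomial: elsewhere `x`
    -- is integral.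
    let p := minpoly E x
    let bad : Set (Place K E) := ⋃ n ∈ p.support, {v | p.coeff n ∉ v.ring}
    have hbad : bad.Finite := p.support.finite_toSet.biUnion fun n _ => IsCurveField.finite _
    refine (hbad.biUnion fun v _ => v.finite_fibre F).subset fun w hw => ?_
    simp only [Set.mem_iUnion]
    refine ⟨w.comap E, ?_, rfl⟩
    by_contra h
    simp only [bad, Set.mem_iUnion, not_exists, Set.mem_ofPred_eq, not_not] at h
    refine hw (w.ring.mem_of_isIntegral ?_)
    have hc : ∀ n, algebraMap E F (p.coeff n) ∈ w.ring := by
      intro n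
      by_cases hn : n ∈ p.support
      · exact h n hn
      · rw [Polynomial.notMem_support_iff.mp hn, map_zero]
        exact w.ring.zero_mem
    have hp : ↑((p.map (algebraMap E F)).coeffs) ⊆ (w.ring.toSubring : Set F) := by
      intro y hy
      obtain ⟨n, -, rfl⟩ := Polynomial.mem_coeffs_iff.mp hy
      rw [Polynomial.coeff_map]
      exact hc n
    refine ⟨(p.map (algebraMap E F)).toSubring _ hp,
      (Polynomial.monic_toSubring _ _ hp).mpr
        ((minpoly.monic (Algebra.IsIntegral.isIntegral x)).map _), ?_⟩
    have h₁ := Polynomial.map_toSubring (p.map (algebraMap E F)) w.ring.toSubring hp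
    have h₂ : Polynomial.eval₂ (algebraMap w.ring F) x
        ((p.map (algebraMap E F)).toSubring _ hp) =
        Polynomial.eval x (p.map (algebraMap E F)) := by
      refine Eq.trans ?_ (congrArg (Polynomial.eval x) h₁)
      rw [Polynomial.eval_map]
      rfl
    rw [h₂, Polynomial.eval_map]
    exact minpoly.aeval E x

/-- `K` is algebraically closed, hence integrally closed in `F`, and so the intersection of the
valuation rings containing it. -/
lemma Place.exists_notMem_of_notMem_range {x : F} (hx : x ∉ Set.range (algebraMap K F)) :
    ∃ w : Place K F, x ∉ w.ring := by
  have : IsIntegrallyClosedIn (⊥ : Subalgebra K F).toSubring F := by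
    change IsIntegrallyClosedIn (⊥ : Subalgebra K F) F
    rw [isIntegrallyClosedIn_iff]
    refine ⟨Subtype.val_injective, fun {y} hy => ?_⟩
    have hy' : IsIntegral K y := isIntegral_trans (A := (⊥ : Subalgebra K F)) y hy
    obtain ⟨a, rfl⟩ := minpoly.mem_range_of_degree_eq_one K y
      (IsAlgClosed.degree_eq_one_of_irreducible K (minpoly.irreducible hy'))
    exact ⟨algebraMap K _ a, rfl⟩
  obtain ⟨V, hV, hxV⟩ := Subring.exists_le_valuationSubring_of_isIntegrallyClosedIn
    (R := (⊥ : Subalgebra K F).toSubring) (x := x) hx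
  exact ⟨⟨V, fun a => hV ⟨a, rfl⟩, by
    rintro rfl
    exact hxV (ValuationSubring.mem_top _)⟩, hxV⟩

variable (K F) in
-- A function without poles is constant.
lemma hZero_lattice [Nonempty (Place K F)] : hZero (Place.lattice : Place K F → _) = 1 := by
  have h : relLength (⊥ : Submodule K K) ⊤ = 1 := by
    rw [relLength_eq_length_of_surjective (M := ⊥) (N := (⊤ : Submodule K K))
      (Submodule.topEquiv).toLinearMap
      (Submodule.topEquiv).surjective (fun x => by simp)]
    exact Module.length_eq_one K K
  rw [← h]
  refine (relLength_eq_of_map (LinearMap.pi fun _ => Algebra.linearMap K F) ?_ ?_ ?_).symm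
  · exact fun a _ => ⟨fun w _ => w.algebraMap_mem a, ⟨algebraMap K F a, rfl⟩⟩
  · intro a _
    simp [funext_iff]
  · rintro _ ⟨hr, ⟨x, rfl⟩⟩
    by_cases hx : x ∈ Set.range (algebraMap K F)
    · obtain ⟨a, rfl⟩ := hx
      refine ⟨a, trivial, ?_⟩
      rw [Submodule.mem_bot, sub_eq_zero]
      rfl
    · obtain ⟨w, hw⟩ := Place.exists_notMem_of_notMem_range (K := K) hx
      exact absurd (hr w trivial) hw

variable (F) in
/-- The family of integral closures as a family of lattices on the places of the base. -/
def intClLattice (v : Place K E) : Submodule K F where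
  carrier := v.intCl F
  add_mem' := add_mem
  zero_mem' := zero_mem _
  smul_mem' c x hx := by
    rw [Algebra.smul_def, IsScalarTower.algebraMap_apply K E F]
    exact mul_mem ((v.intCl F).algebraMap_mem ⟨_, v.algebraMap_mem c⟩) hx

omit [IsAlgClosed K] in
-- Pushing forward along `w ↦ w.comap E` does not change cohomology: the fibres are finite, and
-- simultaneous approximation in a fibre replaces a family of principal parts by one element of `F`.
lemma hOne_intClLattice [IsCurveField K E] :
    hOne (intClLattice F : Place K E → Submodule K F) = hOne (Place.lattice : Place K F → _) := by
  refine hOne_eq_of_map (LinearEquiv.refl K F) (fun w => w.comap E)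
    (fun v => v.finite_fibre F) (fun x v => Place.mem_intCl_iff v) fun v r _ => ?_
  exact Place.exists_sub_mem v r

omit [FiniteDimensional E F] [IsAlgClosed K] in
-- With no place above `v`, the criterion `Place.mem_intCl_iff` would be vacuous and every element
-- of `E` integral over `v.ring`.
lemma Place.comap_surjective [IsCurveField K E] :
    Function.Surjective (fun w : Place K F => w.comap E) := by
  intro v
  by_contra! h
  obtain ⟨x, hx⟩ := v.exists_notMem
  have : algebraMap E F x ∈ v.intCl F := (Place.mem_intCl_iff v).mpr fun w hw => absurd hw (h w)
  have h' : IsIntegral v.ring x := (isIntegral_algebraMap_iff (algebraMap E F).injective).mp this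
  exact hx (v.ring.mem_of_isIntegral h')

omit [IsAlgClosed K] in
lemma hZero_intClLattice [IsCurveField K E] [Nonempty (Place K E)] :
    hZero (intClLattice F : Place K E → Submodule K F) = hZero (Place.lattice : Place K F → _) :=
  hZero_eq_of_map (LinearEquiv.refl K F) (fun w => w.comap E)
    Place.comap_surjective fun _ v => Place.mem_intCl_iff v

lemma almostAll_intClLattice [IsCurveField K E] :
    AlmostAll (intClLattice F : Place K E → Submodule K F) := by
  intro x
  have := IsCurveField.of_finite_separable K E F
  refine ((IsCurveField.finite (K := K) x).image fun w => w.comap E).subset fun v hv => ?_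
  have hv' : ¬ ∀ w : Place K F, w.comap E = v → x ∈ w.ring := fun h =>
    hv ((Place.mem_intCl_iff v).mpr h)
  push Not at hv'
  obtain ⟨w, hw, hx⟩ := hv'
  exact ⟨w, hx, hw⟩

end CurveField

/-! ### Local duality of lattices. -/

section Duality

variable {K E F : Type*} [Field K] [Field E] [Field F] [Algebra K E] [Algebra K F]
  [Algebra E F] [IsScalarTower K E F]

/-- A module over the valuation ring of a place as a subspace. -/
def _root_.Submodule.toSubspace {v : Place K E} (M : Submodule v.ring F) : Submodule K F where
  carrier := M
  add_mem' := add_mem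
  zero_mem' := zero_mem _
  smul_mem' c x hx := by
    rw [Algebra.smul_def, IsScalarTower.algebraMap_apply K E F]
    have := M.smul_mem ⟨_, v.algebraMap_mem c⟩ hx
    rwa [Algebra.smul_def] at this

@[simp] lemma _root_.Submodule.mem_toSubspace {v : Place K E} {M : Submodule v.ring F} {x : F} :
    x ∈ M.toSubspace ↔ x ∈ M := Iff.rfl

lemma Place.mem_one_iff {v : Place K E} {y : E} : y ∈ (1 : Submodule v.ring E) ↔ y ∈ v.ring := by
  rw [Submodule.mem_one]
  exact ⟨fun ⟨a, ha⟩ => ha ▸ a.2, fun h => ⟨⟨y, h⟩, rfl⟩⟩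

/-- The functional plays the role of a residue. Any linear form killing the valuation ring but not
`ϖ⁻¹` will do, since each `y` outside the ring has a multiple equal to `ϖ⁻¹`. It turns duality over
the valuation ring into duality of `K`-vector spaces. -/
lemma Place.exists_dual (v : Place K E) [IsDiscreteValuationRing v.ring] :
    ∃ l : E →ₗ[K] K, (∀ y ∈ v.ring, l y = 0) ∧
      ∀ y, (∀ a ∈ v.ring, l (a * y) = 0) → y ∈ v.ring := by
  obtain ⟨ϖ, hϖ⟩ := IsDiscreteValuationRing.exists_irreducible v.ring
  have hϖ0 : (ϖ : E) ≠ 0 := by simpa using hϖ.ne_zero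
  have hn : (ϖ : E)⁻¹ ∉ v.lattice := by
    intro h
    exact hϖ.not_isUnit (IsUnit.of_mul_eq_one ⟨_, h⟩ (Subtype.ext (mul_inv_cancel₀ hϖ0)))
  obtain ⟨l, hl, hl'⟩ := Submodule.exists_dual_map_eq_bot_of_notMem hn inferInstance
  have hl'' : ∀ y ∈ v.ring, l y = 0 := fun y hy => by
    have : l y ∈ v.lattice.map l := ⟨y, hy, rfl⟩
    rwa [hl', Submodule.mem_bot] at this
  refine ⟨l, hl'', fun y hy => ?_⟩
  by_contra hyv
  have hy0 : y ≠ 0 := by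
    rintro rfl
    exact hyv v.ring.zero_mem
  have hyi := (v.ring.mem_or_inv_mem y).resolve_left hyv
  obtain ⟨n, u, hu⟩ := IsDiscreteValuationRing.eq_unit_mul_pow_irreducible
    (x := (⟨y⁻¹, hyi⟩ : v.ring)) (by simpa [Subtype.ext_iff] using hy0) hϖ
  have hu' : y⁻¹ = (u : v.ring) * (ϖ : E) ^ n := congrArg Subtype.val hu
  have huu : ((u⁻¹ : v.ringˣ) : v.ring) * ((u : v.ring) : E) = 1 := by
    exact_mod_cast u.inv_mul
  rcases n with - | n
  · refine hyv ?_
    rw [pow_zero, mul_one] at hu'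
    rw [← inv_inv y, hu', inv_eq_of_mul_eq_one_left huu]
    exact Subtype.prop _
  · refine hl ?_
    have := hy ((u : v.ring) * (ϖ : E) ^ n) (v.ring.mul_mem _ _ (Subtype.prop _)
      (pow_mem ϖ.2 n))
    convert this using 2
    rw [← inv_inv y, hu', pow_succ]
    have hu0 : ((u : v.ring) : E) ≠ 0 := right_ne_zero_of_mul_eq_one huu
    field_simp

/-- The pairing `l (B x m)`, with `l` from `Place.exists_dual`, embeds the quotient of the dual
lattices into the `K`-dual of `M / (N ∩ M)`. -/
lemma relLength_dualSubmodule_le {v : Place K E} [IsDiscreteValuationRing v.ring]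
    (B : LinearMap.BilinForm E F) (N M : Submodule v.ring F) :
    relLength (B.dualSubmodule M).toSubspace (B.dualSubmodule N).toSubspace ≤
      relLength N.toSubspace M.toSubspace := by
  by_cases hfin : relLength N.toSubspace M.toSubspace = ⊤
  · rw [hfin]
    exact le_top
  obtain ⟨l, hl, hl'⟩ := v.exists_dual
  let W : Submodule K M.toSubspace := N.toSubspace.comap M.toSubspace.subtype
  have : Module.Finite K (M.toSubspace ⧸ W) := by
    have := (isFiniteLength_iff_isNoetherian_isArtinian.mp (Module.length_ne_top_iff.mp hfin)).1
    infer_instance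
  let Φ : F →ₗ[K] Module.Dual K M.toSubspace :=
    { toFun := fun x => l ∘ₗ ((B x).restrictScalars K) ∘ₗ M.toSubspace.subtype
      map_add' := fun x y => by ext; simp
      map_smul' := fun c x => by
        ext m
        simp only [LinearMap.comp_apply, LinearMap.restrictScalars_apply, RingHom.id_apply,
          LinearMap.smul_apply]
        rw [← algebraMap_smul E c x, map_smul, LinearMap.smul_apply, algebraMap_smul, map_smul] }
  refine (relLength_le_of_map Φ (M' := ⊥) (N' := W.dualAnnihilator) ?_ ?_).trans ?_
  · intro x hx
    rw [Submodule.mem_dualAnnihilator]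
    intro m hm
    exact hl _ (Place.mem_one_iff.mp (hx m hm))
  · intro x hx hx0 m hm
    refine Place.mem_one_iff.mpr (hl' _ fun a ha => ?_)
    have h : B x ((⟨a, ha⟩ : v.ring) • m) = a * B x m := by
      rw [Algebra.smul_def]
      change B x (algebraMap E F a * m) = _
      rw [← Algebra.smul_def, map_smul, smul_eq_mul]
    rw [← h]
    exact LinearMap.congr_fun hx0 ⟨(⟨a, ha⟩ : v.ring) • m, M.smul_mem _ hm⟩
  · rw [relLength_eq_length_of_surjective (M := ⊥) (N := W.dualAnnihilator)
      W.dualQuotEquivDualAnnihilator.symm.toLinearMap W.dualQuotEquivDualAnnihilator.symm.surjective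
      (fun x => by simp)]
    rw [relLength, Module.length_eq_finrank, Module.length_eq_finrank, Subspace.dual_finrank_eq]

lemma Place.mem_nonunits_of_mul {v : Place K E} {x y : E} (hx : x ∈ v.ring.nonunits)
    (hy : y ∈ v.ring) : x * y ∈ v.ring.nonunits := by
  rw [ValuationSubring.mem_nonunits_iff] at hx ⊢
  rw [map_mul]
  exact mul_lt_one_of_lt_of_le hx ((v.ring.valuation_le_one_iff y).mpr hy)

lemma Place.algebraMap_mem_nonunits {v : Place K E} {a : K}
    (ha : algebraMap K E a ∈ v.ring.nonunits) : a = 0 := by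
  by_contra h
  have := Place.mem_nonunits_of_mul ha (v.algebraMap_mem a⁻¹)
  rw [← map_mul, mul_inv_cancel₀ h, map_one, ValuationSubring.mem_nonunits_iff, map_one] at this
  exact lt_irrefl _ this

/-- The multiples of `s` by the elements of the valuation ring. -/
def Place.scaled (v : Place K E) (s : E) : Submodule K E :=
  v.lattice.comap (LinearMap.mulLeft K s⁻¹)

lemma Place.mem_scaled {v : Place K E} {s x : E} : x ∈ v.scaled s ↔ s⁻¹ * x ∈ v.ring := Iff.rfl

/-- The quotient is a copy of the residue field, which is `K`. -/
lemma relLength_scaled_mul [IsCurveField K E] (v : Place K E) {ϖ : v.ring} (hϖ : Irreducible ϖ)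
    {s : E} (hs : s ≠ 0) : relLength (v.scaled (s * ϖ)) (v.scaled s) = 1 := by
  have hϖ0 : (ϖ : E) ≠ 0 := by simpa using hϖ.ne_zero
  have hnon : ∀ x : E, (ϖ : E)⁻¹ * x ∈ v.ring ↔ x ∈ v.ring.nonunits := by
    intro x
    rw [ValuationSubring.mem_nonunits_iff_exists_mem_maximalIdeal]
    constructor
    · intro h
      have hx : x = ϖ * ((ϖ : E)⁻¹ * x) := by field_simp
      refine ⟨hx ▸ v.ring.mul_mem _ _ ϖ.2 h, ?_⟩
      rw [hϖ.maximalIdeal_eq, Ideal.mem_span_singleton]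
      exact ⟨⟨_, h⟩, Subtype.ext hx⟩
    · rintro ⟨hx, h⟩
      rw [hϖ.maximalIdeal_eq, Ideal.mem_span_singleton] at h
      obtain ⟨y, hy⟩ := h
      have : x = ϖ * y := congrArg Subtype.val hy
      rw [this, inv_mul_cancel_left₀ hϖ0]
      exact y.2
  have h : relLength (⊥ : Submodule K K) ⊤ = 1 := by
    rw [relLength_eq_length_of_surjective (M := ⊥) (N := (⊤ : Submodule K K))
      (Submodule.topEquiv).toLinearMap (Submodule.topEquiv).surjective (fun x => by simp)]
    exact Module.length_eq_one K K
  rw [← h]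
  refine (relLength_eq_of_map ((LinearMap.mulLeft K s) ∘ₗ Algebra.linearMap K E) ?_ ?_ ?_).symm
  · intro a _
    rw [Place.mem_scaled]
    simpa [hs] using v.algebraMap_mem a
  · intro a _
    rw [Place.mem_scaled, mul_inv_rev, mul_assoc, hnon]
    simp only [LinearMap.comp_apply, LinearMap.mulLeft_apply, Algebra.linearMap_apply,
      inv_mul_cancel_left₀ hs, Submodule.mem_bot]
    exact ⟨Place.algebraMap_mem_nonunits, fun h => by simp [h]⟩
  · intro y hy
    obtain ⟨a, ha⟩ := IsCurveField.residue v _ hy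
    refine ⟨a, trivial, ?_⟩
    rw [Place.mem_scaled, mul_inv_rev, mul_assoc, hnon]
    simpa [mul_sub, hs] using ha

lemma relLength_scaled_ne_top [IsCurveField K E] (v : Place K E) {s : E} (hs : s ∈ v.ring)
    (hs0 : s ≠ 0) : relLength (v.scaled s) v.lattice ≠ ⊤ := by
  obtain ⟨ϖ, hϖ⟩ := IsDiscreteValuationRing.exists_irreducible v.ring
  have hϖ0 : (ϖ : E) ≠ 0 := by simpa using hϖ.ne_zero
  obtain ⟨n, u, hu⟩ := IsDiscreteValuationRing.eq_unit_mul_pow_irreducible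
    (x := (⟨s, hs⟩ : v.ring)) (by simpa [Subtype.ext_iff] using hs0) hϖ
  have hu' : s = (u : v.ring) * (ϖ : E) ^ n := congrArg Subtype.val hu
  have huu : ((u⁻¹ : v.ringˣ) : v.ring) * ((u : v.ring) : E) = 1 := by
    exact_mod_cast u.inv_mul
  have hu0 : ((u : v.ring) : E) ≠ 0 := right_ne_zero_of_mul_eq_one huu
  rw [hu']
  clear hu hu' hs0 hs s
  induction n with
  | zero =>
    have : v.lattice ≤ v.scaled ((u : v.ring) * (ϖ : E) ^ 0) := by
      intro x hx
      rw [Place.mem_scaled, pow_zero, mul_one, inv_eq_of_mul_eq_one_left huu]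
      exact v.ring.mul_mem _ _ (Subtype.prop _) hx
    rw [relLength_self_of_le this]
    exact ENat.zero_ne_top
  | succ n ih =>
    have h₁ : v.scaled ((u : v.ring) * (ϖ : E) ^ n * ϖ) ≤
        v.scaled ((u : v.ring) * (ϖ : E) ^ n) := by
      intro x hx
      rw [Place.mem_scaled] at hx ⊢
      have := v.ring.mul_mem _ _ ϖ.2 hx
      rwa [mul_inv_rev, mul_assoc, mul_inv_cancel_left₀ hϖ0] at this
    have h₂ : v.scaled ((u : v.ring) * (ϖ : E) ^ n) ≤ v.lattice := by
      intro x hx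
      rw [Place.mem_scaled] at hx
      have := v.ring.mul_mem _ _ ((u : v.ring) * ϖ ^ n).2 hx
      change ((u : v.ring) : E) * (ϖ : E) ^ n * (_ * x) ∈ _ at this
      rwa [mul_inv_cancel_left₀ (mul_ne_zero hu0 (pow_ne_zero n hϖ0))] at this
    rw [pow_succ, ← mul_assoc, relLength_add h₁ h₂,
      relLength_scaled_mul v hϖ (mul_ne_zero hu0 (pow_ne_zero n hϖ0))]
    exact WithTop.add_ne_top.mpr ⟨ENat.one_ne_top, ih⟩

variable {ι κ : Type*} [Fintype ι] [Fintype κ]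

omit [Algebra K F] [IsScalarTower K E F] [Fintype ι] in
lemma mem_span_basis_iff {v : Place K E} (b : Module.Basis ι E F) {x : F} :
    x ∈ Submodule.span v.ring (Set.range b) ↔ ∀ i, b.repr x i ∈ v.ring := by
  rw [Module.Basis.mem_span_iff_repr_mem]
  exact forall_congr' fun i => ⟨fun ⟨a, ha⟩ => ha ▸ a.2, fun h => ⟨⟨_, h⟩, rfl⟩⟩

lemma Place.exists_mul_mem (v : Place K E) (f : ι → E) :
    ∃ s ∈ v.ring, s ≠ 0 ∧ ∀ i, s * f i ∈ v.ring := by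
  obtain ⟨⟨s, hs⟩, h⟩ := IsLocalization.exist_integer_multiples (nonZeroDivisors v.ring)
    Finset.univ f
  refine ⟨s, s.2, by simpa using nonZeroDivisors.ne_zero hs, fun i => ?_⟩
  obtain ⟨a, ha⟩ := h i (Finset.mem_univ i)
  have : (a : E) = s * f i := ha.trans (Algebra.smul_def _ _)
  exact this ▸ a.2

lemma relLength_span_basis_ne_top [IsCurveField K E] (v : Place K E) (b : Module.Basis ι E F)
    (c : Module.Basis κ E F) :
    relLength (Submodule.span v.ring (Set.range b)).toSubspace
      (Submodule.span v.ring (Set.range c)).toSubspace ≠ ⊤ := by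
  -- `s` clears the denominators of the change of basis, so `s` times the span of `c` lies in the
  -- span of `b`, and the index of the former bounds the one sought.
  obtain ⟨s, hs, hs0, h⟩ := v.exists_mul_mem fun ij : ι × κ => b.repr (c ij.2) ij.1
  have hle : relLength (Submodule.span v.ring (Set.range b)).toSubspace
      (Submodule.span v.ring (Set.range c)).toSubspace ≤
      relLength (Submodule.pi Set.univ fun _ : κ => v.scaled s)
        (Submodule.pi Set.univ fun _ : κ => v.lattice) := by
    refine relLength_le_of_map (c.equivFun.restrictScalars K).toLinearMap ?_ ?_
    · intro x hx i _
      exact (mem_span_basis_iff c).mp hx i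
    · intro x _ hx
      rw [Submodule.mem_toSubspace, ← c.sum_repr x]
      refine sum_mem fun j _ => ?_
      have hj : s⁻¹ * c.repr x j ∈ v.ring := hx j trivial
      rw [mem_span_basis_iff]
      intro i
      have : b.repr (c.repr x j • c j) i = (s⁻¹ * c.repr x j) * (s * b.repr (c j) i) := by
        rw [map_smul, Finsupp.smul_apply, smul_eq_mul]
        field_simp
      rw [this]
      exact v.ring.mul_mem _ _ hj (h (i, j))
  refine ne_top_of_le_ne_top ?_ hle
  rw [pi_relLength_const_eq]
  exact WithTop.mul_ne_top (ENat.natCast_ne_top _) (relLength_scaled_ne_top v hs hs0)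

/-- The reverse of `relLength_dualSubmodule_le`, obtained by applying it to the duals: lattices
spanned by bases are their own double duals. -/
lemma relLength_dualSubmodule_span {v : Place K E} [IsDiscreteValuationRing v.ring]
    {B : LinearMap.BilinForm E F} (hB : B.Nondegenerate) (hB' : B.IsSymm)
    (b : Module.Basis ι E F) (c : Module.Basis κ E F) :
    relLength (Submodule.span v.ring (Set.range b)).toSubspace
      (Submodule.span v.ring (Set.range c)).toSubspace ≤
    relLength (B.dualSubmodule (Submodule.span v.ring (Set.range c))).toSubspace
      (B.dualSubmodule (Submodule.span v.ring (Set.range b))).toSubspace := by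
  have := relLength_dualSubmodule_le B (B.dualSubmodule (Submodule.span v.ring (Set.range c)))
    (B.dualSubmodule (Submodule.span v.ring (Set.range b)))
  rwa [B.dualSubmodule_dualSubmodule_of_basis hB hB' b,
    B.dualSubmodule_dualSubmodule_of_basis hB hB' c] at this

end Duality

/-! ### The different and its lower bound. -/

section Different

variable {K E F : Type*} [Field K] [Field E] [Field F] [Algebra K E] [Algebra K F]
  [Algebra E F] [IsScalarTower K E F] [FiniteDimensional E F] [Algebra.IsSeparable E F]

instance (v : Place K E) [IsDiscreteValuationRing v.ring] :
    IsLocalization (Algebra.algebraMapSubmonoid (v.intCl F) (nonZeroDivisors v.ring)) F :=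
  IsIntegralClosure.isLocalization v.ring E F _

variable (F) in
/-- The integral closure of the valuation ring of a place as a lattice. -/
abbrev Place.intClModule (v : Place K E) : Submodule v.ring F :=
  Subalgebra.toSubmodule (v.intCl F)

omit [Algebra K F] [IsScalarTower K E F] in
variable (F) in
lemma Place.exists_basis_intClModule (v : Place K E) [IsDiscreteValuationRing v.ring] :
    ∃ (n : ℕ) (c : Module.Basis (Fin n) E F),
      Submodule.span v.ring (Set.range c) = v.intClModule F := by
  refine ⟨_, (Module.finBasis v.ring (v.intCl F)).localizationLocalization E
    (nonZeroDivisors v.ring) F, ?_⟩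
  rw [Module.Basis.localizationLocalization_span]
  ext x
  simp only [LinearMap.mem_range, Subalgebra.mem_toSubmodule]
  exact ⟨fun ⟨y, hy⟩ => hy ▸ y.2, fun h => ⟨⟨x, h⟩, rfl⟩⟩

omit [Algebra K F] [IsScalarTower K E F] [Algebra.IsSeparable E F] in
lemma Place.trace_mem {v : Place K E} [IsDiscreteValuationRing v.ring] {x : F}
    (hx : x ∈ v.intCl F) : Algebra.trace E F x ∈ v.ring :=
  v.ring.mem_of_isIntegral (Algebra.isIntegral_trace hx)

/-- Such an `x` lies in every prime above the maximal ideal of `v.ring`, so it is nilpotent modulo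
that ideal. The trace commutes with reduction, and the trace of a nilpotent element over a field is
zero. -/
lemma Place.trace_mem_nonunits {v : Place K E} [IsDiscreteValuationRing v.ring] {x : F}
    (hx : ∀ w : Place K F, w.comap E = v → x ∈ w.ring.nonunits)
    (hxv : x ∈ v.intCl F) : Algebra.trace E F x ∈ v.ring.nonunits := by
  let y : v.intCl F := ⟨x, hxv⟩
  let I := Ideal.map (algebraMap v.ring (v.intCl F)) (IsLocalRing.maximalIdeal v.ring)
  have hy : y ∈ I.radical := by
    rw [Ideal.radical_eq_sInf, Ideal.mem_sInf]
    rintro P ⟨hP, hPp⟩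
    have hP0 : P ≠ ⊥ := by
      rintro rfl
      obtain ⟨z, hz, hz0⟩ := Submodule.exists_mem_ne_zero_of_ne_bot v.maximalIdeal_ne_bot
      have := hP (Ideal.mem_map_of_mem _ hz)
      have hz' : algebraMap E F z = 0 := congrArg Subtype.val (Ideal.mem_bot.mp this)
      exact hz0 (Subtype.ext ((algebraMap E F).injective (hz'.trans (map_zero _).symm)))
    obtain ⟨w, hw, rfl⟩ := Place.exists_center_eq P hP0
    exact (Place.mem_center hw y).mpr (hx w hw)
  have hnil : IsNilpotent (Ideal.Quotient.mk I y) := by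
    obtain ⟨n, hn⟩ := hy
    exact ⟨n, by rwa [← map_pow, Ideal.Quotient.eq_zero_iff_mem]⟩
  let := Ideal.Quotient.field (IsLocalRing.maximalIdeal v.ring)
  have h : Algebra.trace (v.ring ⧸ IsLocalRing.maximalIdeal v.ring) (v.intCl F ⧸ I)
      (Ideal.Quotient.mk I y) = 0 := (Algebra.isNilpotent_trace_of_isNilpotent hnil).eq_zero
  rw [Algebra.trace_quotient_mk, Ideal.Quotient.eq_zero_iff_mem] at h
  rw [ValuationSubring.mem_nonunits_iff_exists_mem_maximalIdeal]
  have h' : Algebra.trace E F x = algebraMap v.ring E (Algebra.trace v.ring (v.intCl F) y) :=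
    Algebra.trace_localization v.ring (nonZeroDivisors v.ring) (Rₘ := E) (Sₘ := F) y
  rw [h']
  exact ⟨Subtype.prop _, h⟩

lemma relLength_scaled_pow [IsCurveField K E] (v : Place K E) {ϖ : v.ring} (hϖ : Irreducible ϖ)
    (n : ℕ) : relLength v.lattice (v.scaled ((ϖ : E)⁻¹ ^ n)) = n := by
  have hϖ0 : (ϖ : E) ≠ 0 := by simpa using hϖ.ne_zero
  have key : ∀ m, v.scaled ((ϖ : E)⁻¹ ^ m) ≤ v.scaled ((ϖ : E)⁻¹ ^ (m + 1)) := by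
    intro m x hx
    rw [Place.mem_scaled] at hx ⊢
    rw [inv_pow, inv_inv] at hx ⊢
    rw [pow_succ', mul_assoc]
    exact v.ring.mul_mem _ _ ϖ.2 hx
  have h0 : v.scaled ((ϖ : E)⁻¹ ^ 0) = v.lattice := by
    ext x
    rw [Place.mem_scaled, pow_zero, inv_one, one_mul]
    rfl
  have hmono : Monotone fun m => v.scaled ((ϖ : E)⁻¹ ^ m) := monotone_nat_of_le_succ key
  rw [← h0]
  induction n with
  | zero => rw [relLength_self_of_le le_rfl, Nat.cast_zero]
  | succ n ih =>
    rw [relLength_add (hmono (Nat.zero_le n)) (key n), ih, Nat.cast_succ]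
    congr 1
    have := relLength_scaled_mul v hϖ (pow_ne_zero (n + 1) (inv_ne_zero hϖ0))
    rwa [pow_succ, inv_mul_cancel_right₀ hϖ0, ← pow_succ] at this

lemma Place.coe_mem_maximalIdeal_pow_ram {v : Place K E} [IsDiscreteValuationRing v.ring]
    {w : Place K F} (hw : w.comap E = v) {x : v.ring} (hx : x ∈ IsLocalRing.maximalIdeal v.ring) :
    ∃ h : algebraMap E F x ∈ w.ring,
      (⟨_, h⟩ : w.ring) ∈ IsLocalRing.maximalIdeal w.ring ^ w.ram E := by
  have h := Ideal.le_pow_ramificationIdx' (p := IsLocalRing.maximalIdeal v.ring)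
    (P := Place.center hw) (Ideal.mem_map_of_mem _ hx)
  rw [← Place.ram_eq hw, Place.mem_center_pow] at h
  exact ⟨_, h⟩

variable [IsAlgClosed K] [IsCurveField K E]

/-- Let `W` be the space of elements with pole order at most `e_w - 1` at each `w` above `v`. For
`x` in `W` and `b` integral, `ϖ x b` vanishes at all these places, so its trace is divisible by `ϖ`
and the trace of `x b` is integral. Thus `W` lies in the dual lattice. -/
lemma sum_ram_sub_one_le (v : Place K E) :
    ((∑ w ∈ v.fibre F, (w.ram E - 1) : ℕ) : ℕ∞) ≤ relLength (intClLattice F v)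
      ((Algebra.traceForm E F).dualSubmodule (v.intClModule F)).toSubspace := by
  have := IsCurveField.of_finite_separable K E F
  choose t ht using fun w : Place K F => IsDiscreteValuationRing.exists_irreducible w.ring
  have ht0 : ∀ w, (t w : F) ≠ 0 := fun w => by simpa using (ht w).ne_zero
  let M : {w : Place K F // w.comap E = v} → Submodule K F := fun w =>
    w.1.scaled ((t w : F)⁻¹ ^ (w.1.ram E - 1))
  let W : Submodule K F := ⨅ w, M w
  have hM : ∀ w, w.1.lattice ≤ M w := by
    intro w x hx
    rw [Place.mem_scaled, inv_pow, inv_inv]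
    exact w.1.ring.mul_mem _ _ (pow_mem (t w).2 _) hx
  let := Fintype.ofFinite {w : Place K F // w.comap E = v}
  have h₁ : relLength (intClLattice F v) W = ((∑ w ∈ v.fibre F, (w.ram E - 1) : ℕ) : ℕ∞) := by
    rw [Finset.sum_subtype (p := fun w => w.comap E = v) (v.fibre F) (fun w => Place.mem_fibre),
      Nat.cast_sum, ← Finset.sum_congr rfl
        (fun (w : {w : Place K F // w.comap E = v}) _ =>
          relLength_scaled_pow w.1 (ht w) (w.1.ram E - 1)),
      ← relLength_pi Finset.univ (L' := M) (by simp)]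
    -- Simultaneous approximation makes the index of `W` the sum of the local indices.
    refine relLength_eq_of_map (LinearMap.pi fun _ => LinearMap.id) ?_ ?_ ?_
    · intro x hx w _
      exact (Submodule.mem_iInf _).mp hx w
    · intro x _
      refine Iff.trans ?_ (Place.mem_intCl_iff v).symm
      simp only [Submodule.mem_pi, Set.mem_univ, true_implies, Subtype.forall]
      rfl
    · intro y hy
      classical
      obtain ⟨x, hx⟩ := Place.exists_sub_mem v
        (fun w => if hw : w.comap E = v then y ⟨w, hw⟩ else 0)
      have hx' : ∀ w : {w : Place K F // w.comap E = v}, y w - x ∈ w.1.ring := fun w => by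
        simpa [w.2] using hx w w.2
      refine ⟨x, (Submodule.mem_iInf _).mpr fun w => ?_, fun w _ => hx' w⟩
      have := (M w).sub_mem (hy w trivial) (hM w (hx' w))
      rwa [sub_sub_cancel] at this
  rw [← h₁]
  refine relLength_le_of_map LinearMap.id (fun x hx b hb => ?_) fun x _ h => h
  obtain ⟨ϖ, hϖ⟩ := IsDiscreteValuationRing.exists_irreducible v.ring
  have hϖ0 : (ϖ : E) ≠ 0 := by simpa using hϖ.ne_zero
  have key : ∀ w : Place K F, w.comap E = v → algebraMap E F ϖ * (x * b) ∈ w.ring.nonunits := by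
    intro w hw
    obtain ⟨h, h'⟩ := Place.coe_mem_maximalIdeal_pow_ram hw
      (hϖ.maximalIdeal_eq ▸ Ideal.mem_span_singleton_self ϖ)
    rw [(ht w).maximalIdeal_eq, Ideal.span_singleton_pow, Ideal.mem_span_singleton] at h'
    obtain ⟨z, hz⟩ := h'
    have hz' : algebraMap E F ϖ = (t w : F) ^ w.ram E * z := congrArg Subtype.val hz
    have hxw := (Submodule.mem_iInf _).mp hx ⟨w, hw⟩
    change x ∈ w.scaled _ at hxw
    rw [Place.mem_scaled, inv_pow, inv_inv] at hxw
    have htn : (t w : F) ∈ w.ring.nonunits :=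
      ValuationSubring.mem_nonunits_iff_exists_mem_maximalIdeal.mpr ⟨(t w).2, (ht w).not_isUnit⟩
    -- `ϖ` contributes `e_w` factors of the uniformizer and `x` absorbs `e_w - 1` of them; the spare
    -- one makes the product a nonunit.
    have e : algebraMap E F ϖ * (x * b) =
        t w * (z * (((t w : F) ^ (w.ram E - 1) * x) * b)) := by
      obtain ⟨n, hn⟩ : ∃ n, w.ram E = n + 1 :=
        ⟨_, (Nat.succ_pred_eq_of_pos (Place.ram_pos hw)).symm⟩
      rw [hz', hn, Nat.add_sub_cancel, pow_succ]
      ring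
    rw [e]
    exact Place.mem_nonunits_of_mul htn (w.ring.mul_mem _ _ z.2
      (w.ring.mul_mem _ _ hxw (Place.intCl_le hw ⟨b, hb⟩)))
  have hint : algebraMap E F ϖ * (x * b) ∈ v.intCl F :=
    (Place.mem_intCl_iff v).mpr fun w hw => w.ring.nonunits_le (key w hw)
  have htr := Place.trace_mem_nonunits key hint
  rw [← Algebra.smul_def, map_smul, smul_eq_mul,
    ValuationSubring.mem_nonunits_iff_exists_mem_maximalIdeal] at htr
  obtain ⟨h, h'⟩ := htr
  rw [hϖ.maximalIdeal_eq, Ideal.mem_span_singleton] at h'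
  obtain ⟨z, hz⟩ := h'
  have hz' : (ϖ : E) * Algebra.trace E F (x * b) = ϖ * z := congrArg Subtype.val hz
  rw [Place.mem_one_iff, LinearMap.id_apply, Algebra.traceForm_apply, mul_left_cancel₀ hϖ0 hz']
  exact z.2

end Different

section Families

variable {K V P : Type*} [Field K] [AddCommGroup V] [Module K V] {L L' : P → Submodule K V}

lemma hZero_mono (h : ∀ p, L p ≤ L' p) : hZero L ≤ hZero L' :=
  relLength_le_of_map LinearMap.id (fun _ hx => ⟨fun p hp => h p (hx.1 p hp), hx.2⟩) fun _ _ h => h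

lemma hOne_anti (h : ∀ p, L p ≤ L' p) {s : Set P} (hs : s.Finite) (hs' : ∀ p ∉ s, L p = L' p) :
    hOne L' ≤ hOne L := by
  rw [hOne, hOne, restricted_congr hs hs']
  exact relLength_mono_left (sup_le_sup_right (fun _ hr p hp => h p (hr p hp)) _)

lemma AlmostAll.mono (hL : AlmostAll L) (h : ∀ p, L p ≤ L' p) : AlmostAll L' :=
  fun v => (hL v).subset fun p hp hpL => hp (h p hpL)

lemma AlmostAll.congr (hL : AlmostAll L) {s : Set P} (hs : s.Finite) (h : ∀ p ∉ s, L p = L' p) :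
    AlmostAll L' := by
  refine fun v => (hs.union (hL v)).subset fun p hp => ?_
  by_cases hps : p ∈ s
  · exact Or.inl hps
  · rw [Set.mem_ofPred_eq, ← h p hps] at hp
    exact Or.inr hp

end Families

section FreeLattice

variable {K E F : Type*} [Field K] [Field E] [Field F] [Algebra K E] [Algebra K F]
  [Algebra E F] [IsScalarTower K E F] {ι : Type*} [Fintype ι]

/-- The family of lattices spanned by a basis. -/
def freeLattice (b : Module.Basis ι E F) (v : Place K E) : Submodule K F :=
  (Submodule.span v.ring (Set.range b)).toSubspace

omit [Fintype ι] in
lemma mem_freeLattice {b : Module.Basis ι E F} {v : Place K E} {x : F} :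
    x ∈ freeLattice b v ↔ ∀ i, b.repr x i ∈ v.ring := mem_span_basis_iff b

lemma hZero_freeLattice [Nonempty (Place K E)] (b : Module.Basis ι E F) :
    hZero (freeLattice b : Place K E → Submodule K F) =
      Fintype.card ι * hZero (Place.lattice : Place K E → _) := by
  rw [← hZero_pi]
  refine hZero_eq_of_map (b.equivFun.restrictScalars K) id Function.surjective_id fun x v => ?_
  rw [mem_freeLattice]
  simp only [Submodule.mem_pi, Set.mem_univ, true_implies, id, forall_eq]
  rfl

lemma hOne_freeLattice (b : Module.Basis ι E F) :
    hOne (freeLattice b : Place K E → Submodule K F) =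
      Fintype.card ι * hOne (Place.lattice : Place K E → _) := by
  rw [← hOne_pi]
  refine hOne_eq_of_map (b.equivFun.restrictScalars K) id (fun v => by simp) (fun x v => ?_)
    fun v r _ => ⟨(b.equivFun.restrictScalars K).symm (r v), ?_⟩
  · rw [mem_freeLattice]
    simp only [Submodule.mem_pi, Set.mem_univ, true_implies, id, forall_eq]
    rfl
  · rintro _ rfl
    rw [LinearEquiv.apply_symm_apply, id, sub_self]
    exact zero_mem _

lemma almostAll_freeLattice [IsCurveField K E] (b : Module.Basis ι E F) :
    AlmostAll (freeLattice b : Place K E → Submodule K F) := by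
  intro x
  refine (Set.finite_iUnion fun i => IsCurveField.finite (K := K) (b.repr x i)).subset
    fun v hv => ?_
  rw [Set.mem_ofPred_eq, mem_freeLattice, not_forall] at hv
  exact Set.mem_iUnion.mpr hv

end FreeLattice

/-! ### The Riemann-Hurwitz inequality. -/

section Hurwitz

variable (K E F : Type*) [Field K] [Field E] [Field F] [Algebra K E] [Algebra K F]
  [Algebra E F] [IsScalarTower K E F] [FiniteDimensional E F] [Algebra.IsSeparable E F]
  [IsAlgClosed K] [IsCurveField K E]

omit [Algebra K F] [IsScalarTower K E F] [IsAlgClosed K] in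
lemma exists_sublattice {n : ℕ} (b : Module.Basis (Fin n) E F) (v : Place K E) :
    ∃ s : E, s ≠ 0 ∧ s ∈ v.ring ∧ (∀ i, s • b i ∈ v.intCl F) ∧
      ((∀ i, b i ∈ v.intCl F) → s = 1) := by
  by_cases h : ∀ i, b i ∈ v.intCl F
  · exact ⟨1, one_ne_zero, v.ring.one_mem, by simpa using h, fun _ => rfl⟩
  · obtain ⟨m, c, hc⟩ := v.exists_basis_intClModule F
    obtain ⟨s, hs, hs0, hsc⟩ := v.exists_mul_mem fun ij : Fin n × Fin m => c.repr (b ij.1) ij.2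
    refine ⟨s, hs0, hs, fun i => ?_, fun h' => absurd h' h⟩
    change s • b i ∈ v.intClModule F
    rw [← hc, mem_span_basis_iff]
    intro j
    simpa using hsc (i, j)

/-- The inequality in the Riemann-Hurwitz formula, with the finiteness of the genus. -/
theorem hurwitz [Nonempty (Place K E)] (hE : hOne (Place.lattice : Place K E → _) ≠ ⊤) :
    hOne (Place.lattice : Place K F → _) ≠ ⊤ ∧ ∀ t : Finset (Place K F),
      (∑ w ∈ t, ((w.ram E : ℤ) - 1)) ≤
        2 * ((hOne (Place.lattice : Place K F → _)).toNat : ℤ) - 2 -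
          Module.finrank E F * (2 * ((hOne (Place.lattice : Place K E → _)).toNat : ℤ) - 2) := by
  classical
  have := IsCurveField.of_finite_separable K E F
  have hne : Nonempty (Place K F) := by
    obtain ⟨w, -⟩ := Place.comap_surjective (K := K) (E := E) (F := F) (Classical.arbitrary _)
    exact ⟨w⟩
  let B := Algebra.traceForm E F
  have hB : B.Nondegenerate := traceForm_nondegenerate E F
  have hB' : B.IsSymm := Algebra.traceForm_isSymm E
  let b := Module.finBasis E F
  let b' := B.dualBasis hB b
  -- `N`, spanned by `s v • b`, is a common sublattice of `L` and `L₀`; the choice `s v = 1`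
  -- wherever `b` is integral keeps it equal to `L₀` at almost all places.
  choose s hs0 hs hsb hs1 using exists_sublattice K E F b
  let c (v : Place K E) : Module.Basis _ E F := b.unitsSMul fun _ => Units.mk0 (s v) (hs0 v)
  have hcb : ∀ v i, c v i = s v • b i := fun v i => by
    rw [Module.Basis.unitsSMul_apply]
    rfl
  let D (M : ∀ v : Place K E, Submodule v.ring F) (v : Place K E) : Submodule K F :=
    (B.dualSubmodule (M v)).toSubspace
  have hD : ∀ {v : Place K E} {M M' : Submodule v.ring F}, M ≤ M' →
      B.dualSubmodule M' ≤ B.dualSubmodule M := fun h x hx y hy => hx y (h hy)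
  let mL (v : Place K E) := v.intClModule F
  let mL₀ (v : Place K E) := Submodule.span v.ring (Set.range b)
  let mN (v : Place K E) := Submodule.span v.ring (Set.range (c v))
  let L (v : Place K E) := (mL v).toSubspace
  let L₀ (v : Place K E) := (mL₀ v).toSubspace
  let N (v : Place K E) := (mN v).toSubspace
  have hNL : ∀ v, mN v ≤ mL v := by
    intro v
    refine Submodule.span_le.mpr ?_
    rintro _ ⟨i, rfl⟩
    rw [hcb]
    exact hsb v i
  have hNL₀ : ∀ v, mN v ≤ mL₀ v := by
    intro v
    refine Submodule.span_le.mpr ?_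
    rintro _ ⟨i, rfl⟩
    rw [hcb]
    exact (mL₀ v).smul_mem ⟨s v, hs v⟩ (Submodule.subset_span ⟨i, rfl⟩)
  have hLL : ∀ v, mL v ≤ B.dualSubmodule (mL v) := fun v x hx y hy =>
    Place.mem_one_iff.mpr (Place.trace_mem (mul_mem hx hy))
  have hL₀' : ∀ v : Place K E, B.dualSubmodule (mL₀ v) = Submodule.span v.ring (Set.range b') :=
    fun v => B.dualSubmodule_span_of_basis hB b
  have hDL₀ : D mL₀ = freeLattice b' := funext fun v => congrArg Submodule.toSubspace (hL₀' v)
  -- Where both `b` and its dual basis are integral, the inclusions `mL₀ ≤ mL ≤ D mL ≤ mL₀` make all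
  -- these lattices coincide.
  let bad : Set (Place K E) := (⋃ i, {v | b i ∉ v.intCl F}) ∪ ⋃ i, {v | b' i ∉ v.intCl F}
  have hbad : bad.Finite := (Set.finite_iUnion fun i => almostAll_intClLattice (K := K) (b i)).union
    (Set.finite_iUnion fun i => almostAll_intClLattice (K := K) (b' i))
  have hgood : ∀ v ∉ bad, mN v = mL₀ v ∧ mL v = mL₀ v ∧ B.dualSubmodule (mL₀ v) = mL₀ v := by
    intro v hv
    simp only [bad, Set.mem_union, Set.mem_iUnion, Set.mem_ofPred_eq, not_or, not_exists,
      not_not] at hv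
    have h₁ : mL₀ v ≤ mL v := Submodule.span_le.mpr (by rintro _ ⟨i, rfl⟩; exact hv.1 i)
    have h₂ : B.dualSubmodule (mL₀ v) ≤ mL v := by
      rw [hL₀']
      exact Submodule.span_le.mpr (by rintro _ ⟨i, rfl⟩; exact hv.2 i)
    have h₃ : B.dualSubmodule (mL v) ≤ mL₀ v :=
      (hD h₂).trans (B.dualSubmodule_dualSubmodule_of_basis hB hB' b).le
    have h₄ : mL v = mL₀ v := le_antisymm ((hLL v).trans h₃) h₁
    refine ⟨?_, h₄, ?_⟩
    · have : (c v : _ → F) = b := by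
        ext i
        rw [hcb, hs1 v hv.1, one_smul]
      simp only [mN, mL₀, this]
    · rw [← h₄]
      exact le_antisymm (h₃.trans h₁) (hLL v)
  have aL : AlmostAll L := almostAll_intClLattice
  have aL₀ : AlmostAll L₀ := almostAll_freeLattice b
  have aN : AlmostAll N := aL₀.congr hbad fun v hv =>
    congrArg Submodule.toSubspace (hgood v hv).1.symm
  have aDL : AlmostAll (D mL) := aL.mono hLL
  have aDL₀ : AlmostAll (D mL₀) := hDL₀ ▸ almostAll_freeLattice b'
  have eDL : ∀ v ∉ bad, D mL v = L v := fun v hv => congrArg Submodule.toSubspace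
    (show B.dualSubmodule (mL v) = mL v by rw [(hgood v hv).2.1, (hgood v hv).2.2])
  have eDL₀ : ∀ v ∉ bad, D mL₀ v = D mN v := fun v hv => congrArg Submodule.toSubspace
    (show B.dualSubmodule (mL₀ v) = B.dualSubmodule (mN v) by rw [(hgood v hv).1])
  have eDLN : ∀ v ∉ bad, D mL v = D mN v := fun v hv => congrArg Submodule.toSubspace
    (show B.dualSubmodule (mL v) = B.dualSubmodule (mN v) by
      rw [(hgood v hv).1, (hgood v hv).2.1])
  have eNL : ∀ v ∉ bad, N v = L v := fun v hv => congrArg Submodule.toSubspace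
    ((hgood v hv).1.trans (hgood v hv).2.1.symm)
  have eNL₀ : ∀ v ∉ bad, N v = L₀ v := fun v hv => congrArg Submodule.toSubspace (hgood v hv).1
  have zE : hZero (Place.lattice : Place K E → _) = 1 := hZero_lattice K E
  have zL : hZero L = 1 := by
    rw [← hZero_lattice K F, ← hZero_intClLattice (E := E)]
    rfl
  have oL : hOne L = hOne (Place.lattice : Place K F → _) := by
    rw [← hOne_intClLattice (E := E)]
    rfl
  have zL₀ : hZero L₀ = Module.finrank E F := by
    have := hZero_freeLattice (K := K) b
    rwa [zE, Fintype.card_fin, mul_one] at this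
  have oL₀ : hOne L₀ = Module.finrank E F * hOne (Place.lattice : Place K E → _) := by
    have := hOne_freeLattice (K := K) b
    rwa [Fintype.card_fin] at this
  have zDL₀ : hZero (D mL₀) = Module.finrank E F := by
    have := hZero_freeLattice (K := K) b'
    rwa [zE, Fintype.card_fin, mul_one, ← hDL₀] at this
  have oDL₀ : hOne (D mL₀) = Module.finrank E F * hOne (Place.lattice : Place K E → _) := by
    have := hOne_freeLattice (K := K) b'
    rwa [Fintype.card_fin, ← hDL₀] at this
  have hfin : ∀ v : Place K E, relLength (L v) (D mL v) ≠ ⊤ := by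
    intro v
    obtain ⟨m, e, he⟩ := v.exists_basis_intClModule F
    have := relLength_span_basis_ne_top v e (B.dualBasis hB e)
    rw [← B.dualSubmodule_span_of_basis hB e, he] at this
    exact this
  have hle : ∀ v, relLength (N v) (L v) ≤ relLength (D mL v) (D mN v) := by
    intro v
    obtain ⟨m, e, he⟩ := v.exists_basis_intClModule F
    have := relLength_dualSubmodule_span (v := v) hB hB' (c v) e
    rwa [he] at this
  have hle₀ : ∀ v, relLength (D mL₀ v) (D mN v) ≤ relLength (N v) (L₀ v) := fun v =>
    relLength_dualSubmodule_le B (mN v) (mL₀ v)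
  have hfin₀ : ∀ v, relLength (N v) (L₀ v) ≠ ⊤ := fun v => relLength_span_basis_ne_top v (c v) b
  have hfinD : ∀ v, relLength (D mL v) (D mN v) ≠ ⊤ := by
    intro v
    obtain ⟨m, e, he⟩ := v.exists_basis_intClModule F
    have := relLength_span_basis_ne_top v (B.dualBasis hB e) (B.dualBasis hB (c v))
    rw [← B.dualSubmodule_span_of_basis hB e, ← B.dualSubmodule_span_of_basis hB (c v), he] at this
    exact this
  have sum_ne_top : ∀ {T : Finset (Place K E)} {f : Place K E → ℕ∞}, (∀ v, f v ≠ ⊤) →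
      ∑ v ∈ T, f v ≠ ⊤ := fun h => WithTop.sum_ne_top.mpr fun v _ => h v
  -- Put `χ = hZero - hOne`. By `q₁` and `q₂`, `χ(L) - χ(L₀)` is the index of `N` in `L` minus that
  -- in `L₀`; by `q₃` and `q₄`, `χ(D mL) - χ(D mL₀)` is the index of `D mL₀` in `D mN` minus that of
  -- `D mL`. The bounds `r₁` and `r₂` make the sum of these differences nonpositive, and `q₅` turns
  -- `χ(D mL)` into `χ(L)` plus the degree of the different.
  have main : ∀ T : Finset (Place K E), bad ⊆ T →
      hOne L ≠ ⊤ ∧ (∑ v ∈ T, relLength (L v) (D mL v)).toNat ≤ 2 * ((hOne L).toNat : ℤ) - 2 -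
          Module.finrank E F * (2 * ((hOne (Place.lattice : Place K E → _)).toNat : ℤ) - 2) := by
    intro T hT
    have out : ∀ v ∉ T, v ∉ bad := fun v hv h => hv (hT h)
    have q₁ := hZero_add_hOne (fun v => hNL v) T (fun v hv => eNL v (out v hv)) aN
    have q₂ := hZero_add_hOne (fun v => hNL₀ v) T (fun v hv => eNL₀ v (out v hv)) aN
    have q₃ := hZero_add_hOne (L := D mL) (L' := D mN) (fun v => hD (hNL v)) T
      (fun v hv => eDLN v (out v hv)) aDL
    have q₄ := hZero_add_hOne (L := D mL₀) (L' := D mN) (fun v => hD (hNL₀ v)) T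
      (fun v hv => eDL₀ v (out v hv)) aDL₀
    have q₅ := hZero_add_hOne (L := L) (L' := D mL) hLL T
      (fun v hv => (eDL v (out v hv)).symm) aL
    have r₁ : ∑ v ∈ T, relLength (N v) (L v) ≤ ∑ v ∈ T, relLength (D mL v) (D mN v) :=
      Finset.sum_le_sum fun v _ => hle v
    have r₂ : ∑ v ∈ T, relLength (D mL₀ v) (D mN v) ≤ ∑ v ∈ T, relLength (N v) (L₀ v) :=
      Finset.sum_le_sum fun v _ => hle₀ v
    have f₃ : ∑ v ∈ T, relLength (D mL v) (D mN v) ≠ ⊤ := sum_ne_top hfinD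
    have f₂ : ∑ v ∈ T, relLength (N v) (L₀ v) ≠ ⊤ := sum_ne_top hfin₀
    have f₅ : ∑ v ∈ T, relLength (L v) (D mL v) ≠ ⊤ := sum_ne_top hfin
    have f₁ := ne_top_of_le_ne_top f₃ r₁
    have f₄ := ne_top_of_le_ne_top f₂ r₂
    -- The identities hold in `ℕ∞`, so each term must be finite before anything is subtracted;
    -- finiteness of cohomology spreads from the free lattices, where it is that of `E`.
    have zN : hZero N ≠ ⊤ := ne_top_of_le_ne_top (zL₀ ▸ ENat.natCast_ne_top _) (hZero_mono hNL₀)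
    have fg : (Module.finrank E F * hOne (Place.lattice : Place K E → _) : ℕ∞) ≠ ⊤ :=
      WithTop.mul_ne_top (ENat.natCast_ne_top _) hE
    have oN : hOne N ≠ ⊤ := by
      refine ne_top_of_le_ne_top ?_ (le_add_self.trans q₂.le)
      rw [oL₀]
      exact WithTop.add_ne_top.mpr ⟨WithTop.add_ne_top.mpr ⟨zN, f₂⟩, fg⟩
    have oL' : hOne L ≠ ⊤ := by
      refine ne_top_of_le_ne_top ?_ (le_add_self.trans q₁.ge)
      rw [zL]
      exact WithTop.add_ne_top.mpr ⟨ENat.one_ne_top, oN⟩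
    have oDN : hOne (D mN) ≠ ⊤ := ne_top_of_le_ne_top (oDL₀ ▸ fg)
      (hOne_anti (fun v => hD (hNL₀ v)) hbad eDL₀)
    have zDN : hZero (D mN) ≠ ⊤ := by
      refine ne_top_of_le_ne_top ?_ (le_self_add.trans q₄.le)
      rw [zDL₀]
      exact WithTop.add_ne_top.mpr ⟨WithTop.add_ne_top.mpr ⟨ENat.natCast_ne_top _, f₄⟩, oDN⟩
    have zDL : hZero (D mL) ≠ ⊤ := ne_top_of_le_ne_top zDN (hZero_mono fun v => hD (hNL v))
    have oDL : hOne (D mL) ≠ ⊤ := ne_top_of_le_ne_top oL'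
      (hOne_anti hLL hbad fun v hv => (eDL v hv).symm)
    refine ⟨oL', ?_⟩
    rw [zL] at q₁ q₅
    rw [zL₀, oL₀] at q₂
    rw [zDL₀, oDL₀] at q₄
    generalize (∑ v ∈ T, relLength (N v) (L v)) = a₁ at *
    generalize (∑ v ∈ T, relLength (N v) (L₀ v)) = a₂ at *
    generalize (∑ v ∈ T, relLength (D mL v) (D mN v)) = a₃ at *
    generalize (∑ v ∈ T, relLength (D mL₀ v) (D mN v)) = a₄ at *
    generalize (∑ v ∈ T, relLength (L v) (D mL v)) = a₅ at *
    generalize hOne (Place.lattice : Place K E → _) = g at *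
    generalize hOne L = h at *
    generalize hOne N = oN' at *
    generalize hZero N = zN' at *
    generalize hOne (D mN) = oDN' at *
    generalize hZero (D mN) = zDN' at *
    generalize hOne (D mL) = oDL' at *
    generalize hZero (D mL) = zDL' at *
    clear_value D
    lift a₁ to ℕ using f₁
    lift a₂ to ℕ using f₂
    lift a₃ to ℕ using f₃
    lift a₄ to ℕ using f₄
    lift a₅ to ℕ using f₅
    lift g to ℕ using hE
    lift h to ℕ using oL'
    lift oN' to ℕ using oN
    lift zN' to ℕ using zN
    lift oDN' to ℕ using oDN
    lift zDN' to ℕ using zDN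
    lift oDL' to ℕ using oDL
    lift zDL' to ℕ using zDL
    norm_cast at q₁ q₂ q₃ q₄ q₅ r₁ r₂
    simp only [ENat.toNat_natCast]
    zify at q₁ q₂ q₃ q₄ q₅ r₁ r₂
    linarith
  refine ⟨oL ▸ (main hbad.toFinset (by simp)).1, fun t => ?_⟩
  let T : Finset (Place K E) := hbad.toFinset ∪ t.image fun w => w.comap E
  obtain ⟨-, h⟩ := main T (fun v hv => by simp [T, hv])
  rw [oL] at h
  refine le_trans ?_ h
  have h₁ : (∑ w ∈ t, (w.ram E - 1) : ℕ) ≤ ∑ v ∈ T, ∑ w ∈ v.fibre F, (w.ram E - 1) := by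
    rw [← Finset.sum_biUnion]
    · refine Finset.sum_le_sum_of_subset fun w hw => ?_
      rw [Finset.mem_biUnion]
      exact ⟨w.comap E, Finset.mem_union_right _ (Finset.mem_image_of_mem _ hw),
        Place.mem_fibre.mpr rfl⟩
    · intro v _ v' _ hvv
      rw [Function.onFun, Finset.disjoint_left]
      intro w hw hw'
      exact hvv ((Place.mem_fibre.mp hw).symm.trans (Place.mem_fibre.mp hw'))
  have h₂ : (∑ v ∈ T, ∑ w ∈ v.fibre F, (w.ram E - 1)) ≤
      (∑ v ∈ T, relLength (L v) (D mL v)).toNat := by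
    rw [← ENat.natCast_le_natCast, ENat.natCast_toNat (sum_ne_top hfin), Nat.cast_sum]
    exact Finset.sum_le_sum fun v _ => sum_ram_sub_one_le v
  have h₃ : ∑ w ∈ t, ((w.ram E : ℤ) - 1) = ((∑ w ∈ t, (w.ram E - 1) : ℕ) : ℤ) := by
    rw [Nat.cast_sum]
    refine Finset.sum_congr rfl fun w _ => ?_
    have : 0 < w.ram E := Place.ram_pos (v := w.comap E) rfl
    rw [Nat.cast_sub this, Nat.cast_one]
  rw [h₃]
  exact_mod_cast h₁.trans h₂

end Hurwitz

/-! ### The rational function field and its genus zero. -/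

section Rational

open IntermediateField Polynomial

variable {K E : Type*} [Field K] [Field E] [Algebra K E]

namespace Place

variable {v w : Place K E} {y : E}

lemma inv_mem_of_notMem_nonunits {z : E} (hz : z ∉ v.ring.nonunits) : z⁻¹ ∈ v.ring := by
  rw [ValuationSubring.mem_nonunits_iff, not_lt] at hz
  rw [← v.ring.valuation_le_one_iff, map_inv₀]
  exact inv_le_one_of_one_le₀ hz

lemma inv_mem_nonunits {z : E} (hz : z ∉ v.ring) : z⁻¹ ∈ v.ring.nonunits := by
  rw [← v.ring.valuation_le_one_iff, not_le] at hz
  rw [ValuationSubring.mem_nonunits_iff, map_inv₀]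
  exact inv_lt_one_of_one_lt₀ hz

lemma sub_mem_nonunits {z z' : E} (h : z ∈ v.ring.nonunits) (h' : z' ∈ v.ring.nonunits) :
    z - z' ∈ v.ring.nonunits := by
  rw [ValuationSubring.mem_nonunits_iff_exists_mem_maximalIdeal] at h h' ⊢
  exact ⟨sub_mem h.1 h'.1, sub_mem h.2 h'.2⟩

lemma aeval_mem (hy : y ∈ v.ring) (p : K[X]) : aeval y p ∈ v.ring := by
  rw [aeval_eq_sum_range]
  refine sum_mem fun i _ => ?_
  rw [Algebra.smul_def]
  exact v.ring.mul_mem _ _ (v.algebraMap_mem _) (pow_mem hy i)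

lemma aeval_sub_mem_nonunits (hy : y ∈ v.ring) (a : K) (h : y - algebraMap K E a ∈ v.ring.nonunits)
    (p : K[X]) : aeval y p - algebraMap K E (p.eval a) ∈ v.ring.nonunits := by
  obtain ⟨q, hq⟩ := X_sub_C_dvd_sub_C_eval (a := a) (p := p)
  have := congrArg (aeval y) hq
  rw [map_sub, map_mul, map_sub, aeval_X, aeval_C, aeval_C] at this
  rw [this]
  exact mem_nonunits_of_mul h (aeval_mem hy q)

/-- Numerator and denominator are polynomials in `y`; splitting off the powers of `y` leaves nonzero
constant terms, and `a` is their quotient. The conclusion covers every place where `y` vanishes, so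
that it also shows such a place to be unique. -/
lemma exists_eq_zpow_mul (hy : y ∈ v.ring.nonunits) (hgen : K⟮y⟯ = ⊤) {z : E} (hz : z ≠ 0) :
    ∃ (n : ℤ) (u : E) (a : K), a ≠ 0 ∧ z = y ^ n * u ∧
      ∀ w : Place K E, y ∈ w.ring.nonunits → u - algebraMap K E a ∈ w.ring.nonunits := by
  have poly : ∀ p : K[X], aeval y p ≠ 0 → ∃ (n : ℕ) (q : K[X]), q.eval 0 ≠ 0 ∧
      aeval y p = y ^ n * aeval y q := by
    intro p hp
    have hp0 : p ≠ 0 := by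
      rintro rfl
      exact hp (map_zero _)
    obtain ⟨q, hq, hq'⟩ := exists_eq_pow_rootMultiplicity_mul_and_not_dvd p hp0 0
    refine ⟨rootMultiplicity 0 p, q, fun h => hq' (dvd_iff_isRoot.mpr h), ?_⟩
    have := congrArg (aeval y) hq
    rwa [map_mul, map_pow, map_sub, aeval_X, aeval_C, map_zero, sub_zero] at this
  obtain ⟨p, q, rfl⟩ := mem_adjoin_simple_iff K z |>.mp (hgen ▸ mem_top)
  have hp0 : aeval y p ≠ 0 := fun h => hz (by rw [h, zero_div])
  have hq0 : aeval y q ≠ 0 := fun h => hz (by rw [h, div_zero])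
  have hy0 : y ≠ 0 := by
    rintro rfl
    rw [adjoin_zero] at hgen
    obtain ⟨x, hx⟩ := v.exists_notMem
    have : x ∈ (⊥ : IntermediateField K E) := hgen ▸ mem_top
    obtain ⟨a, rfl⟩ := IntermediateField.mem_bot.mp this
    exact hx (v.algebraMap_mem a)
  obtain ⟨m, p', hp', hm⟩ := poly p hp0
  obtain ⟨n, q', hq', hn⟩ := poly q hq0
  refine ⟨m - n, aeval y p' / aeval y q', p'.eval 0 / q'.eval 0, div_ne_zero hp' hq', ?_, ?_⟩
  · rw [hm, hn, zpow_sub₀ hy0, zpow_natCast, zpow_natCast]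
    field_simp
  · intro w hw
    have hw' := w.ring.nonunits_le hw
    have h0 : y - algebraMap K E 0 ∈ w.ring.nonunits := by rwa [map_zero, sub_zero]
    have h₁ := aeval_sub_mem_nonunits hw' 0 h0 p'
    have h₂ := aeval_sub_mem_nonunits hw' 0 h0 q'
    have h₃ : aeval y q' ∉ w.ring.nonunits := by
      intro h
      have := sub_mem_nonunits h h₂
      rw [sub_sub_cancel] at this
      exact hq' (algebraMap_mem_nonunits this)
    have h₄ : aeval y q' ≠ 0 := by
      intro h
      rw [h] at h₃
      exact h₃ (by simp)
    have hq'' : algebraMap K E (q'.eval 0) ≠ 0 := by simpa using hq'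
    have e : aeval y p' / aeval y q' - algebraMap K E (p'.eval 0 / q'.eval 0) =
        ((aeval y p' - algebraMap K E (p'.eval 0)) -
          (aeval y q' - algebraMap K E (q'.eval 0)) * algebraMap K E (p'.eval 0 / q'.eval 0)) *
          (aeval y q')⁻¹ := by
      rw [map_div₀]
      field_simp
      ring
    rw [e]
    exact mem_nonunits_of_mul (sub_mem_nonunits h₁ (mem_nonunits_of_mul h₂ (w.algebraMap_mem _)))
      (inv_mem_of_notMem_nonunits h₃)

lemma mem_of_sub_mem_nonunits {u : E} {a : K} (h : u - algebraMap K E a ∈ v.ring.nonunits) :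
    u ∈ v.ring := by
  have := v.ring.add_mem _ _ (v.ring.nonunits_le h) (v.algebraMap_mem a)
  rwa [sub_add_cancel] at this

lemma notMem_nonunits_of_sub_mem {u : E} {a : K} (ha : a ≠ 0)
    (h : u - algebraMap K E a ∈ v.ring.nonunits) : u ∉ v.ring.nonunits := by
  intro hu
  have := sub_mem_nonunits hu h
  rw [sub_sub_cancel] at this
  exact ha (algebraMap_mem_nonunits this)

lemma mem_nonunits_of_zpow_neg (hy : y ∈ v.ring.nonunits) (hy0 : y ≠ 0) {n : ℕ} {u : E} {a : K}
    (ha : a ≠ 0) (h : u - algebraMap K E a ∈ v.ring.nonunits)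
    (hz : y ^ (-(n + 1 : ℤ)) * u ∈ v.ring) : False := by
  refine notMem_nonunits_of_sub_mem ha h ?_
  have := mem_nonunits_of_mul hy
    (v.ring.mul_mem _ _ (v.ring.toSubring.pow_mem (v.ring.nonunits_le hy) n) hz)
  rwa [← mul_assoc, ← mul_assoc, ← pow_succ', zpow_neg, ← Nat.cast_succ, zpow_natCast,
    mul_inv_cancel₀ (pow_ne_zero _ hy0), one_mul] at this

lemma ne_zero_of_adjoin_eq_top (hgen : K⟮y⟯ = ⊤) (v : Place K E) : y ≠ 0 := by
  rintro rfl
  rw [adjoin_zero] at hgen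
  obtain ⟨x, hx⟩ := v.exists_notMem
  have : x ∈ (⊥ : IntermediateField K E) := hgen ▸ mem_top
  obtain ⟨a, rfl⟩ := IntermediateField.mem_bot.mp this
  exact hx (v.algebraMap_mem a)

lemma exists_eq_pow_mul (hy : y ∈ v.ring.nonunits) (hgen : K⟮y⟯ = ⊤) {z : E} (hz : z ≠ 0)
    (hzv : z ∈ v.ring) : ∃ (n : ℕ) (u : E) (a : K), a ≠ 0 ∧ z = y ^ n * u ∧
      ∀ w : Place K E, y ∈ w.ring.nonunits → u - algebraMap K E a ∈ w.ring.nonunits := by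
  obtain ⟨n, u, a, ha, rfl, hu⟩ := exists_eq_zpow_mul hy hgen hz
  obtain ⟨n, rfl | rfl⟩ := n.eq_nat_or_neg
  · exact ⟨n, u, a, ha, by rw [zpow_natCast], hu⟩
  · rcases n with - | n
    · exact ⟨0, u, a, ha, by simp, hu⟩
    · exact (mem_nonunits_of_zpow_neg hy (ne_zero_of_adjoin_eq_top hgen v) ha (hu v hy)
        (by simpa using hzv)).elim

lemma eq_of_mem_nonunits_of_adjoin_eq_top (hy : y ∈ v.ring.nonunits) (hy' : y ∈ w.ring.nonunits)
    (hgen : K⟮y⟯ = ⊤) : v = w := by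
  have key : ∀ v w : Place K E, y ∈ v.ring.nonunits → y ∈ w.ring.nonunits →
      v.ring ≤ w.ring := by
    intro v w hy hy' z hz
    by_cases hz0 : z = 0
    · rw [hz0]
      exact w.ring.zero_mem
    · obtain ⟨n, u, a, ha, rfl, hu⟩ := exists_eq_pow_mul hy hgen hz0 hz
      exact w.ring.mul_mem _ _ (w.ring.toSubring.pow_mem (w.ring.nonunits_le hy') n)
        (mem_of_sub_mem_nonunits (hu w hy'))
  have h := le_antisymm (key v w hy hy') (key w v hy' hy)
  cases v
  cases w
  simpa using h

lemma isDiscreteValuationRing_of_adjoin_eq_top (hy : y ∈ v.ring.nonunits) (hgen : K⟮y⟯ = ⊤) :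
    IsDiscreteValuationRing v.ring := by
  have hy0 := ne_zero_of_adjoin_eq_top hgen v
  have hyv := v.ring.nonunits_le hy
  have hunit : ∀ z : v.ring, (z : E) ∉ v.ring.nonunits → IsUnit z := by
    intro z hz
    by_contra h
    exact hz (ValuationSubring.mem_nonunits_iff_exists_mem_maximalIdeal.mpr ⟨z.2, h⟩)
  have hnon : ∀ z : v.ring, (z : E) ∈ v.ring.nonunits → ¬ IsUnit z := by
    intro z hz
    obtain ⟨_, h⟩ := ValuationSubring.mem_nonunits_iff_exists_mem_maximalIdeal.mp hz
    exact h
  have hdec : ∀ {z : v.ring}, z ≠ 0 → ∃ n : ℕ, Associated (⟨y, hyv⟩ ^ n) z := by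
    intro z hz0
    obtain ⟨n, u, a, ha, h, hu⟩ := exists_eq_pow_mul hy hgen (z := z)
      (fun h => hz0 (Subtype.ext h)) z.2
    have hu' := hu v hy
    have := hunit ⟨u, mem_of_sub_mem_nonunits hu'⟩ (notMem_nonunits_of_sub_mem ha hu')
    exact ⟨n, this.unit, Subtype.ext h.symm⟩
  refine IsDiscreteValuationRing.ofHasUnitMulPowIrreducibleFactorization
    ⟨⟨y, hyv⟩, ⟨hnon _ hy, ?_⟩, hdec⟩
  intro z z' h
  by_contra! hc
  have h' : y = z * z' := congrArg Subtype.val h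
  have hz0 : z ≠ 0 := by
    rintro rfl
    exact hy0 (by simpa using h')
  have hz0' : z' ≠ 0 := by
    rintro rfl
    exact hy0 (by simpa using h')
  have hdvd : ∀ {z : v.ring}, z ≠ 0 → ¬ IsUnit z → (⟨y, hyv⟩ : v.ring) ∣ z := by
    intro z hz hzu
    obtain ⟨n, hn⟩ := hdec hz
    rcases n with - | n
    · rw [pow_zero] at hn
      exact absurd (hn.isUnit isUnit_one) hzu
    · exact (dvd_pow_self _ n.succ_ne_zero).trans hn.dvd
  obtain ⟨s, rfl⟩ := hdvd hz0 hc.1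
  obtain ⟨s', rfl⟩ := hdvd hz0' hc.2
  refine hnon ⟨y, hyv⟩ hy (IsUnit.of_mul_eq_one (s * s') ?_)
  have hy0' : (⟨y, hyv⟩ : v.ring) ≠ 0 := fun h => hy0 (congrArg Subtype.val h)
  refine mul_left_cancel₀ hy0' ?_
  rw [mul_one]
  nth_rw 3 [h]
  ring

lemma exists_sub_mem_nonunits_of_adjoin_eq_top (hy : y ∈ v.ring.nonunits) (hgen : K⟮y⟯ = ⊤) {z : E}
    (hz : z ∈ v.ring) : ∃ a : K, z - algebraMap K E a ∈ v.ring.nonunits := by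
  by_cases hz0 : z = 0
  · exact ⟨0, by simp [hz0]⟩
  · obtain ⟨n, u, a, ha, rfl, hu⟩ := exists_eq_pow_mul hy hgen hz0 hz
    rcases n with - | n
    · exact ⟨a, by simpa using hu v hy⟩
    · refine ⟨0, ?_⟩
      rw [map_zero, sub_zero, pow_succ', mul_assoc]
      exact mem_nonunits_of_mul hy (v.ring.mul_mem _ _
        (v.ring.toSubring.pow_mem (v.ring.nonunits_le hy) n)
        (mem_of_sub_mem_nonunits (hu v hy)))

/-- Partial fractions: the principal part at `v` is a polynomial in `y⁻¹`, found one coefficient at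
a time, and `y⁻¹` is regular elsewhere because `y` vanishes only at `v`. -/
lemma exists_sub_mem_of_adjoin_eq_top (hy : y ∈ v.ring.nonunits) (hgen : K⟮y⟯ = ⊤) (z : E) :
    ∃ f : E, z - f ∈ v.ring ∧ ∀ w : Place K E, w ≠ v → f ∈ w.ring := by
  have hy0 := ne_zero_of_adjoin_eq_top hgen v
  have hinv : ∀ w : Place K E, w ≠ v → y⁻¹ ∈ w.ring := by
    intro w hw
    by_contra h
    have := inv_mem_nonunits h
    rw [inv_inv] at this
    exact hw (eq_of_mem_nonunits_of_adjoin_eq_top this hy hgen)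
  have key : ∀ (n : ℕ) (u : E), u ∈ v.ring → ∃ f : E, y⁻¹ ^ n * u - f ∈ v.ring ∧
      ∀ w : Place K E, w ≠ v → f ∈ w.ring := by
    intro n
    induction n with
    | zero => exact fun u hu => ⟨0, by simpa using hu, fun w _ => w.ring.zero_mem⟩
    | succ n ih =>
      intro u hu
      obtain ⟨a, ha⟩ := exists_sub_mem_nonunits_of_adjoin_eq_top hy hgen hu
      have hu' : y⁻¹ * (u - algebraMap K E a) ∈ v.ring := by
        by_cases h0 : u - algebraMap K E a = 0
        · rw [h0, mul_zero]
          exact v.ring.zero_mem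
        · obtain ⟨m, u', b, hb, hm, hu'⟩ := exists_eq_pow_mul hy hgen h0 (v.ring.nonunits_le ha)
          rcases m with - | m
          · rw [pow_zero, one_mul] at hm
            rw [hm] at ha
            exact absurd ha (notMem_nonunits_of_sub_mem hb (hu' v hy))
          · rw [hm, pow_succ', mul_assoc, inv_mul_cancel_left₀ hy0]
            exact v.ring.mul_mem _ _ (v.ring.toSubring.pow_mem (v.ring.nonunits_le hy) m)
              (mem_of_sub_mem_nonunits (hu' v hy))
      obtain ⟨f, hf, hf'⟩ := ih _ hu'
      refine ⟨f + y⁻¹ ^ (n + 1) * algebraMap K E a, ?_, fun w hw => w.ring.add_mem _ _ (hf' w hw)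
        (w.ring.mul_mem _ _ (pow_mem (hinv w hw) _) (w.algebraMap_mem a))⟩
      convert hf using 1
      ring
  by_cases hz0 : z = 0
  · exact ⟨0, by simp [hz0], fun w _ => w.ring.zero_mem⟩
  obtain ⟨n, u, a, ha, rfl, hu⟩ := exists_eq_zpow_mul hy hgen hz0
  have huv := mem_of_sub_mem_nonunits (hu v hy)
  obtain ⟨n, rfl | rfl⟩ := n.eq_nat_or_neg
  · refine ⟨0, ?_, fun w _ => w.ring.zero_mem⟩
    rw [sub_zero, zpow_natCast]
    exact v.ring.mul_mem _ _ (v.ring.toSubring.pow_mem (v.ring.nonunits_le hy) n) huv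
  · rw [zpow_neg, zpow_natCast, ← inv_pow]
    exact key n u huv

/-- If `x` is regular at `v` and no `x - a` vanishes there, every nonzero polynomial in `x`, being a
product of linear factors, has its inverse in `v.ring`, which would then be all of `E`. -/
lemma exists_mem_nonunits_of_adjoin_eq_top [IsAlgClosed K] {x : E} (hx : K⟮x⟯ = ⊤)
    (v : Place K E) : (x⁻¹ ∈ v.ring.nonunits ∧ K⟮x⁻¹⟯ = ⊤) ∨
      (x ∈ v.ring ∧ ∃ a : K, x - algebraMap K E a ∈ v.ring.nonunits ∧
        K⟮x - algebraMap K E a⟯ = ⊤) := by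
  by_cases hxv : x ∈ v.ring
  · refine Or.inr ⟨hxv, ?_⟩
    have hgen : ∀ a : K, K⟮x - algebraMap K E a⟯ = ⊤ := by
      intro a
      refine top_le_iff.mp (hx.ge.trans (adjoin_simple_le_iff.mpr ?_))
      have := add_mem (mem_adjoin_simple_self K (x - algebraMap K E a))
        (IntermediateField.algebraMap_mem K⟮x - algebraMap K E a⟯ a)
      rwa [sub_add_cancel] at this
    by_contra! hc
    have hc' : ∀ a : K, x - algebraMap K E a ∉ v.ring.nonunits := fun a h => hc a h (hgen a)
    have hunit : ∀ p : K[X], p ≠ 0 → (aeval x p)⁻¹ ∈ v.ring := by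
      intro p hp
      rw [(IsAlgClosed.splits p).eq_prod_roots, map_mul, aeval_C, mul_inv, ← map_inv₀,
        map_multiset_prod, Multiset.map_map]
      refine v.ring.mul_mem _ _ (v.algebraMap_mem _) ?_
      rw [← Multiset.prod_map_inv']
      refine multiset_prod_mem _ fun z hz => ?_
      simp only [Multiset.map_map, Multiset.mem_map, Function.comp_apply, map_sub, aeval_X,
        aeval_C] at hz
      obtain ⟨a, -, rfl⟩ := hz
      exact inv_mem_of_notMem_nonunits (hc' a)
    obtain ⟨z, hz⟩ := v.exists_notMem
    obtain ⟨p, q, rfl⟩ := mem_adjoin_simple_iff K z |>.mp (hx ▸ mem_top)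
    by_cases hq : q = 0
    · rw [hq, map_zero, div_zero] at hz
      exact hz v.ring.zero_mem
    · rw [div_eq_mul_inv] at hz
      exact hz (v.ring.mul_mem _ _ (aeval_mem hxv p) (hunit q hq))
  · refine Or.inl ⟨inv_mem_nonunits hxv, top_le_iff.mp (hx.ge.trans (adjoin_simple_le_iff.mpr ?_))⟩
    have := inv_mem (mem_adjoin_simple_self K x⁻¹)
    rwa [inv_inv] at this

lemma exists_uniformizer_of_adjoin_eq_top [IsAlgClosed K] {x : E} (hx : K⟮x⟯ = ⊤)
    (v : Place K E) : ∃ y ∈ v.ring.nonunits, K⟮y⟯ = ⊤ := by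
  obtain ⟨h, h'⟩ | ⟨-, a, h, h'⟩ := exists_mem_nonunits_of_adjoin_eq_top hx v
  · exact ⟨_, h, h'⟩
  · exact ⟨_, h, h'⟩

end Place

variable [IsAlgClosed K] {x : E}

lemma IsCurveField.of_adjoin_eq_top (hx : K⟮x⟯ = ⊤) : IsCurveField K E where
  dvr v := by
    obtain ⟨y, hy, hgen⟩ := v.exists_uniformizer_of_adjoin_eq_top hx
    exact Place.isDiscreteValuationRing_of_adjoin_eq_top hy hgen
  residue v z hz := by
    obtain ⟨y, hy, hgen⟩ := v.exists_uniformizer_of_adjoin_eq_top hx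
    exact Place.exists_sub_mem_nonunits_of_adjoin_eq_top hy hgen hz
  finite z := by
    classical
    have h₁ : {v : Place K E | x⁻¹ ∈ v.ring.nonunits ∧ K⟮x⁻¹⟯ = ⊤}.Finite :=
      Set.Subsingleton.finite fun v hv w hw =>
        Place.eq_of_mem_nonunits_of_adjoin_eq_top hv.1 hw.1 hv.2
    have h₂ : ∀ a : K, {v : Place K E | x - algebraMap K E a ∈ v.ring.nonunits ∧
        K⟮x - algebraMap K E a⟯ = ⊤}.Finite := fun a =>
      Set.Subsingleton.finite fun v hv w hw =>
        Place.eq_of_mem_nonunits_of_adjoin_eq_top hv.1 hw.1 hv.2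
    obtain ⟨p, q, rfl⟩ := mem_adjoin_simple_iff K z |>.mp (hx ▸ mem_top)
    refine (h₁.union (q.roots.toFinset.finite_toSet.biUnion fun a _ => h₂ a)).subset fun v hv => ?_
    obtain h | ⟨hxv, a, h, h'⟩ := Place.exists_mem_nonunits_of_adjoin_eq_top hx v
    · exact Or.inl h
    · refine Or.inr (Set.mem_biUnion (x := a) ?_ ⟨h, h'⟩)
      have hq : q ≠ 0 := by
        rintro rfl
        rw [Set.mem_ofPred_eq, map_zero, div_zero] at hv
        exact hv v.ring.zero_mem
      rw [Finset.mem_coe, Multiset.mem_toFinset, mem_roots hq, IsRoot.def]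
      by_contra ha
      have := Place.notMem_nonunits_of_sub_mem ha (Place.aeval_sub_mem_nonunits hxv a h q)
      rw [Set.mem_ofPred_eq, div_eq_mul_inv] at hv
      exact hv (v.ring.mul_mem _ _ (Place.aeval_mem hxv p)
        (Place.inv_mem_of_notMem_nonunits this))

/-- The sum of the finitely many principal parts is one function realizing all of them. This is the
starting point for the finiteness of the genus. -/
lemma hOne_eq_zero_of_adjoin_eq_top (hx : K⟮x⟯ = ⊤) :
    hOne (Place.lattice : Place K E → _) = 0 := by
  classical
  refine relLength_self_of_le fun r hr => ?_
  have hr' : {p : Place K E | r p ∉ p.ring}.Finite := hr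
  have key (p : Place K E) : ∃ f : E, r p - f ∈ p.ring ∧ ∀ w : Place K E, w ≠ p → f ∈ w.ring := by
    obtain ⟨y, hy, hgen⟩ := p.exists_uniformizer_of_adjoin_eq_top hx
    exact Place.exists_sub_mem_of_adjoin_eq_top hy hgen (r p)
  choose f hf hf' using key
  let g := ∑ p ∈ hr'.toFinset, f p
  rw [← sub_add_cancel r fun _ => g]
  refine Submodule.add_mem_sup (fun q _ => ?_) (mem_constants.mpr ⟨g, rfl⟩)
  change r q - g ∈ q.ring
  by_cases hq : r q ∈ q.ring
  · refine sub_mem hq (sum_mem fun p hp => hf' p q ?_)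
    rintro rfl
    exact (hr'.mem_toFinset.mp hp) hq
  · have hg : g = f q + ∑ p ∈ hr'.toFinset.erase q, f p :=
      (Finset.add_sum_erase _ _ (hr'.mem_toFinset.mpr hq)).symm
    rw [hg, ← sub_sub]
    exact sub_mem (hf q) (sum_mem fun p hp => hf' p q (Finset.ne_of_mem_erase hp).symm)

end Rational

/-! ### Étale coordinates and local rings of smooth algebras of dimension one. -/

section LocalAlgebra

/-- A noetherian local ring whose maximal ideal is generated by a regular element is a discrete
valuation ring. -/
lemma isDiscreteValuationRing_of_maximalIdeal_eq_span {S : Type*} [CommRing S] [IsLocalRing S]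
    [IsNoetherianRing S] {t : S} (ht : IsLocalRing.maximalIdeal S = Ideal.span {t})
    (hreg : t ∈ nonZeroDivisors S) : ∃ _ : IsDomain S, IsDiscreteValuationRing S := by
  have hdec : ∀ {x : S}, x ≠ 0 → ∃ (n : ℕ) (u : Sˣ), t ^ n * u = x := by
    intro x hx
    -- Krull's intersection theorem gives every nonzero element a finite `t`-adic order.
    have hinf := Ideal.iInf_pow_eq_bot_of_isLocalRing (IsLocalRing.maximalIdeal S)
      (IsLocalRing.maximalIdeal.isMaximal S).ne_top
    have hex : ∃ n, x ∉ IsLocalRing.maximalIdeal S ^ n := by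
      by_contra! h
      refine hx ?_
      rw [← Ideal.mem_bot, ← hinf]
      exact (Submodule.mem_iInf _).mpr h
    classical
    have hn := Nat.find_spec hex
    obtain ⟨n, hn'⟩ : ∃ n, Nat.find hex = n + 1 := Nat.exists_eq_succ_of_ne_zero (by
      intro h
      rw [h, pow_zero, Ideal.one_eq_top] at hn
      exact hn trivial)
    have hlt : x ∈ IsLocalRing.maximalIdeal S ^ n := by
      by_contra h
      exact Nat.find_min hex (hn' ▸ n.lt_succ_self) h
    rw [hn'] at hn
    rw [ht, Ideal.span_singleton_pow, Ideal.mem_span_singleton] at hn hlt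
    obtain ⟨u, rfl⟩ := hlt
    have hu : IsUnit u := by
      by_contra hu
      have : u ∈ IsLocalRing.maximalIdeal S := hu
      rw [ht, Ideal.mem_span_singleton] at this
      obtain ⟨w, rfl⟩ := this
      exact hn ⟨w, by ring⟩
    exact ⟨n, hu.unit, rfl⟩
  have hdom : IsDomain S := by
    have : NoZeroDivisors S := ⟨fun {x y} hxy => by
      by_contra! h
      obtain ⟨n, u, rfl⟩ := hdec h.1
      obtain ⟨m, w, rfl⟩ := hdec h.2
      have e : t ^ (n + m) * ((u * w : Sˣ) : S) = 0 := by
        rw [← hxy, Units.val_mul]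
        ring
      rw [Units.mul_left_eq_zero] at e
      exact nonZeroDivisors.ne_zero (pow_mem hreg (n + m)) e⟩
    exact NoZeroDivisors.to_isDomain S
  refine ⟨hdom, IsDiscreteValuationRing.ofHasUnitMulPowIrreducibleFactorization
    ⟨t, ?_, fun hx => (hdec hx).imp fun n ⟨u, hu⟩ => ⟨u, hu⟩⟩⟩
  have ht0 := nonZeroDivisors.ne_zero hreg
  have hp : (Ideal.span {t}).IsPrime := ht ▸ (IsLocalRing.maximalIdeal.isMaximal S).isPrime
  exact ((Ideal.span_singleton_prime ht0).mp hp).irreducible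

/-- An étale algebra over a principal ideal domain has fields and discrete valuation rings as its
local rings. -/
lemma isField_or_isDiscreteValuationRing_of_etale (R : Type*) {A : Type*}
    [CommRing R] [IsDomain R] [IsPrincipalIdealRing R] [CommRing A] [Algebra R A]
    [Algebra.Etale R A] (q : Ideal A) [q.IsPrime] :
    IsField (Localization.AtPrime q) ∨
      ∃ _ : IsDomain (Localization.AtPrime q),
        IsDiscreteValuationRing (Localization.AtPrime q) := by
  let p := q.under R
  let := Localization.AtPrime.algebraOfLiesOver p q
  have : IsNoetherianRing A := Algebra.FiniteType.isNoetherianRing R A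
  -- Unramifiedness makes a generator of `p` generate the maximal ideal of the local ring; flatness
  -- keeps it regular if it is nonzero.
  have h := ((Algebra.isUnramifiedAt_iff_map_eq R p q).mp inferInstance).2
  obtain ⟨g, hg⟩ := IsPrincipalIdealRing.principal p
  rw [hg, Ideal.submodule_span_eq, Ideal.map_span, Set.image_singleton] at h
  by_cases hg0 : g = 0
  · left
    rw [hg0, map_zero, Ideal.span_singleton_eq_bot.mpr rfl] at h
    exact IsLocalRing.isField_iff_maximalIdeal_eq.mpr h.symm
  · right
    refine isDiscreteValuationRing_of_maximalIdeal_eq_span h.symm ?_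
    have : Module.Flat R (Localization.AtPrime q) := Module.Flat.trans R A _
    rw [mem_nonZeroDivisors_iff_right]
    intro x hx
    have hreg : IsSMulRegular (Localization.AtPrime q) (algebraMap R (Localization.AtPrime q) g) :=
      IsSMulRegular.of_flat fun a b hab => mul_left_cancel₀ hg0 hab
    refine hreg ?_
    change _ * x = _ * 0
    rw [mul_zero, mul_comm, hx]

lemma _root_.Algebra.IsStandardSmoothOfRelativeDimension.isField_or_isDiscreteValuationRing
    (K : Type*) {A : Type*} [Field K] [CommRing A] [Algebra K A]
    [Algebra.IsStandardSmoothOfRelativeDimension 1 K A] (q : Ideal A) [q.IsPrime] :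
    IsField (Localization.AtPrime q) ∨
      ∃ _ : IsDomain (Localization.AtPrime q),
        IsDiscreteValuationRing (Localization.AtPrime q) := by
  obtain ⟨g, hg⟩ :=
    Algebra.IsStandardSmoothOfRelativeDimension.exists_etale_mvPolynomial (n := 1) (R := K) (S := A)
  let := g.toRingHom.toAlgebra
  have : Algebra.Etale (MvPolynomial (Fin 1) K) A := hg
  have : IsPrincipalIdealRing (MvPolynomial (Fin 1) K) :=
    IsPrincipalIdealRing.of_surjective (MvPolynomial.uniqueAlgEquiv K (Fin 1)).symm.toRingEquiv
      (MvPolynomial.uniqueAlgEquiv K (Fin 1)).symm.surjective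
  exact isField_or_isDiscreteValuationRing_of_etale (MvPolynomial (Fin 1) K) q

open IntermediateField in
-- `t` is an étale coordinate: `F` is formally unramified and essentially of finite type over
-- `K(t)`, hence finite separable. Were `A` a field, the Nullstellensatz for Jacobson rings would
-- make it finite over `K[t]`, and `K[t]` would be a field.
lemma _root_.Algebra.IsStandardSmoothOfRelativeDimension.exists_isSeparable_adjoin
    (K : Type*) {A F : Type*} [Field K] [CommRing A] [IsDomain A] [Field F] [Algebra K A]
    [Algebra A F] [Algebra K F] [IsScalarTower K A F] [IsFractionRing A F]
    [Algebra.IsStandardSmoothOfRelativeDimension 1 K A] :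
    ¬ IsField A ∧ ∃ t : F, t ∉ Set.range (algebraMap K F) ∧ FiniteDimensional K⟮t⟯ F ∧
      Algebra.IsSeparable K⟮t⟯ F := by
  obtain ⟨g, hg⟩ :=
    Algebra.IsStandardSmoothOfRelativeDimension.exists_etale_mvPolynomial (n := 1) (R := K) (S := A)
  let R := MvPolynomial (Fin 1) K
  let := g.toRingHom.toAlgebra
  have : Algebra.Etale R A := hg
  have hinj : Function.Injective (algebraMap R A) := FaithfulSMul.algebraMap_injective R A
  refine ⟨fun hA => ?_, algebraMap A F (g (MvPolynomial.X 0)), ?_, ?_⟩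
  · let := hA.toField
    have : Module.Finite R A := finite_of_finite_type_of_isJacobsonRing R A
    have : IsField R := isField_of_isIntegral_of_isField hinj hA
    exact Polynomial.not_isField K
      ((MvPolynomial.uniqueAlgEquiv K (Fin 1)).symm.toMulEquiv.isField this)
  · rintro ⟨a, ha⟩
    rw [IsScalarTower.algebraMap_apply K A F] at ha
    have h' : algebraMap R A (MvPolynomial.C a) = algebraMap R A (MvPolynomial.X 0) := by
      refine Eq.trans ?_ (IsFractionRing.injective A F ha)
      exact g.commutes a
    have h := hinj h'
    have := congrArg MvPolynomial.totalDegree h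
    simp at this
  · let t := algebraMap A F (g (MvPolynomial.X 0))
    let E := K⟮t⟯
    let φ : R →ₐ[K] E := MvPolynomial.aeval fun _ => AdjoinSimple.gen K t
    let := φ.toRingHom.toAlgebra
    let := ((algebraMap A F).comp (algebraMap R A)).toAlgebra
    have : IsScalarTower R A F := .of_algebraMap_eq fun _ => rfl
    have : IsScalarTower R E F := by
      refine .of_algebraMap_eq' ?_
      refine MvPolynomial.ringHom_ext (fun a => ?_) fun i => ?_
      · change algebraMap A F (g (MvPolynomial.C a)) = algebraMap E F (φ (MvPolynomial.C a))
        rw [← MvPolynomial.algebraMap_eq, AlgHom.commutes, AlgHom.commutes,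
          ← IsScalarTower.algebraMap_apply, ← IsScalarTower.algebraMap_apply]
      · change algebraMap A F (g (MvPolynomial.X i)) = algebraMap E F (φ (MvPolynomial.X i))
        rw [MvPolynomial.aeval_X, Subsingleton.elim i 0]
        rfl
    have : Algebra.FormallyUnramified A F := .of_isLocalization (nonZeroDivisors A)
    have : Algebra.FormallyUnramified R F := .comp R A F
    have : Algebra.FormallyUnramified E F := .of_restrictScalars R E F
    have : Algebra.EssFiniteType A F := .of_isLocalization F (nonZeroDivisors A)
    have : Algebra.EssFiniteType R F := .comp R A F
    have : Algebra.EssFiniteType E F := .of_comp R E F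
    exact ⟨Algebra.FormallyUnramified.finite_of_free E F,
      Algebra.FormallyUnramified.isSeparable E F⟩

end LocalAlgebra

/-! ### Local rings, function field and points of a curve. -/

section CurveStalks

variable {k : Type u} [Field k] {X : Scheme.{u}} (f : X ⟶ Spec (.of k))

/-- The structure map of the sections of a `k`-scheme over an open subset. -/
def toSection (U : X.Opens) : k →+* Γ(X, U) :=
  (f.appLE ⊤ U le_top).hom.comp (Scheme.ΓSpecIso (.of k)).inv.hom

lemma germ_toSection (U : X.Opens) (x : X) (hx : x ∈ U) (a : k) :
    X.presheaf.germ U x hx (toSection f U a) = toStalk f x a := by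
  simp only [toStalk, toSection, RingHom.comp_apply]
  simp only [Scheme.Hom.appLE, CommRingCat.hom_comp, RingHom.comp_apply]
  exact TopCat.Presheaf.germ_res_apply ..

lemma exists_isStandardSmooth [hf : IsCurve f] (x : X) :
    ∃ U : X.Opens, IsAffineOpen U ∧ x ∈ U ∧
      (toSection f U).IsStandardSmoothOfRelativeDimension 1 := by
  obtain ⟨V, -, U, hU, hx, e, h⟩ := hf.smooth.exists_isStandardSmoothOfRelativeDimension x
  have hV : V = ⊤ := by
    have := e hx
    refine top_le_iff.mp fun y _ => ?_
    rwa [Subsingleton.elim y (f x)]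
  subst hV
  refine ⟨U, hU, hx, ?_⟩
  exact RingHom.isStandardSmoothOfRelativeDimension_respectsIso.2 _
    (Scheme.ΓSpecIso (.of k)).symm.commRingCatIsoToRingEquiv h

lemma isField_or_isDiscreteValuationRing_stalk [IsCurve f] (x : X) :
    IsField (X.presheaf.stalk x) ∨
      ∃ _ : IsDomain (X.presheaf.stalk x), IsDiscreteValuationRing (X.presheaf.stalk x) := by
  obtain ⟨U, hU, hx, h⟩ := exists_isStandardSmooth f x
  let := (toSection f U).toAlgebra
  have : Algebra.IsStandardSmoothOfRelativeDimension 1 k Γ(X, U) := h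
  let := X.presheaf.algebra_section_stalk (⟨x, hx⟩ : U)
  have := hU.isLocalization_stalk ⟨x, hx⟩
  let q := (hU.primeIdealOf ⟨x, hx⟩).asIdeal
  let e := (IsLocalization.algEquiv q.primeCompl (Localization.AtPrime q)
    (X.presheaf.stalk x)).toRingEquiv
  obtain h | ⟨h, h'⟩ :=
    Algebra.IsStandardSmoothOfRelativeDimension.isField_or_isDiscreteValuationRing k q
  · exact Or.inl (e.symm.toMulEquiv.isField h)
  · have : IsDomain (X.presheaf.stalk x) := e.symm.toMulEquiv.isDomain _
    exact Or.inr ⟨this, IsDiscreteValuationRing.RingEquivClass.isDiscreteValuationRing e⟩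

lemma IsCurve.isIntegral [hf : IsCurve f] : IsIntegral X := by
  have := IsCurve.irreducibleSpace f
  have : ∀ x : X, _root_.IsReduced (X.presheaf.stalk x) := fun x => by
    obtain h | ⟨h, -⟩ := isField_or_isDiscreteValuationRing_stalk f x
    · have := h.isDomain
      infer_instance
    · infer_instance
  have := isReduced_of_isReduced_stalk X
  exact isIntegral_of_irreducibleSpace_of_isReduced X

end CurveStalks

section FunctionField

variable {k : Type u} [Field k] {X : Scheme.{u}} (f : X ⟶ Spec (.of k)) [hf : IsCurve f]

/-- The function field of a curve. -/
def FunctionField : Type u :=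
  haveI := IsCurve.irreducibleSpace f
  X.functionField

instance : Field (FunctionField f) :=
  haveI := IsCurve.isIntegral f
  inferInstanceAs (Field X.functionField)

instance : Algebra k (FunctionField f) :=
  haveI := IsCurve.irreducibleSpace f
  functionFieldAlgebra f

instance (x : X) : Algebra (X.presheaf.stalk x) (FunctionField f) :=
  haveI := IsCurve.irreducibleSpace f
  inferInstanceAs (Algebra (X.presheaf.stalk x) X.functionField)

instance (x : X) : IsFractionRing (X.presheaf.stalk x) (FunctionField f) :=
  haveI := IsCurve.isIntegral f
  inferInstanceAs (IsFractionRing (X.presheaf.stalk x) X.functionField)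

end FunctionField

section Points

variable {k : Type u} [Field k] {X : Scheme.{u}} (f : X ⟶ Spec (.of k)) [hf : IsCurve f]

/-- The generic point of a curve. -/
def generic : X :=
  haveI := IsCurve.irreducibleSpace f
  genericPoint X

lemma generic_specializes (x : X) : generic f ⤳ x := by
  have := IsCurve.irreducibleSpace f
  exact (genericPoint_spec X).specializes trivial

lemma algebraMap_functionField (x : X) : algebraMap (X.presheaf.stalk x) (FunctionField f) =
    (X.presheaf.stalkSpecializes (generic_specializes f x)).hom := rfl

lemma algebraMap_stalk_toStalk (x : X) (a : k) :
    algebraMap (X.presheaf.stalk x) (FunctionField f) (toStalk f x a) =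
      algebraMap k (FunctionField f) a := by
  have := IsCurve.irreducibleSpace f
  exact algebraMap_toStalk f x a

lemma algebraMap_stalkSpecializes {x y : X} (h : x ⤳ y) (a : X.presheaf.stalk y) :
    algebraMap (X.presheaf.stalk x) (FunctionField f) (X.presheaf.stalkSpecializes h a) =
      algebraMap (X.presheaf.stalk y) (FunctionField f) a := by
  rw [algebraMap_functionField, algebraMap_functionField,
    ← TopCat.Presheaf.stalkSpecializes_comp X.presheaf (generic_specializes f x) h]
  rfl

lemma algebraMap_stalk_injective (x : X) :
    Function.Injective (algebraMap (X.presheaf.stalk x) (FunctionField f)) :=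
  have := IsCurve.isIntegral f
  IsFractionRing.injective _ _

lemma primeIdealOf_eq_bot {X : Scheme.{u}} [IsIntegral X] {U : X.Opens} (hU : IsAffineOpen U)
    {y : X} (hy : y ∈ U) (h : IsField (X.presheaf.stalk y)) :
    (hU.primeIdealOf ⟨y, hy⟩).asIdeal = ⊥ := by
  let := X.presheaf.algebra_section_stalk (⟨y, hy⟩ : U)
  have := hU.isLocalization_stalk ⟨y, hy⟩
  rw [eq_bot_iff]
  intro a ha
  by_contra ha0
  have h₁ := (IsLocalization.AtPrime.to_map_mem_maximal_iff (X.presheaf.stalk y)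
    (hU.primeIdealOf ⟨y, hy⟩).asIdeal a).mpr ha
  rw [IsLocalRing.isField_iff_maximalIdeal_eq.mp h, Ideal.mem_bot] at h₁
  have h₂ : Function.Injective (X.presheaf.germ U y hy) := germ_injective_of_isIntegral X y hy
  exact ha0 (h₂ (h₁.trans (map_zero _).symm))

lemma isField_stalk_generic : IsField (X.presheaf.stalk (generic f)) :=
  Field.toIsField (FunctionField f)

/-- A point with a field as its local ring is the zero prime of any affine neighbourhood, as is the
generic point. -/
lemma isField_stalk_iff (x : X) : IsField (X.presheaf.stalk x) ↔ x = generic f := by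
  have := IsCurve.isIntegral f
  constructor
  · intro h
    obtain ⟨U, hU, hx, -⟩ := exists_isStandardSmooth f x
    have hη : generic f ∈ U := (generic_specializes f x).mem_open U.2 hx
    have h' : hU.primeIdealOf ⟨x, hx⟩ = hU.primeIdealOf ⟨generic f, hη⟩ :=
      PrimeSpectrum.ext ((primeIdealOf_eq_bot hU hx h).trans
        (primeIdealOf_eq_bot hU hη (isField_stalk_generic f)).symm)
    have := congrArg hU.fromSpec h'
    rwa [hU.fromSpec_primeIdealOf, hU.fromSpec_primeIdealOf] at this
  · rintro rfl
    exact isField_stalk_generic f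

lemma isDiscreteValuationRing_stalk [IsIntegral X] {x : X} (hx : x ≠ generic f) :
    IsDiscreteValuationRing (X.presheaf.stalk x) := by
  obtain h | ⟨_, h⟩ := isField_or_isDiscreteValuationRing_stalk f x
  · exact absurd ((isField_stalk_iff f x).mp h) hx
  · exact h

lemma exists_algebraMap_stalk_ne {x : X} (hx : x ≠ generic f) :
    ∃ z : FunctionField f, z ∉ Set.range (algebraMap (X.presheaf.stalk x) (FunctionField f)) := by
  by_contra! h
  refine hx ((isField_stalk_iff f x).mp ?_)
  exact (RingEquiv.ofBijective (algebraMap (X.presheaf.stalk x) (FunctionField f))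
    ⟨algebraMap_stalk_injective f x, h⟩).toMulEquiv.isField (Field.toIsField _)

/-- The place of the function field given by a point of a curve other than the generic one. -/
def placeOf {x : X} (hx : x ≠ generic f) : Place k (FunctionField f) :=
  haveI := IsCurve.isIntegral f
  haveI := isDiscreteValuationRing_stalk f hx
  { ring :=
      { (algebraMap (X.presheaf.stalk x) (FunctionField f)).range with
        mem_or_inv_mem' := fun z =>
          ValuationRing.isInteger_or_isInteger (X.presheaf.stalk x) z }
    algebraMap_mem := fun a => ⟨toStalk f x a, algebraMap_stalk_toStalk f x a⟩
    ne_top := fun h => by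
      obtain ⟨z, hz⟩ := exists_algebraMap_stalk_ne f hx
      exact hz (h.ge (ValuationSubring.mem_top z)) }

/-- A local ring of a curve is the valuation ring of the corresponding place. -/
def stalkEquiv {x : X} (hx : x ≠ generic f) : X.presheaf.stalk x ≃+* (placeOf f hx).ring :=
  RingEquiv.ofBijective
    ((algebraMap (X.presheaf.stalk x) (FunctionField f)).codRestrict
      (placeOf f hx).ring.toSubring fun a => ⟨a, rfl⟩)
    ⟨fun _ _ h => algebraMap_stalk_injective f x (congrArg Subtype.val h),
      fun ⟨_, a, ha⟩ => ⟨a, Subtype.ext ha⟩⟩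

lemma isDiscreteValuationRing_placeOf {x : X} (hx : x ≠ generic f) :
    IsDiscreteValuationRing (placeOf f hx).ring :=
  have := IsCurve.isIntegral f
  have := isDiscreteValuationRing_stalk f hx
  IsDiscreteValuationRing.RingEquivClass.isDiscreteValuationRing (stalkEquiv f hx)

lemma SpecMap_fromSpecStalk_closedPoint {X : Scheme.{u}} {x : X} {R : CommRingCat.{u}}
    [IsLocalRing R] (φ : X.presheaf.stalk x ⟶ R) [IsLocalHom φ.hom] :
    (Spec.map φ ≫ X.fromSpecStalk x) (IsLocalRing.closedPoint R) = x := by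
  have h : Spec.map φ (IsLocalRing.closedPoint R) = IsLocalRing.closedPoint (X.presheaf.stalk x) :=
    Spec_closedPoint (f := φ)
  exact (congrArg (X.fromSpecStalk x) h).trans Scheme.fromSpecStalk_closedPoint

/-- A specialization `y` of `x` gives an inclusion of discrete valuation rings of the function
field, hence an equality. The map of stalks is then bijective, in particular local, so it sends
closed point to closed point and `x = y`. -/
lemma isClosed_of_ne_generic {x : X} (hx : x ≠ generic f) : IsClosed {x} := by
  have := IsCurve.isIntegral f
  refine isClosed_of_closure_subset fun y hy => ?_
  have hxy : x ⤳ y := specializes_iff_mem_closure.mpr hy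
  have hy' : y ≠ generic f := by
    rintro rfl
    exact hx (hxy.antisymm (generic_specializes f x)).eq
  have hle : ∀ z ∈ (placeOf f hy').ring, z ∈ (placeOf f hx).ring := by
    rintro z ⟨a, rfl⟩
    exact ⟨_, algebraMap_stalkSpecializes f hxy a⟩
  have := isDiscreteValuationRing_placeOf f hy'
  have heq : placeOf f hy' = placeOf f hx := Place.eq_of_le hle
  have hbij : Function.Bijective (X.presheaf.stalkSpecializes hxy).hom := by
    constructor
    · intro a b h
      refine algebraMap_stalk_injective f y ?_
      rw [← algebraMap_stalkSpecializes f hxy, ← algebraMap_stalkSpecializes f hxy]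
      exact congrArg _ h
    · intro b
      obtain ⟨a, ha⟩ : algebraMap _ (FunctionField f) b ∈ (placeOf f hy').ring := by
        rw [heq]
        exact ⟨b, rfl⟩
      refine ⟨a, algebraMap_stalk_injective f x ?_⟩
      rw [← ha]
      exact algebraMap_stalkSpecializes f hxy a
  have hloc : IsLocalHom (X.presheaf.stalkSpecializes hxy).hom :=
    ⟨fun a ha => by
      let e := RingEquiv.ofBijective _ hbij
      have : IsUnit (e a) := ha
      rwa [MulEquiv.isUnit_map] at this⟩
  have h₁ := SpecMap_fromSpecStalk_closedPoint (X.presheaf.stalkSpecializes hxy)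
  rw [Scheme.SpecMap_stalkSpecializes_fromSpecStalk, Scheme.fromSpecStalk_closedPoint] at h₁
  exact h₁.symm

lemma exists_adjoin_isSeparable :
    ∃ (U : X.Opens) (_ : IsAffineOpen U) (_ : generic f ∈ U), ¬ IsField Γ(X, U) ∧
      ∃ t : FunctionField f, t ∉ Set.range (algebraMap k (FunctionField f)) ∧
        FiniteDimensional (IntermediateField.adjoin k {t}) (FunctionField f) ∧
        Algebra.IsSeparable (IntermediateField.adjoin k {t}) (FunctionField f) := by
  have := IsCurve.isIntegral f
  obtain ⟨U, hU, hη, h⟩ := exists_isStandardSmooth f (generic f)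
  have : Nonempty U := ⟨⟨_, hη⟩⟩
  let := (toSection f U).toAlgebra
  have : Algebra.IsStandardSmoothOfRelativeDimension 1 k Γ(X, U) := h
  let : Algebra Γ(X, U) (FunctionField f) := inferInstanceAs (Algebra Γ(X, U) X.functionField)
  have : IsFractionRing Γ(X, U) (FunctionField f) :=
    functionField_isFractionRing_of_isAffineOpen X U hU
  have : IsScalarTower k Γ(X, U) (FunctionField f) :=
    .of_algebraMap_eq fun a => (germ_toSection f U _ hη a).symm
  exact ⟨U, hU, hη, Algebra.IsStandardSmoothOfRelativeDimension.exists_isSeparable_adjoin k⟩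

lemma ne_generic_of_isClosed {x : X} (hx : IsClosed {x}) : x ≠ generic f := by
  rintro rfl
  have := IsCurve.isIntegral f
  obtain ⟨U, hU, hη, h, -⟩ := exists_adjoin_isSeparable f
  have hmax := hU.primeIdealOf_isMaximal_of_isClosed ⟨_, hη⟩ hx
  rw [primeIdealOf_eq_bot hU hη (isField_stalk_generic f)] at hmax
  have : Nonempty U := ⟨⟨_, hη⟩⟩
  exact h (Ring.isField_iff_maximal_bot.mpr hmax)

end Points

/-! ### Closed points as places, by the valuative criterion. -/

section Centers

lemma fromSpecStalk_comp {k : Type u} [Field k] {X : Scheme.{u}} (f : X ⟶ Spec (.of k)) (x : X) :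
    X.fromSpecStalk x ≫ f = Spec.map (CommRingCat.ofHom (toStalk f x)) := by
  have h : CommRingCat.ofHom (toStalk f x) =
      (Scheme.ΓSpecIso (.of k)).inv ≫ f.appTop ≫ X.presheaf.germ ⊤ x trivial := rfl
  rw [h, Spec.map_comp, Spec.map_comp, ← Scheme.fromSpecStalk_toSpecΓ, Category.assoc,
    Category.assoc, ← Scheme.toSpecΓ_naturality_assoc, ← SpecMap_ΓSpecIso_hom, ← Spec.map_comp,
    Iso.inv_hom_id, Spec.map_id, Category.comp_id]

variable {k : Type u} [Field k] {X : Scheme.{u}} (f : X ⟶ Spec (.of k)) [hf : IsCurve f]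

/-- The inclusion of the generic point of a curve. -/
def fromSpecFunctionField : Spec (.of (FunctionField f)) ⟶ X := X.fromSpecStalk (generic f)

lemma SpecMap_algebraMap_fromSpecStalk (x : X) :
    Spec.map (CommRingCat.ofHom (algebraMap (X.presheaf.stalk x) (FunctionField f))) ≫
      X.fromSpecStalk x = fromSpecFunctionField f :=
  Scheme.SpecMap_stalkSpecializes_fromSpecStalk (generic_specializes f x)

/-- The square of the valuative criterion given by a place of the function field. -/
def valuativeCommSq (w : Place k (FunctionField f)) : ValuativeCommSq f where
  R := w.ring
  K := FunctionField f
  i₁ := fromSpecFunctionField f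
  i₂ := Spec.map (CommRingCat.ofHom
    ((algebraMap k (FunctionField f)).codRestrict w.ring.toSubring w.algebraMap_mem))
  commSq := ⟨by
    refine (fromSpecStalk_comp f _).trans ?_
    rw [← Spec.map_comp]
    rfl⟩

lemma valuativeCriterion : ValuativeCriterion f := by
  have := hf.isProper
  rw [IsProper.eq_valuativeCriterion] at this
  exact this.1.1.1

/-- The existence half of the valuative criterion gives `w` a center `x`. The local ring at `x` is
contained in `w.ring`; it is not the whole field, so it is discrete and equality follows. -/
lemma placeOf_surjective (w : Place k (FunctionField f)) :
    ∃ (x : X) (hx : x ≠ generic f), placeOf f hx = w := by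
  obtain ⟨⟨l, h₁, -⟩⟩ := (CommSq.HasLift.iff _).mp ((valuativeCriterion f).existence
    (valuativeCommSq f w))
  change Spec (.of w.ring) ⟶ X at l
  let x := l (IsLocalRing.closedPoint w.ring)
  let φ : X.presheaf.stalk x ⟶ .of w.ring := Scheme.stalkClosedPointTo l
  have h₂ : Spec.map φ ≫ X.fromSpecStalk x = l := Scheme.Spec_stalkClosedPointTo_fromSpecStalk l
  have h₃ : φ ≫ CommRingCat.ofHom (algebraMap w.ring (FunctionField f)) =
      CommRingCat.ofHom (algebraMap (X.presheaf.stalk x) (FunctionField f)) := by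
    apply Spec.map_injective
    rw [← cancel_mono (X.fromSpecStalk x), Spec.map_comp, Category.assoc, h₂,
      SpecMap_algebraMap_fromSpecStalk]
    exact h₁
  have h₄ : ∀ a, (φ a : FunctionField f) = algebraMap _ _ a := fun a =>
    congrArg (fun ψ => ψ.hom a) h₃
  have hx : x ≠ generic f := by
    intro hx
    obtain ⟨z, hz⟩ := w.exists_notMem
    have hs : Function.Surjective (algebraMap (X.presheaf.stalk x) (FunctionField f)) := by
      have := IsCurve.isIntegral f
      have := (isField_stalk_iff f x).mpr hx
      exact (IsFractionRing.surjective_iff_isField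
        (R := X.presheaf.stalk x) (K := FunctionField f)).mpr this
    obtain ⟨a, rfl⟩ := hs z
    exact hz (h₄ a ▸ (φ a).2)
  have := isDiscreteValuationRing_placeOf f hx
  refine ⟨x, hx, Place.eq_of_le ?_⟩
  rintro _ ⟨a, rfl⟩
  exact h₄ a ▸ (φ a).2

/-- The uniqueness half of the criterion: two points with the same valuation ring give two lifts of
one square. -/
lemma eq_of_placeOf_eq {x y : X} {hx : x ≠ generic f} {hy : y ≠ generic f}
    (h : placeOf f hx = placeOf f hy) : x = y := by
  let S := valuativeCommSq f (placeOf f hy)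
  have key : ∀ (z : X) (hz : z ≠ generic f), placeOf f hz = placeOf f hy →
      ∃ l : S.commSq.LiftStruct, l.l (IsLocalRing.closedPoint (placeOf f hy).ring) = z := by
    intro z hz e
    have hw : ∃ φ : X.presheaf.stalk z ⟶ .of (placeOf f hy).ring, IsLocalHom φ.hom ∧
        ∀ a, (φ a : FunctionField f) = algebraMap _ _ a := by
      rw [← e]
      exact ⟨CommRingCat.ofHom (stalkEquiv f hz).toRingHom,
        ⟨fun a ha => (MulEquiv.isUnit_map (stalkEquiv f hz)).mp ha⟩, fun _ => rfl⟩
    obtain ⟨φ, hφ, hφ'⟩ := hw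
    have h₃ : φ ≫ CommRingCat.ofHom (algebraMap (placeOf f hy).ring (FunctionField f)) =
        CommRingCat.ofHom (algebraMap (X.presheaf.stalk z) (FunctionField f)) := by
      ext a
      exact hφ' a
    refine ⟨⟨Spec.map φ ≫ X.fromSpecStalk z, ?_, ?_⟩, SpecMap_fromSpecStalk_closedPoint φ⟩
    · have := SpecMap_algebraMap_fromSpecStalk f z
      rw [← h₃, Spec.map_comp, Category.assoc] at this
      exact this
    · rw [Category.assoc, fromSpecStalk_comp]
      refine (Spec.map_comp _ _).symm.trans (congrArg Spec.map ?_)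
      ext a
      exact Subtype.ext ((hφ' _).trans (algebraMap_stalk_toStalk f z a))
  obtain ⟨l, hl⟩ := key x hx h
  obtain ⟨l', hl'⟩ := key y hy rfl
  have := (valuativeCriterion f).uniqueness S
  have h : l = l' := Subsingleton.elim l l'
  subst h
  exact hl.symm.trans hl'

/-- The closed points of a curve are the places of its function field. -/
def closedPointsEquiv : closedPoints X ≃ Place k (FunctionField f) :=
  Equiv.ofBijective (fun x => placeOf f (ne_generic_of_isClosed f x.2))
    ⟨fun _ _ h => Subtype.ext (eq_of_placeOf_eq f h), fun w => by
      obtain ⟨x, hx, rfl⟩ := placeOf_surjective f w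
      exact ⟨⟨x, isClosed_of_ne_generic f hx⟩, rfl⟩⟩

end Centers

/-! ### Finiteness of the genus over an algebraically closed field. -/

section Genus

open IntermediateField

variable {k : Type u} [Field k] [IsAlgClosed k] {X : Scheme.{u}} (f : X ⟶ Spec (.of k))
  [hf : IsCurve f]

lemma adjoin_gen_eq_top {K F : Type*} [Field K] [Field F] [Algebra K F] (t : F) :
    K⟮AdjoinSimple.gen K t⟯ = ⊤ := by
  apply IntermediateField.lift_injective
  rw [lift_adjoin_simple, lift_top]
  rfl

/-- The function field is finite separable over some `k(t)`, for which `hOne` vanishes, and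
`hurwitz` transports finiteness. -/
lemma isCurveField_and_hOne_ne_top : IsCurveField k (FunctionField f) ∧
    Nonempty (Place k (FunctionField f)) ∧
    hOne (Place.lattice : Place k (FunctionField f) → _) ≠ ⊤ := by
  obtain ⟨-, -, -, -, t, ht, hfin, hsep⟩ := exists_adjoin_isSeparable f
  have hgen := adjoin_gen_eq_top (K := k) t
  have : IsCurveField k k⟮t⟯ := IsCurveField.of_adjoin_eq_top hgen
  have : Nonempty (Place k k⟮t⟯) := by
    obtain ⟨w, -⟩ := Place.exists_notMem_of_notMem_range (K := k) (x := AdjoinSimple.gen k t) (by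
      rintro ⟨a, ha⟩
      exact ht ⟨a, congrArg Subtype.val ha⟩)
    exact ⟨w⟩
  have : Nonempty (Place k (FunctionField f)) := by
    obtain ⟨w, -⟩ := Place.exists_notMem_of_notMem_range (K := k) ht
    exact ⟨w⟩
  refine ⟨IsCurveField.of_finite_separable k k⟮t⟯ _, this, ?_⟩
  exact (hurwitz k k⟮t⟯ (FunctionField f)
    (by rw [hOne_eq_zero_of_adjoin_eq_top hgen]; exact ENat.zero_ne_top)).1

instance : IsCurveField k (FunctionField f) := (isCurveField_and_hOne_ne_top f).1

instance : Nonempty (Place k (FunctionField f)) := (isCurveField_and_hOne_ne_top f).2.1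

lemma hOne_ne_top : hOne (Place.lattice : Place k (FunctionField f) → _) ≠ ⊤ :=
  (isCurveField_and_hOne_ne_top f).2.2

lemma genusOver_eq [IrreducibleSpace X] :
    genusOver f = (hOne (Place.lattice : Place k (FunctionField f) → _)).toNat := by
  let L : closedPoints X → Submodule k (FunctionField f) := fun x => localSubspace f x
  have h : hOne L = hOne (Place.lattice : Place k (FunctionField f) → _) := by
    refine hOne_eq_of_map (LinearEquiv.refl k _) (closedPointsEquiv f).symm (fun x => ?_)
      (fun z x => ?_) fun x r _ => ⟨r (closedPointsEquiv f x), ?_⟩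
    · exact (Set.finite_singleton x).preimage (closedPointsEquiv f).symm.injective.injOn
    · constructor
      · rintro h w rfl
        obtain ⟨x, rfl⟩ := (closedPointsEquiv f).surjective w
        rw [Equiv.symm_apply_apply] at h
        exact h
      · intro h
        exact h (closedPointsEquiv f x) ((closedPointsEquiv f).symm_apply_apply x)
    · rintro w rfl
      rw [Equiv.apply_symm_apply, LinearEquiv.refl_apply, sub_self]
      exact zero_mem _
  let := functionFieldAlgebra f
  have h' : hOne L = Module.length k (H1 f) := rfl
  have hfin : Module.Finite k (H1 f) := by
    have hne : Module.length k (H1 f) ≠ ⊤ := h' ▸ h ▸ hOne_ne_top f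
    have := (isFiniteLength_iff_isNoetherian_isArtinian.mp (Module.length_ne_top_iff.mp hne)).1
    infer_instance
  rw [← h, h', Module.length_eq_finrank, ENat.toNat_natCast]
  rfl

end Genus

lemma isSeparable_iff_of_isField {A E F : Type*} [CommRing A] (hA : IsField A) [Field E] [Field F]
    [Algebra A F] [Algebra E F] (e : A ≃+* E) (he : ∀ a, algebraMap E F (e a) = algebraMap A F a) :
    Algebra.IsSeparable A F ↔ Algebra.IsSeparable E F := by
  let := hA.toField
  exact Algebra.IsSeparable.iff_of_equiv_equiv e (RingEquiv.refl F) (RingHom.ext he)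

/-! ### Morphisms of curves and extensions of function fields. -/

section FieldMap

variable {k k' : Type u} [Field k] [Field k'] {X Y : Scheme.{u}} (f : X ⟶ Spec (.of k))
  (g : Y ⟶ Spec (.of k')) [IsCurve f] [IsCurve g] (π : X ⟶ Y)

/-- A non-generic image of the generic point would be closed, and all of `X` would map to it. -/
lemma map_generic (h : IsNonconstant π) : π (generic f) = generic g := by
  by_contra hne
  refine h ⟨π (generic f), fun x => ?_⟩
  have h₁ : π (generic f) ⤳ π x := (generic_specializes f x).map π.continuous
  have h₂ := (isClosed_of_ne_generic g hne).closure_eq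
  rw [specializes_iff_mem_closure, h₂] at h₁
  exact h₁

variable {f g π} (h : π (generic f) = generic g)

/-- The map of function fields given by a dominant morphism of curves. -/
def fieldMap : FunctionField g →+* FunctionField f :=
  (π.stalkMap (generic f)).hom.comp (Y.presheaf.stalkSpecializes (specializes_of_eq h)).hom

lemma algebraMap_stalkMap (x : X) (a : Y.presheaf.stalk (π x)) :
    algebraMap _ (FunctionField f) (π.stalkMap x a) = fieldMap h (algebraMap _ _ a) := by
  refine (Scheme.Hom.stalkSpecializes_stalkMap_apply π _ _ (generic_specializes f x) a).symm.trans
    (congrArg (π.stalkMap (generic f)) ?_)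
  exact (ConcreteCategory.congr_hom (TopCat.Presheaf.stalkSpecializes_comp Y.presheaf
    (specializes_of_eq h) (generic_specializes g (π x))) a).symm

lemma stalkMap_toStalk {g : Y ⟶ Spec (.of k)} (hπ : π ≫ g = f) (x : X) (a : k) :
    π.stalkMap x (toStalk g (π x) a) = toStalk f x a := by
  subst hπ
  simp only [toStalk, RingHom.comp_apply]
  refine (Scheme.Hom.germ_stalkMap_apply π ⊤ x trivial _).trans ?_
  rw [Scheme.Hom.comp_appTop]
  rfl

lemma fieldMap_algebraMap {g : Y ⟶ Spec (.of k)} [IsCurve g] (h : π (generic f) = generic g)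
    (hπ : π ≫ g = f) (a : k) : fieldMap h (algebraMap k _ a) = algebraMap k _ a := by
  rw [← algebraMap_stalk_toStalk g (π (generic f)), ← algebraMap_stalkMap, stalkMap_toStalk hπ,
    algebraMap_stalk_toStalk]

/-- The stalk at the image of the generic point is the function field. -/
def imageStalkEquiv : Y.presheaf.stalk (π (generic f)) ≃+* FunctionField g :=
  (Y.presheaf.stalkCongr (.of_eq h)).commRingCatIsoToRingEquiv

lemma fieldMap_imageStalkEquiv (a : Y.presheaf.stalk (π (generic f))) :
    fieldMap h (imageStalkEquiv h a) = π.stalkMap (generic f) a := by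
  refine congrArg (π.stalkMap (generic f)) ?_
  exact (imageStalkEquiv h).symm_apply_apply a

lemma degree_eq [IrreducibleSpace X] :
    letI := (fieldMap h).toAlgebra
    degree π = Module.finrank (FunctionField g) (FunctionField f) := by
  let := (fieldMap h).toAlgebra
  let := functionFieldExt π
  refine Algebra.finrank_eq_of_equiv_equiv (imageStalkEquiv h) (RingEquiv.refl (FunctionField f)) ?_
  ext a
  exact fieldMap_imageStalkEquiv h a

lemma isSeparableMap_iff [IrreducibleSpace X] :
    letI := (fieldMap h).toAlgebra
    IsSeparableMap π ↔ Algebra.IsSeparable (FunctionField g) (FunctionField f) := by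
  let := (fieldMap h).toAlgebra
  have hf : IsField (Y.presheaf.stalk (π (generic f))) :=
    (imageStalkEquiv h).toMulEquiv.isField (Field.toIsField _)
  let : Algebra (Y.presheaf.stalk (π (generic f))) (FunctionField f) := functionFieldExt π
  exact isSeparable_iff_of_isField hf (imageStalkEquiv h) (fieldMap_imageStalkEquiv h)

end FieldMap

section Finite

open IntermediateField

variable {k : Type u} [Field k] {X : Scheme.{u}} (f : X ⟶ Spec (.of k)) [IsCurve f]

lemma essFiniteType_functionField : Algebra.EssFiniteType k (FunctionField f) := by
  obtain ⟨-, -, -, -, t, -, hfin, -⟩ := exists_adjoin_isSeparable f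
  have : Algebra.EssFiniteType k k⟮t⟯ := by
    rw [IntermediateField.essFiniteType_iff]
    exact ⟨{t}, by simp⟩
  exact Algebra.EssFiniteType.comp k k⟮t⟯ _

/-- Finiteness is not part of the definition of a separable map, and `finrank` would be `0` without
it. A separable extension is formally unramified, and together with essential finite type this
forces finiteness. -/
lemma finiteDimensional_of_isSeparable {E : Type*} [Field E] [Algebra k E]
    [Algebra E (FunctionField f)] [IsScalarTower k E (FunctionField f)]
    [Algebra.IsSeparable E (FunctionField f)] : FiniteDimensional E (FunctionField f) := by
  have := essFiniteType_functionField f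
  have := Algebra.EssFiniteType.of_comp k E (FunctionField f)
  have := Algebra.FormallyUnramified.of_isSeparable E (FunctionField f)
  exact Algebra.FormallyUnramified.finite_of_free _ _

end Finite

section Ramification

variable {k : Type u} [Field k] {X Y : Scheme.{u}} {f : X ⟶ Spec (.of k)}
  {g : Y ⟶ Spec (.of k)} [IsCurve f] [IsCurve g] {π : X ⟶ Y} (h : π (generic f) = generic g)
  (hπ : π ≫ g = f)

include hπ in
lemma isScalarTower_fieldMap :
    letI := (fieldMap h).toAlgebra
    IsScalarTower k (FunctionField g) (FunctionField f) :=
  let := (fieldMap h).toAlgebra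
  .of_algebraMap_eq fun a => (fieldMap_algebraMap h hπ a).symm

lemma isLocalHom_fieldMap_iff (x : X) (a : Y.presheaf.stalk (π x)) :
    IsUnit (π.stalkMap x a) ↔ IsUnit a :=
  isUnit_map_iff (π.stalkMap x).hom a

lemma map_ne_generic [letI := (fieldMap h).toAlgebra
    Algebra.IsAlgebraic (FunctionField g) (FunctionField f)] {x : X} (hx : x ≠ generic f) :
    π x ≠ generic g := by
  let := (fieldMap h).toAlgebra
  intro hy
  have hE : ∀ z : FunctionField g, fieldMap h z ∈ (placeOf f hx).ring := by
    intro z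
    have hs : Function.Surjective (algebraMap (Y.presheaf.stalk (π x)) (FunctionField g)) := by
      have := IsCurve.isIntegral g
      have := (isField_stalk_iff g (π x)).mpr hy
      exact (IsFractionRing.surjective_iff_isField
        (R := Y.presheaf.stalk (π x)) (K := FunctionField g)).mpr this
    obtain ⟨a, rfl⟩ := hs z
    exact ⟨_, algebraMap_stalkMap h x a⟩
  obtain ⟨x', hx'⟩ := (placeOf f hx).exists_notMem
  refine hx' ((placeOf f hx).ring.mem_of_isIntegral ?_)
  exact (Algebra.IsIntegral.isIntegral (R := FunctionField g) x').map_of_comp_eq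
    ((fieldMap h).codRestrict (placeOf f hx).ring.toSubring hE) (RingHom.id _) rfl

lemma comap_placeOf [letI := (fieldMap h).toAlgebra
    Algebra.IsAlgebraic (FunctionField g) (FunctionField f)] {x : X} (hx : x ≠ generic f)
    (hy : π x ≠ generic g) :
    letI := (fieldMap h).toAlgebra
    haveI := isScalarTower_fieldMap h hπ
    (placeOf f hx).comap (FunctionField g) = placeOf g hy := by
  let := (fieldMap h).toAlgebra
  have := isScalarTower_fieldMap h hπ
  have := isDiscreteValuationRing_placeOf g hy
  refine (Place.eq_of_le ?_).symm
  rintro _ ⟨a, rfl⟩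
  exact ⟨_, algebraMap_stalkMap h x a⟩

include hπ in
lemma ramIdx_eq [letI := (fieldMap h).toAlgebra
    Algebra.IsAlgebraic (FunctionField g) (FunctionField f)] {x : X} (hx : x ≠ generic f) :
    letI := (fieldMap h).toAlgebra
    ramIdx π x = (placeOf f hx).ram (FunctionField g) := by
  let := (fieldMap h).toAlgebra
  have := isScalarTower_fieldMap h hπ
  have hmem : ∀ z, algebraMap (FunctionField g) (FunctionField f) z ∈ (placeOf f hx).ring →
      z ∈ (placeOf g (map_ne_generic h hx)).ring := by
    intro z hz
    rw [← comap_placeOf h hπ hx]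
    exact hz
  have hpow : ∀ (n : ℕ) (a : X.presheaf.stalk x),
      stalkEquiv f hx a ∈ IsLocalRing.maximalIdeal (placeOf f hx).ring ^ n ↔
        a ∈ IsLocalRing.maximalIdeal (X.presheaf.stalk x) ^ n := by
    intro n a
    rw [← IsLocalRing.map_ringEquiv_maximalIdeal (stalkEquiv f hx), ← Ideal.map_pow]
    exact Ideal.apply_mem_of_equiv_iff
  unfold ramIdx Place.ram Ideal.ramificationIdx'
  congr 1
  ext n
  rw [Set.mem_ofPred_eq, Set.mem_ofPred_eq, Ideal.map_le_iff_le_comap]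
  have key : ∀ (a : Y.presheaf.stalk (π x))
      (hx' : algebraMap (FunctionField g) (FunctionField f) (algebraMap _ _ a) ∈
      (placeOf f hx).ring), (⟨_, hx'⟩ : (placeOf f hx).ring) = stalkEquiv f hx (π.stalkMap x a) :=
    fun a _ => Subtype.ext (algebraMap_stalkMap h x a).symm
  constructor
  · intro H z hz hu
    obtain ⟨a, rfl⟩ := hmem z hz
    rw [key a hz, MulEquiv.isUnit_map, isLocalHom_fieldMap_iff] at hu
    rw [key a hz, hpow]
    exact H hu
  · intro H a ha
    have hz : algebraMap (FunctionField g) (FunctionField f) (algebraMap _ _ a) ∈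
        (placeOf f hx).ring := ⟨_, algebraMap_stalkMap h x a⟩
    have := H _ hz
    rw [key a hz, MulEquiv.isUnit_map, isLocalHom_fieldMap_iff, hpow] at this
    exact this ha

end Ramification

section AlgClosed

variable {k : Type u} [Field k] [IsAlgClosed k] {X Y : Scheme.{u}} {f : X ⟶ Spec (.of k)}
  {g : Y ⟶ Spec (.of k)} [IsCurve f] [IsCurve g] [IrreducibleSpace X]
  {π : X ⟶ Y} (hπ : π ≫ g = f) (hc : IsNonconstant π) (hs : IsSeparableMap π)

include hπ hc hs

theorem exists_fibre_sum_ramIdx (y : closedPoints Y) : ∃ Z : Finset (closedPoints X),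
    (∀ x, x ∈ Z ↔ π x = y) ∧ ∑ x ∈ Z, ramIdx π x = degree π := by
  have h := map_generic f g π hc
  let := (fieldMap h).toAlgebra
  have := isScalarTower_fieldMap h hπ
  have := (isSeparableMap_iff h).mp hs
  have := finiteDimensional_of_isSeparable f (E := FunctionField g)
  let v := closedPointsEquiv g y
  refine ⟨(v.fibre (FunctionField f)).map (closedPointsEquiv f).symm.toEmbedding, fun x => ?_, ?_⟩
  · rw [Finset.mem_map_equiv, Equiv.symm_symm, Place.mem_fibre]
    have hx := ne_generic_of_isClosed f x.2
    change (placeOf f hx).comap _ = v ↔ _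
    rw [comap_placeOf h hπ hx (map_ne_generic h hx)]
    exact ⟨fun e => eq_of_placeOf_eq g (hy := ne_generic_of_isClosed g y.2) e,
      fun e => by simp only [v, e]; rfl⟩
  · rw [Finset.sum_map, degree_eq h, ← Place.sum_ram (v := v) (IsCurveField.residue v)]
    refine Finset.sum_congr rfl fun w _ => ?_
    obtain ⟨x, rfl⟩ := (closedPointsEquiv f).surjective w
    rw [Equiv.coe_toEmbedding, Equiv.symm_apply_apply]
    exact ramIdx_eq h hπ (ne_generic_of_isClosed f x.2)

theorem sum_ramIdx_sub_one_le [IrreducibleSpace Y] (Z : Finset (closedPoints X)) :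
    ∑ x ∈ Z, ((ramIdx π x : ℤ) - 1) ≤
      2 * (genusOver f : ℤ) - 2 - degree π * (2 * (genusOver g : ℤ) - 2) := by
  have h := map_generic f g π hc
  let := (fieldMap h).toAlgebra
  have := isScalarTower_fieldMap h hπ
  have := (isSeparableMap_iff h).mp hs
  have := finiteDimensional_of_isSeparable f (E := FunctionField g)
  rw [genusOver_eq, genusOver_eq, degree_eq h]
  refine le_of_eq_of_le ?_ ((hurwitz k (FunctionField g) (FunctionField f) (hOne_ne_top g)).2
    (Z.map (closedPointsEquiv f).toEmbedding))
  rw [Finset.sum_map]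
  refine Finset.sum_congr rfl fun x _ => ?_
  rw [ramIdx_eq h hπ (ne_generic_of_isClosed f x.2)]
  rfl

theorem ramIdx_pos (x : closedPoints X) : 0 < ramIdx π x := by
  have h := map_generic f g π hc
  let := (fieldMap h).toAlgebra
  have := isScalarTower_fieldMap h hπ
  have := (isSeparableMap_iff h).mp hs
  have := finiteDimensional_of_isSeparable f (E := FunctionField g)
  rw [ramIdx_eq h hπ (ne_generic_of_isClosed f x.2)]
  exact Place.ram_pos (v := (closedPointsEquiv f x).comap (FunctionField g)) rfl

end AlgClosed

/-! ### Invariance of degree and separability under extension of constants. -/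

section FieldBaseChange

/-- `F'` is the field of fractions of `K ⊗ F`, for field extensions `K` and `F` of `k`. -/
structure IsFieldBaseChange (k K F F' : Type*) [Field k] [Field K] [Field F] [Field F']
    [Algebra k K] [Algebra K F'] [Algebra F F'] : Prop where
  linearIndependent :
    LinearIndependent F fun i => algebraMap K F' (Module.Basis.ofVectorSpace k K i)
  exists_subring : ∃ R : Subring F', IsFractionRing R F' ∧ ∀ z ∈ R,
    z ∈ Submodule.span F (Set.range fun i => algebraMap K F' (Module.Basis.ofVectorSpace k K i))

namespace IsFieldBaseChange

variable {k K E F E' F' : Type*} [Field k] [Field K] [Field E] [Field F] [Field E'] [Field F']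
  [Algebra k K] [Algebra K E'] [Algebra K F'] [Algebra E E'] [Algebra F F'] [Algebra E F]
  [Algebra E' F'] [Algebra E F'] [IsScalarTower K E' F'] [IsScalarTower E E' F']
  [IsScalarTower E F F'] (hE : IsFieldBaseChange k K E E') (hF : IsFieldBaseChange k K F F')

include hF in
omit [Algebra E E'] [Algebra E F] [Algebra E F'] [IsScalarTower E E' F'] [IsScalarTower E F F'] in
lemma eq_top (L : IntermediateField E' F') (hL : ∀ x : F, algebraMap F F' x ∈ L) : L = ⊤ := by
  obtain ⟨R, hR, hspan⟩ := hF.exists_subring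
  have hRL : ∀ z ∈ R, z ∈ L := fun z hz => by
    refine Submodule.span_induction ?_ L.zero_mem (fun _ _ _ _ => L.add_mem) ?_ (hspan z hz)
    · rintro _ ⟨i, rfl⟩
      beta_reduce
      rw [IsScalarTower.algebraMap_apply K E' F']
      exact L.algebraMap_mem _
    · intro a x _ hx
      rw [Algebra.smul_def]
      exact L.mul_mem (hL a) hx
  refine top_le_iff.mp fun z _ => ?_
  obtain ⟨a, b, -, rfl⟩ := IsFractionRing.div_surjective (A := R) z
  exact L.div_mem (hRL _ a.2) (hRL _ b.2)

include hF in
theorem isSeparable [Algebra.IsSeparable E F] : Algebra.IsSeparable E' F' := by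
  rw [← separableClosure.eq_top_iff]
  refine hF.eq_top _ fun x => ?_
  rw [mem_separableClosure_iff]
  exact ((Algebra.IsSeparable.isSeparable E x).map (IsScalarTower.toAlgHom E F F')
    (algebraMap F F').injective).tower_top E'

include hF in
-- `F'` is generated by `F` as a field over `E'`, hence as a ring because it is algebraic, hence as
-- a vector space because `F` is closed under multiplication.
lemma span_range_eq_top [Algebra.IsSeparable E F] {ι : Type*} (b : Module.Basis ι E F) :
    Submodule.span E' (Set.range fun i => algebraMap F F' (b i)) = ⊤ := by
  have := hF.isSeparable (E := E) (E' := E')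
  let M : Submodule E' F' := Submodule.span E' (Set.range fun i => algebraMap F F' (b i))
  have hM : ∀ x : F, algebraMap F F' x ∈ M := by
    intro x
    refine Submodule.span_induction (p := fun x _ => algebraMap F F' x ∈ M) ?_ ?_ ?_ ?_
      (b.span_eq.ge (Submodule.mem_top (x := x)))
    · rintro _ ⟨i, rfl⟩
      exact Submodule.subset_span ⟨i, rfl⟩
    · rw [map_zero]
      exact M.zero_mem
    · intro x y _ _ hx hy
      rw [map_add]
      exact M.add_mem hx hy
    · intro a x _ hx
      rw [Algebra.smul_def, map_mul, ← IsScalarTower.algebraMap_apply E F F',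
        IsScalarTower.algebraMap_apply E E' F', ← Algebra.smul_def]
      exact M.smul_mem _ hx
  have h : IntermediateField.adjoin E' (Set.range (algebraMap F F')) = ⊤ :=
    hF.eq_top _ fun x => IntermediateField.subset_adjoin _ _ ⟨x, rfl⟩
  have h' := IntermediateField.adjoin_toSubalgebra_of_isAlgebraic (F := E')
    (S := Set.range (algebraMap F F')) fun x _ => Algebra.IsAlgebraic.isAlgebraic x
  rw [h] at h'
  rw [eq_top_iff]
  intro z _
  have hz : z ∈ Algebra.adjoin E' (Set.range (algebraMap F F')) :=
    h' ▸ IntermediateField.mem_top (F := E') (x := z)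
  rw [← Subalgebra.mem_toSubmodule, Algebra.adjoin_eq_span] at hz
  refine Submodule.span_le.mpr ?_ hz
  have hcl : Submonoid.closure (Set.range (algebraMap F F')) = MonoidHom.mrange (algebraMap F F') :=
    Submonoid.closure_eq (MonoidHom.mrange (algebraMap F F'))
  rw [hcl]
  rintro _ ⟨x, rfl⟩
  exact hM x

include hE hF in
-- After clearing denominators the coefficients lie in `R`, so they expand over `E` in the images of
-- a basis of `K/k`. These images are independent over `F`, and comparing coordinates leaves
-- relations over `E`.
lemma linearIndependent_map {ι : Type*} {b : ι → F} (hb : LinearIndependent E b) :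
    LinearIndependent E' fun i => algebraMap F F' (b i) := by
  obtain ⟨R, hR, hspan⟩ := hE.exists_subring
  rw [← LinearIndependent.iff_fractionRing R E', linearIndependent_iff']
  intro s a ha i hi
  have h : ∀ i, ∃ v : _ →₀ E, v.sum (fun j c => c • algebraMap K E'
      (Module.Basis.ofVectorSpace k K j)) = a i :=
    fun i => Finsupp.mem_span_range_iff_exists_finsupp.mp (hspan _ (a i).2)
  choose v hv using h
  let w : ι → (_ →₀ F) := fun i => b i • (v i).mapRange (algebraMap E F) (map_zero _)
  have hw : ∀ i, Finsupp.linearCombination F (fun j => algebraMap K F'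
      (Module.Basis.ofVectorSpace k K j)) (w i) = a i • algebraMap F F' (b i) := by
    intro i
    rw [map_smul, Finsupp.linearCombination_apply, Finsupp.sum_mapRange_index (by simp),
      Subring.smul_def, ← hv, Algebra.smul_def, Algebra.smul_def, mul_comm]
    congr 1
    rw [Finsupp.sum, Finsupp.sum, map_sum]
    refine Finset.sum_congr rfl fun j _ => ?_
    rw [Algebra.smul_def, Algebra.smul_def, map_mul,
      ← IsScalarTower.algebraMap_apply, ← IsScalarTower.algebraMap_apply,
      ← IsScalarTower.algebraMap_apply]
  have hsum : ∑ i ∈ s, w i = 0 := by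
    refine hF.linearIndependent.finsuppLinearCombination_injective ?_
    rw [map_zero, map_sum, ← ha]
    exact Finset.sum_congr rfl fun i _ => hw i
  have hvi : v i = 0 := by
    ext j
    refine linearIndependent_iff'.mp hb s (fun i => v i j) ?_ i hi
    rw [← Finsupp.zero_apply (M := F) (a := j), ← hsum, Finsupp.finsetSum_apply]
    refine Finset.sum_congr rfl fun i _ => ?_
    simp only [w, Finsupp.smul_apply, Finsupp.mapRange_apply, smul_eq_mul]
    rw [Algebra.smul_def, mul_comm]
  refine Subtype.ext ?_
  rw [← hv, hvi, Finsupp.sum_zero_index]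
  rfl

include hE hF in
theorem finrank_eq [Algebra.IsSeparable E F] : Module.finrank E' F' = Module.finrank E F := by
  let b := Module.Basis.ofVectorSpace E F
  let b' := Module.Basis.mk (hE.linearIndependent_map hF b.linearIndependent)
    (hF.span_range_eq_top b).ge
  rw [Module.finrank_eq_nat_card_basis b, Module.finrank_eq_nat_card_basis b']

end IsFieldBaseChange

end FieldBaseChange

section Germ

variable {k : Type u} [Field k] {X : Scheme.{u}} (f : X ⟶ Spec (.of k)) [IsCurve f]

/-- The sections over a nonempty open subset as rational functions. -/
def germField {U : X.Opens} (hU : generic f ∈ U) : Γ(X, U) →+* FunctionField f :=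
  (X.presheaf.germ U (generic f) hU).hom

lemma germField_toSection {U : X.Opens} (hU : generic f ∈ U) (a : k) :
    germField f hU (toSection f U a) = algebraMap k (FunctionField f) a :=
  germ_toSection f U _ hU a

lemma germField_injective {U : X.Opens} (hU : generic f ∈ U) :
    Function.Injective (germField f hU) :=
  have := IsCurve.isIntegral f
  germ_injective_of_isIntegral X _ hU

lemma isFractionRing_germField {U : X.Opens} (hU : generic f ∈ U) (h : IsAffineOpen U) :
    letI := (germField f hU).toAlgebra
    IsFractionRing Γ(X, U) (FunctionField f) :=
  have := IsCurve.isIntegral f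
  have : Nonempty U := ⟨⟨_, hU⟩⟩
  functionField_isFractionRing_of_isAffineOpen X U h

lemma fieldMap_germField {k' : Type u} [Field k'] {Y : Scheme.{u}} {g : Y ⟶ Spec (.of k')}
    [IsCurve g] {π : X ⟶ Y} (h : π (generic f) = generic g) {V : Y.Opens} {U : X.Opens}
    (e : U ≤ π ⁻¹ᵁ V) (hU : generic f ∈ U) (hV : generic g ∈ V) (a : Γ(Y, V)) :
    fieldMap h (germField g hV a) = germField f hU (π.appLE V U e a) := by
  have h₁ : Y.presheaf.stalkSpecializes (specializes_of_eq h) (Y.presheaf.germ V _ hV a) =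
      Y.presheaf.germ V _ (e hU) a :=
    ConcreteCategory.congr_hom (TopCat.Presheaf.germ_stalkSpecializes Y.presheaf hV
      (specializes_of_eq h)) a
  refine (congrArg (π.stalkMap (generic f)) h₁).trans ?_
  refine (Scheme.Hom.germ_stalkMap_apply π V _ (e hU) a).trans ?_
  exact (TopCat.Presheaf.germ_res_apply X.presheaf (homOfLE e) _ hU _).symm

end Germ

/-! ### Base change of curves and of their function fields. -/

section BaseChange

variable {k : Type u} [Field k] (K : Type u) [Field K] [Algebra k K] {X : Scheme.{u}}
  (f : X ⟶ Spec (.of k)) [hf : IsCurve f]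

instance : IsCurve (baseChangeHom K f) := by
  have := hf.isProper
  have := hf.geometricallyIrreducible
  exact ⟨inferInstance,
    (smoothOfRelativeDimension_isStableUnderBaseChange (n := 1)).of_isPullback
      (.of_hasPullback f (specMap k K)) hf.smooth, inferInstance⟩

lemma fst_generic :
    pullback.fst f (specMap k K) (generic (baseChangeHom K f)) = generic f := by
  have : Surjective (specMap k K) := ⟨fun y => ⟨IsLocalRing.closedPoint K, Subsingleton.elim _ _⟩⟩
  obtain ⟨x, hx⟩ := (pullback.fst f (specMap k K)).surjective (generic f)
  have h := (generic_specializes (baseChangeHom K f) x).map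
    (pullback.fst f (specMap k K)).continuous
  rw [hx] at h
  exact (h.antisymm (generic_specializes f _)).eq

instance : Algebra (FunctionField f) (FunctionField (baseChangeHom K f)) :=
  (fieldMap (fst_generic K f)).toAlgebra

omit hf in
lemma isPushout_section {U : X.Opens} (hU : IsAffineOpen U) :
    IsPushout (CommRingCat.ofHom (toSection f U)) (CommRingCat.ofHom (algebraMap k K))
      ((pullback.fst f (specMap k K)).appLE U (pullback.fst f (specMap k K) ⁻¹ᵁ U) le_rfl)
      (CommRingCat.ofHom (toSection (baseChangeHom K f) (pullback.fst f (specMap k K) ⁻¹ᵁ U))) := by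
  have H := IsPullback.of_hasPullback f (specMap k K)
  have hUY : pullback.fst f (specMap k K) ⁻¹ᵁ U =
    pullback.fst f (specMap k K) ⁻¹ᵁ U ⊓ pullback.snd f (specMap k K) ⁻¹ᵁ ⊤ := by
      rw [Scheme.Hom.preimage_top, inf_top_eq]
  have h := (isIso_pushoutSection_iff H (US := ⊤) (UT := ⊤) (UX := U) le_top le_top hUY).mp
    (isIso_pushoutSection_of_isAffineOpen H le_top le_top hUY (isAffineOpen_top _)
      (isAffineOpen_top _) hU)
  refine h.of_iso (Scheme.ΓSpecIso (.of k)) (Iso.refl _) (Scheme.ΓSpecIso (.of K)) (Iso.refl _)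
    ?_ ?_ ?_ ?_
  · rw [Iso.refl_hom, Category.comp_id, ← Iso.inv_comp_eq]
    rfl
  · rw [← Scheme.ΓSpecIso_naturality]
    congr 1
  · rw [Iso.refl_hom, Iso.refl_hom, Category.comp_id, Category.id_comp]
  · rw [Iso.refl_hom, Category.comp_id, ← Iso.inv_comp_eq]
    rfl

/-- On an affine open `U` the sections of `X_K` are `K ⊗ Γ(X, U)`, free over `Γ(X, U)` on a basis of
`K/k`. They embed in the function field of the integral scheme `X_K` with it as fraction field, and
so provide `R`. -/
theorem isFieldBaseChange :
    IsFieldBaseChange k K (FunctionField f) (FunctionField (baseChangeHom K f)) := by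
  obtain ⟨U, hU, hη, -⟩ := exists_isStandardSmooth f (generic f)
  have : IsAffineHom (pullback.fst f (specMap k K)) :=
    isAffineHom_isStableUnderBaseChange.of_isPullback
      (IsPullback.of_hasPullback f (specMap k K)).flip inferInstance
  let U' := pullback.fst f (specMap k K) ⁻¹ᵁ U
  have hU' : IsAffineOpen U' := hU.preimage _
  have hη' : generic (baseChangeHom K f) ∈ U' := by
    change pullback.fst f (specMap k K) (generic (baseChangeHom K f)) ∈ U
    rwa [fst_generic]
  let φ : Γ(X, U) →+* Γ(baseChange K f, U') :=
    ((pullback.fst f (specMap k K)).appLE U U' le_rfl).hom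
  have hpush := isPushout_section K f hU
  let := (toSection f U).toAlgebra
  let := φ.toAlgebra
  let := (toSection (baseChangeHom K f) U').toAlgebra
  let : Algebra k Γ(baseChange K f, U') := (φ.comp (toSection f U)).toAlgebra
  have : IsScalarTower k Γ(X, U) Γ(baseChange K f, U') := .of_algebraMap_eq fun _ => rfl
  have : IsScalarTower k K Γ(baseChange K f, U') :=
    .of_algebraMap_eq fun a => ConcreteCategory.congr_hom hpush.w a
  have hp : Algebra.IsPushout k Γ(X, U) K Γ(baseChange K f, U') :=
    CommRingCat.isPushout_iff_isPushout.mp hpush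
  let b := hp.out.basis (Module.Basis.ofVectorSpace k K)
  have hb : ∀ i, b i = toSection (baseChangeHom K f) U' (Module.Basis.ofVectorSpace k K i) :=
    fun i => hp.out.basis_apply _ i
  let := (germField f hη).toAlgebra
  have := isFractionRing_germField f hη hU
  let := (germField (baseChangeHom K f) hη').toAlgebra
  have := isFractionRing_germField (baseChangeHom K f) hη' hU'
  let : Algebra Γ(X, U) (FunctionField (baseChangeHom K f)) :=
    ((algebraMap (FunctionField f) (FunctionField (baseChangeHom K f))).comp
      (germField f hη)).toAlgebra
  have : IsScalarTower Γ(X, U) (FunctionField f) (FunctionField (baseChangeHom K f)) :=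
    .of_algebraMap_eq fun _ => rfl
  have : IsScalarTower Γ(X, U) Γ(baseChange K f, U') (FunctionField (baseChangeHom K f)) :=
    .of_algebraMap_eq fun a => fieldMap_germField (baseChangeHom K f) (fst_generic K f) le_rfl
      hη' hη a
  have hgb : ∀ i, germField (baseChangeHom K f) hη' (b i) =
      algebraMap K _ (Module.Basis.ofVectorSpace k K i) := fun i => by
    rw [hb, germField_toSection]
  refine ⟨?_, (germField (baseChangeHom K f) hη').range, ?_, ?_⟩
  · rw [← LinearIndependent.iff_fractionRing Γ(X, U)]
    simp_rw [← hgb]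
    exact b.linearIndependent.map' (IsScalarTower.toAlgHom Γ(X, U) Γ(baseChange K f, U')
      (FunctionField (baseChangeHom K f))).toLinearMap
      (LinearMap.ker_eq_bot.mpr (germField_injective _ hη'))
  · refine IsFractionRing.of_field _ _ fun z => ?_
    obtain ⟨a, b, -, rfl⟩ := IsFractionRing.div_surjective (A := Γ(baseChange K f, U')) z
    exact ⟨⟨_, a, rfl⟩, ⟨_, b, rfl⟩, rfl⟩
  · rintro _ ⟨a, rfl⟩
    refine Submodule.span_induction (p := fun a _ => germField (baseChangeHom K f) hη' a ∈ _)
      ?_ ?_ ?_ ?_ (b.mem_span a)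
    · rintro _ ⟨i, rfl⟩
      rw [hgb]
      exact Submodule.subset_span ⟨i, rfl⟩
    · rw [map_zero]
      exact zero_mem _
    · intro x y _ _ hx hy
      rw [map_add]
      exact add_mem hx hy
    · intro c x _ hx
      have : germField (baseChangeHom K f) hη' (c • x) =
          germField f hη c • germField (baseChangeHom K f) hη' x := by
        rw [Algebra.smul_def, Algebra.smul_def, map_mul]
        congr 1
        exact (fieldMap_germField (baseChangeHom K f) (fst_generic K f) le_rfl hη' hη c).symm
      rw [this]
      exact Submodule.smul_mem _ _ hx

end BaseChange

lemma fieldMap_comp {k₁ k₂ k₃ : Type u} [Field k₁] [Field k₂] [Field k₃] {X Y Z : Scheme.{u}}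
    {f : X ⟶ Spec (.of k₁)} {g : Y ⟶ Spec (.of k₂)} {h : Z ⟶ Spec (.of k₃)} [IsCurve f]
    [IsCurve g] [IsCurve h] {π : X ⟶ Y} {ρ : Y ⟶ Z} {σ : X ⟶ Z} (hπ : π (generic f) = generic g)
    (hρ : ρ (generic g) = generic h) (hσ : σ (generic f) = generic h) (e : π ≫ ρ = σ)
    (a : FunctionField h) : fieldMap hπ (fieldMap hρ a) = fieldMap hσ a := by
  obtain ⟨U, hU, s, rfl⟩ := Z.presheaf.exists_germ_eq a
  have hV : generic g ∈ ρ ⁻¹ᵁ U := by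
    change ρ (generic g) ∈ U
    rwa [hρ]
  have hW : generic f ∈ π ⁻¹ᵁ ρ ⁻¹ᵁ U := by
    change π (generic f) ∈ ρ ⁻¹ᵁ U
    rwa [hπ]
  have e' : π ⁻¹ᵁ ρ ⁻¹ᵁ U ≤ σ ⁻¹ᵁ U := by
    rw [← e]
    exact le_rfl
  refine (congrArg (fieldMap hπ) (fieldMap_germField g hρ le_rfl hV hU s)).trans ?_
  refine (fieldMap_germField f hπ le_rfl hW hV _).trans ?_
  refine Eq.trans ?_ (fieldMap_germField f hσ e' hW hU s).symm
  refine congrArg (germField f hW) ?_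
  subst e
  exact ConcreteCategory.congr_hom
    (Scheme.Hom.appLE_comp_appLE π ρ U (ρ ⁻¹ᵁ U) (π ⁻¹ᵁ ρ ⁻¹ᵁ U) le_rfl le_rfl) s

section BaseChange

variable {k : Type u} [Field k] (K : Type u) [Field K] [Algebra k K] {X Y : Scheme.{u}}
  {f : X ⟶ Spec (.of k)} {g : Y ⟶ Spec (.of k)} {π : X ⟶ Y} (hπ : π ≫ g = f)

lemma baseChangeMap_fst : baseChangeMap K f g π hπ ≫ pullback.fst g (specMap k K) =
    pullback.fst f (specMap k K) ≫ π := pullback.lift_fst _ _ _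

lemma baseChangeMap_baseChangeHom :
    baseChangeMap K f g π hπ ≫ baseChangeHom K g = baseChangeHom K f := pullback.lift_snd _ _ _

instance : Surjective (pullback.fst f (specMap k K)) :=
  have : Surjective (specMap k K) := ⟨fun _ => ⟨IsLocalRing.closedPoint K, Subsingleton.elim _ _⟩⟩
  inferInstance

variable (hc : IsNonconstant π)

include hc in
lemma IsNonconstant.baseChange : IsNonconstant (baseChangeMap K f g π hπ) := by
  rintro ⟨y, hy⟩
  refine hc ⟨pullback.fst g (specMap k K) y, fun x => ?_⟩
  obtain ⟨x, rfl⟩ := (pullback.fst f (specMap k K)).surjective x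
  rw [← hy x, ← Scheme.Hom.comp_apply, ← Scheme.Hom.comp_apply, baseChangeMap_fst]

variable [IsCurve f] [IsCurve g] [IrreducibleSpace X] [IrreducibleSpace (baseChange K f)]
  (hs : IsSeparableMap π)

include hc hs in
theorem degree_baseChangeMap_and_isSeparableMap :
    degree (baseChangeMap K f g π hπ) = degree π ∧
      IsSeparableMap (baseChangeMap K f g π hπ) := by
  have h := map_generic f g π hc
  have h' := map_generic (baseChangeHom K f) (baseChangeHom K g) _ (hc.baseChange K hπ)
  let := (fieldMap h).toAlgebra
  let := (fieldMap h').toAlgebra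
  have := isScalarTower_fieldMap h' (baseChangeMap_baseChangeHom K hπ)
  let : Algebra (FunctionField g) (FunctionField (baseChangeHom K f)) :=
    ((algebraMap (FunctionField f) (FunctionField (baseChangeHom K f))).comp
      (fieldMap h)).toAlgebra
  have : IsScalarTower (FunctionField g) (FunctionField f) (FunctionField (baseChangeHom K f)) :=
    .of_algebraMap_eq fun _ => rfl
  have hσ : (pullback.fst f (specMap k K) ≫ π) (generic (baseChangeHom K f)) = generic g := by
    rw [Scheme.Hom.comp_apply, fst_generic, h]
  have : IsScalarTower (FunctionField g) (FunctionField (baseChangeHom K g))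
      (FunctionField (baseChangeHom K f)) := .of_algebraMap_eq fun a =>
    (fieldMap_comp (fst_generic K f) h hσ rfl a).trans
      (fieldMap_comp h' (fst_generic K g) hσ (baseChangeMap_fst K hπ) a).symm
  have := (isSeparableMap_iff h).mp hs
  rw [degree_eq h, degree_eq h', isSeparableMap_iff h']
  exact ⟨(isFieldBaseChange K g).finrank_eq (isFieldBaseChange K f),
    (isFieldBaseChange K f).isSeparable (E := FunctionField g)⟩

end BaseChange

/-! ### Geometric points as closed points of the base change. -/

section Points

variable {k : Type u} [Field k] {K : Type u} [Field K] [Algebra k K]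
  {X Y : Scheme.{u}} {f : X ⟶ Spec (.of k)} {g : Y ⟶ Spec (.of k)}

/-- The `K`-point of `X_K` over `K` given by a `K`-point of `X`. -/
def Pt.toBaseChange (z : Pt K f) : Spec (.of K) ⟶ baseChange K f :=
  pullback.lift (f := f) (g := specMap k K) z.1 (𝟙 _) (by rw [z.2, Category.id_comp])

lemma Pt.toBaseChange_fst (z : Pt K f) : z.toBaseChange ≫ pullback.fst f (specMap k K) = z.1 :=
  pullback.lift_fst _ _ _

lemma Pt.toBaseChange_snd (z : Pt K f) : z.toBaseChange ≫ baseChangeHom K f = 𝟙 _ :=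
  pullback.lift_snd _ _ _

lemma Pt.toBaseChange_map {π : X ⟶ Y} (hπ : π ≫ g = f) (z : Pt K f) :
    (z.map π hπ).toBaseChange = z.toBaseChange ≫ baseChangeMap K f g π hπ := by
  apply pullback.hom_ext
  · rw [Pt.toBaseChange_fst, Category.assoc, baseChangeMap_fst, ← Category.assoc,
      Pt.toBaseChange_fst]
    rfl
  · refine (Pt.toBaseChange_snd _).trans ?_
    rw [Category.assoc, baseChangeMap_baseChangeHom]
    exact z.toBaseChange_snd.symm

lemma Pt.geom_map {π : X ⟶ Y} (hπ : π ≫ g = f) (z : Pt K f) :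
    (z.map π hπ).geom = baseChangeMap K f g π hπ z.geom :=
  congrArg (fun p : Spec (.of K) ⟶ baseChange K g => p (IsLocalRing.closedPoint K))
    (z.toBaseChange_map hπ)

variable [IsAlgClosed K] [LocallyOfFiniteType f]

variable (K f) in
/-- The `K`-points of `X` are the closed points of `X_K`, if `K` is algebraically closed. -/
def ptEquiv : Pt K f ≃ closedPoints (baseChange K f) :=
  Equiv.trans
    { toFun z := ⟨z.toBaseChange, z.toBaseChange_snd⟩
      invFun p := ⟨p.1 ≫ pullback.fst f (specMap k K), by
        rw [Category.assoc, pullback.condition, reassoc_of% p.2]⟩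
      left_inv z := Subtype.ext z.toBaseChange_fst
      right_inv p := Subtype.ext (pullback.hom_ext (Pt.toBaseChange_fst _)
        ((Pt.toBaseChange_snd _).trans p.2.symm)) }
    (pointEquivClosedPoint (baseChangeHom K f))

lemma coe_ptEquiv (z : Pt K f) : (ptEquiv K f z : baseChange K f) = z.geom := rfl

end Points

section Points

variable {k : Type u} [Field k] {K : Type u} [Field K] [Algebra k K] [IsAlgClosed K]
  {X Y : Scheme.{u}} {f : X ⟶ Spec (.of k)} {g : Y ⟶ Spec (.of k)} [hf : IsCurve f]
  [hg : IsCurve g] [IrreducibleSpace X] {π : X ⟶ Y} (hπ : π ≫ g = f) (hc : IsNonconstant π)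
  (hs : IsSeparableMap π)

include hc hs

lemma Pt.exists_fibre_sum_ramIdx (p : Pt K g) : ∃ Z : Finset (Pt K f),
    (∀ z, z ∈ Z ↔ z.map π hπ = p) ∧ ∑ z ∈ Z, z.ramIdx π hπ = degree π := by
  have := IsCurve.irreducibleSpace (baseChangeHom K f)
  have := hf.isProper
  have := hg.isProper
  obtain ⟨hd, hs'⟩ := degree_baseChangeMap_and_isSeparableMap K hπ hc hs
  obtain ⟨Z, hZ, hsum⟩ := CurveCorr.exists_fibre_sum_ramIdx
    (baseChangeMap_baseChangeHom K hπ) (hc.baseChange K hπ) hs' (ptEquiv K g p)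
  refine ⟨Z.map (ptEquiv K f).symm.toEmbedding, fun z => ?_, ?_⟩
  · rw [Finset.mem_map_equiv, Equiv.symm_symm, hZ, coe_ptEquiv, ← Pt.geom_map, ← coe_ptEquiv,
      Subtype.coe_inj, EmbeddingLike.apply_eq_iff_eq]
  · rw [Finset.sum_map, ← hd, ← hsum]
    refine Finset.sum_congr rfl fun x _ => ?_
    rw [Pt.ramIdx, ← coe_ptEquiv, Equiv.coe_toEmbedding, Equiv.apply_symm_apply]

lemma Pt.sum_ramIdx_sub_one_le (Z : Finset (Pt K f)) :
    ∑ z ∈ Z, ((z.ramIdx π hπ : ℤ) - 1) ≤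
      2 * (genus K f : ℤ) - 2 - degree π * (2 * (genus K g : ℤ) - 2) := by
  have := IsCurve.irreducibleSpace (baseChangeHom K f)
  have := IsCurve.irreducibleSpace (baseChangeHom K g)
  have := hf.isProper
  obtain ⟨hd, hs'⟩ := degree_baseChangeMap_and_isSeparableMap K hπ hc hs
  refine le_of_eq_of_le ?_ ((CurveCorr.sum_ramIdx_sub_one_le (baseChangeMap_baseChangeHom K hπ)
    (hc.baseChange K hπ) hs' (Z.map (ptEquiv K f).toEmbedding)).trans_eq ?_)
  · rw [Finset.sum_map]
    rfl
  · rw [hd]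
    rfl

lemma Pt.ramIdx_pos (z : Pt K f) : 0 < z.ramIdx π hπ := by
  have := IsCurve.irreducibleSpace (baseChangeHom K f)
  have := hf.isProper
  obtain ⟨-, hs'⟩ := degree_baseChangeMap_and_isSeparableMap K hπ hc hs
  exact CurveCorr.ramIdx_pos (baseChangeMap_baseChangeHom K hπ) (hc.baseChange K hπ) hs'
    (ptEquiv K f z)

end Points

/-! ### Reduction to connected components. -/

section OpenImmersion

lemma ramIdx_comp {X Y Z : Scheme.{u}} (i : X ⟶ Y) [IsOpenImmersion i] (π : Y ⟶ Z) (x : X) :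
    ramIdx (i ≫ π) x = ramIdx π (i x) := by
  let e : Y.presheaf.stalk (i x) ≃+* X.presheaf.stalk x :=
    (asIso (i.stalkMap x)).commRingCatIsoToRingEquiv
  have h : ∀ a : Z.presheaf.stalk (π (i x)), (i ≫ π).stalkMap x a = e (π.stalkMap (i x) a) :=
    fun a => ConcreteCategory.congr_hom (Scheme.Hom.stalkMap_comp i π x) a
  unfold ramIdx Ideal.ramificationIdx'
  congr 1
  ext n
  rw [Set.mem_ofPred_eq, Set.mem_ofPred_eq, Ideal.map_le_iff_le_comap, Ideal.map_le_iff_le_comap,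
    ← IsLocalRing.map_ringEquiv_maximalIdeal e, ← Ideal.map_pow]
  refine forall₂_congr fun a _ => ?_
  exact (iff_of_eq (congrArg (· ∈ _) (h a))).trans Ideal.apply_mem_of_equiv_iff

variable {k : Type u} [Field k] {K : Type u} [Field K] [Algebra k K] {X Y Z : Scheme.{u}}
  {f : X ⟶ Spec (.of k)} {g : Y ⟶ Spec (.of k)} {h : Z ⟶ Spec (.of k)}

instance (i : X ⟶ Y) [IsOpenImmersion i] (hi : i ≫ g = f) :
    IsOpenImmersion (baseChangeMap K f g i hi) := by
  have : baseChangeMap K f g i hi = pullback.map f (specMap k K) g (specMap k K) i (𝟙 _) (𝟙 _)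
      (by rw [Category.comp_id, hi]) (by rw [Category.comp_id, Category.id_comp]) := by
    apply pullback.hom_ext
    · rw [baseChangeMap_fst, pullback.lift_fst]
    · exact (pullback.lift_snd _ _ _).trans
        ((pullback.lift_snd _ _ _).trans (Category.comp_id _)).symm
  rw [this]
  infer_instance

lemma baseChangeMap_comp (i : X ⟶ Y) (hi : i ≫ g = f) (π : Y ⟶ Z) (hπ : π ≫ h = g) :
    baseChangeMap K f g i hi ≫ baseChangeMap K g h π hπ =
      baseChangeMap K f h (i ≫ π) (by rw [Category.assoc, hπ, hi]) := by
  apply pullback.hom_ext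
  · rw [Category.assoc, baseChangeMap_fst, baseChangeMap_fst, ← Category.assoc, baseChangeMap_fst,
      Category.assoc]
  · rw [Category.assoc]
    refine Eq.trans ?_ (baseChangeMap_baseChangeHom K _).symm
    refine (congrArg _ (baseChangeMap_baseChangeHom K hπ)).trans ?_
    exact baseChangeMap_baseChangeHom K hi

lemma Pt.ramIdx_map (i : X ⟶ Y) [IsOpenImmersion i] (hi : i ≫ g = f) (π : Y ⟶ Z)
    (hπ : π ≫ h = g) (z : Pt K f) : (z.map i hi).ramIdx π hπ =
      z.ramIdx (i ≫ π) (by rw [Category.assoc, hπ, hi]) := by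
  rw [Pt.ramIdx, Pt.ramIdx, ← baseChangeMap_comp i hi π hπ, ramIdx_comp, Pt.geom_map]

end OpenImmersion

section Components

variable (D : Scheme.{u}) [IsNoetherian D]

instance : Finite (_root_.ConnectedComponents D) :=
  have := ConnectedComponents.discreteTopology_iff.mpr (isOpen_connectedComponent_of_noetherian D)
  finite_of_compact_of_discrete

instance : Fintype (_root_.ConnectedComponents D) := Fintype.ofFinite _

variable {D} {k : Type u} [Field k] {K : Type u} [Field K] [Algebra k K] (str : D ⟶ Spec (.of k))

lemma mk_component_map {c : _root_.ConnectedComponents D} (z : Pt K ((component D c).ι ≫ str)) :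
    _root_.ConnectedComponents.mk ((z.map (component D c).ι rfl).1 (IsLocalRing.closedPoint K)) =
      c :=
  (z.1 (IsLocalRing.closedPoint K)).2

variable (K) in
/-- The `K`-points of a noetherian scheme are those of its connected components. -/
def componentPtEquiv :
    (Σ c : _root_.ConnectedComponents D, Pt K ((component D c).ι ≫ str)) ≃ Pt K str :=
  Equiv.ofBijective (fun z => z.2.map (component D z.1).ι rfl) <| by
    constructor
    · rintro ⟨c, z⟩ ⟨c', z'⟩ h
      obtain rfl : c = c' := by
        rw [← mk_component_map str z, ← mk_component_map str z']
        exact congrArg (fun p : Pt K str =>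
          _root_.ConnectedComponents.mk (p.1 (IsLocalRing.closedPoint K))) h
      congr 1
      refine Subtype.ext ((cancel_mono (component D c).ι).mp ?_)
      exact congrArg Subtype.val h
    · intro z
      let c := _root_.ConnectedComponents.mk (z.1 (IsLocalRing.closedPoint K))
      have h : Set.range z.1 ⊆ Set.range (component D c).ι := by
        rintro _ ⟨x, rfl⟩
        rw [Scheme.Opens.range_ι, Subsingleton.elim x (IsLocalRing.closedPoint K)]
        rfl
      refine ⟨⟨c, IsOpenImmersion.lift (component D c).ι z.1 h, ?_⟩, Subtype.ext ?_⟩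
      · rw [IsOpenImmersion.lift_fac_assoc, z.2]
      · exact IsOpenImmersion.lift_fac _ _ h

lemma componentPtEquiv_apply
    (z : Σ c : _root_.ConnectedComponents D, Pt K ((component D c).ι ≫ str)) :
    componentPtEquiv K str z = z.2.map (component D z.1).ι rfl := rfl

variable [hD : ∀ c, IsCurve ((component D c).ι ≫ str)] [∀ c, IrreducibleSpace (component D c)]
  [IsAlgClosed K] {Y : Scheme.{u}}
  {g : Y ⟶ Spec (.of k)} [IsCurve g] {str} {π : D ⟶ Y} (hπ : π ≫ g = str)
  (hc : ∀ c, IsNonconstant ((component D c).ι ≫ π))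
  (hs : ∀ c, IsSeparableMap ((component D c).ι ≫ π))

include hc hs

lemma exists_fibre_sum_ramIdx_eq_sum_degree (p : Pt K g) : ∃ Z : Finset (Pt K str),
    (∀ z, z ∈ Z ↔ z.map π hπ = p) ∧
      ∑ z ∈ Z, z.ramIdx π hπ = ∑ c, degree ((component D c).ι ≫ π) := by
  have hπ' : ∀ c, ((component D c).ι ≫ π) ≫ g = (component D c).ι ≫ str := fun c => by
    rw [Category.assoc, hπ]
  choose Z hZ hsum using fun c => Pt.exists_fibre_sum_ramIdx (hπ' c) (hc c) (hs c) p
  refine ⟨(Finset.univ.sigma Z).map (componentPtEquiv K str).toEmbedding, fun z => ?_, ?_⟩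
  · obtain ⟨⟨c, z⟩, rfl⟩ := (componentPtEquiv K str).surjective z
    rw [Finset.mem_map_equiv, Equiv.symm_apply_apply, Finset.mem_sigma, hZ]
    refine (and_iff_right (Finset.mem_univ c)).trans (iff_of_eq (congrArg (· = p) ?_))
    exact Subtype.ext (Category.assoc _ _ _).symm
  · rw [Finset.sum_map, Finset.sum_sigma]
    refine Finset.sum_congr rfl fun c _ => ?_
    rw [← hsum]
    exact Finset.sum_congr rfl fun z _ => z.ramIdx_map _ rfl π hπ

lemma sum_ramIdx_sub_one_le_sum_genus (Z : Finset (Pt K str)) :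
    ∑ z ∈ Z, ((z.ramIdx π hπ : ℤ) - 1) ≤
      2 * ((∑ c, genus K ((component D c).ι ≫ str) : ℕ) : ℤ) -
        2 * Fintype.card (_root_.ConnectedComponents D) -
        (∑ c, degree ((component D c).ι ≫ π) : ℕ) * (2 * (genus K g : ℤ) - 2) := by
  classical
  have hπ' : ∀ c, ((component D c).ι ≫ π) ≫ g = (component D c).ι ≫ str := fun c => by
    rw [Category.assoc, hπ]
  let t : ∀ c, Finset (Pt K ((component D c).ι ≫ str)) := fun c =>
    Z.preimage (fun z => componentPtEquiv K str ⟨c, z⟩)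
      (((componentPtEquiv K str).injective.comp sigma_mk_injective).injOn)
  have hZ : Z = (Finset.univ.sigma t).map (componentPtEquiv K str).toEmbedding := by
    ext z
    obtain ⟨z, rfl⟩ := (componentPtEquiv K str).surjective z
    rw [Finset.mem_map_equiv, Equiv.symm_apply_apply, Finset.mem_sigma, Finset.mem_preimage]
    exact (and_iff_right (Finset.mem_univ _)).symm
  have h := Finset.sum_le_sum fun c (_ : c ∈ Finset.univ) =>
    Pt.sum_ramIdx_sub_one_le (K := K) (hπ' c) (hc c) (hs c) (t c)
  rw [Finset.sum_sub_distrib, Finset.sum_sub_distrib, ← Finset.mul_sum, Finset.sum_const,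
    ← Finset.sum_mul, Finset.card_univ, nsmul_eq_mul] at h
  push_cast
  rw [hZ, Finset.sum_map, Finset.sum_sigma]
  refine le_of_eq_of_le (Finset.sum_congr rfl fun c _ => Finset.sum_congr rfl fun z _ => ?_)
    (h.trans_eq (by ring))
  rw [← z.ramIdx_map (component D c).ι rfl π hπ]
  rfl

lemma ramIdx_pos_of_components (z : Pt K str) : 0 < z.ramIdx π hπ := by
  obtain ⟨⟨c, z⟩, rfl⟩ := (componentPtEquiv K str).surjective z
  rw [componentPtEquiv_apply, Pt.ramIdx_map]
  exact Pt.ramIdx_pos _ (hc c) (hs c) z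

end Components

/-! ### The counting argument for two maps of sets with multiplicities. -/

section Counting

variable {P Q : Type*} {s t : P → Q} {e₁ e₂ : P → ℕ} {d₁ d₂ : ℕ}

lemma exists_preimage_sum (h : ∀ p, ∃ Z : Finset P, (∀ z, z ∈ Z ↔ t z = p) ∧ ∑ z ∈ Z, e₂ z = d₂)
    (S : Finset Q) :
    ∃ Z : Finset P, (∀ z, z ∈ Z ↔ t z ∈ S) ∧ ∑ z ∈ Z, e₂ z = d₂ * S.card := by
  classical
  choose Z hZ hsum using h
  refine ⟨S.biUnion Z, fun z => ?_, ?_⟩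
  · simp only [Finset.mem_biUnion, hZ, exists_eq_right']
  · rw [Finset.sum_biUnion fun p _ q _ hpq => Finset.disjoint_left.mpr fun z hp hq =>
      hpq (((hZ p z).mp hp).symm.trans ((hZ q z).mp hq)), Finset.sum_congr rfl fun p _ => hsum p,
      Finset.sum_const, smul_eq_mul, mul_comm]

variable (h₁ : ∀ p, ∃ Z : Finset P, (∀ z, z ∈ Z ↔ s z = p) ∧ ∑ z ∈ Z, e₁ z = d₁)
  (h₂ : ∀ p, ∃ Z : Finset P, (∀ z, z ∈ Z ↔ t z = p) ∧ ∑ z ∈ Z, e₂ z = d₂)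
  (hpos : ∀ z, 0 < e₁ z) {S : Finset Q} (hS : ∀ z, t z ∈ S → s z ∈ S)

include h₁ h₂ hpos hS

/-- With `Z₁` and `Z₂` the preimages of `S`, one has `d₂|S| - |Z₂| ≤ R` and `|Z₂| ≤ |Z₁| ≤ d₁|S|`,
the last bound because every `e₁` is at least `1`. -/
lemma mul_card_sub_mul_card_le {R : ℤ} (hR : ∀ Z : Finset P, ∑ z ∈ Z, ((e₂ z : ℤ) - 1) ≤ R) :
    ((d₂ : ℤ) - d₁) * S.card ≤ R := by
  obtain ⟨Z₁, hZ₁, hsum₁⟩ := exists_preimage_sum h₁ S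
  obtain ⟨Z₂, hZ₂, hsum₂⟩ := exists_preimage_sum h₂ S
  have hle : Z₂ ⊆ Z₁ := fun z hz => (hZ₁ z).mpr (hS z ((hZ₂ z).mp hz))
  have h := hR Z₂
  rw [Finset.sum_sub_distrib, Finset.sum_const, nsmul_one] at h
  have hcard : (Z₂.card : ℤ) ≤ Z₁.card := by exact_mod_cast Finset.card_le_card hle
  have hcard₁ : (Z₁.card : ℤ) ≤ d₁ * S.card := by
    rw [← nsmul_one, ← Finset.sum_const]
    exact_mod_cast (Finset.sum_le_sum fun z _ => Nat.succ_le_iff.mpr (hpos z)).trans_eq hsum₁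
  have hsum : ∑ z ∈ Z₂, (e₂ z : ℤ) = d₂ * S.card := by exact_mod_cast hsum₂
  linarith

omit hpos in
lemma mul_card_le_mul_card (hdec : ∀ z, t z ∈ S → e₂ z ≤ e₁ z) : d₂ * S.card ≤ d₁ * S.card := by
  obtain ⟨Z₁, hZ₁, hsum₁⟩ := exists_preimage_sum h₁ S
  obtain ⟨Z₂, hZ₂, hsum₂⟩ := exists_preimage_sum h₂ S
  rw [← hsum₁, ← hsum₂]
  exact (Finset.sum_le_sum fun z hz => hdec z ((hZ₂ z).mp hz)).trans
    (Finset.sum_le_sum_of_subset fun z hz => (hZ₁ z).mpr (hS z ((hZ₂ z).mp hz)))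

/-- The cycle `∑_{Z₂} e₂ ≤ ∑_{Z₂} e₁ ≤ ∑_{Z₁} e₁ = d₁|S| ≤ d₂|S| = ∑_{Z₂} e₂` consists of
equalities. The first gives `e₁ = e₂` on `Z₂`; the second, as `e₁` is positive, gives `Z₁ = Z₂`. -/
lemma eq_of_le_of_decreasing (hd : d₁ ≤ d₂) (hdec : ∀ z, t z ∈ S → e₂ z ≤ e₁ z) :
    (∀ z, s z ∈ S → t z ∈ S) ∧ ∀ z, t z ∈ S → e₁ z = e₂ z := by
  obtain ⟨Z₁, hZ₁, hsum₁⟩ := exists_preimage_sum h₁ S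
  obtain ⟨Z₂, hZ₂, hsum₂⟩ := exists_preimage_sum h₂ S
  have hle : Z₂ ⊆ Z₁ := fun z hz => (hZ₁ z).mpr (hS z ((hZ₂ z).mp hz))
  have hle₁ : ∑ z ∈ Z₂, e₂ z ≤ ∑ z ∈ Z₂, e₁ z :=
    Finset.sum_le_sum fun z hz => hdec z ((hZ₂ z).mp hz)
  have hle₂ : ∑ z ∈ Z₂, e₁ z ≤ ∑ z ∈ Z₁, e₁ z := Finset.sum_le_sum_of_subset hle
  have hle₃ : ∑ z ∈ Z₁, e₁ z ≤ ∑ z ∈ Z₂, e₂ z := by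
    rw [hsum₁, hsum₂]
    exact Nat.mul_le_mul_right _ hd
  constructor
  · intro z hz
    by_contra hz'
    refine absurd (Finset.sum_lt_sum_of_subset hle ((hZ₁ z).mpr hz)
      (fun h => hz' ((hZ₂ z).mp h)) (hpos z) fun _ _ _ => Nat.zero_le _) (not_lt.mpr ?_)
    exact hle₃.trans hle₁
  · intro z hz
    exact ((Finset.sum_eq_sum_iff_of_le fun z hz => hdec z ((hZ₂ z).mp hz)).mp
      (hle₁.antisymm (hle₂.trans hle₃)) z ((hZ₂ z).mpr hz)).symm

end Counting

/-! ### Conclusions for self-correspondences. -/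

namespace SelfCorrespondence

variable {k : Type u} [Field k] {C : Scheme.{u}} {f : C ⟶ Spec (.of k)}

/-- The transpose of a self-correspondence. -/
def swap (T : SelfCorrespondence f) : SelfCorrespondence f where
  D := T.D
  str := T.str
  isNoetherian := T.isNoetherian
  isReduced := T.isReduced
  isCurve := T.isCurve
  π₁ := T.π₂
  π₂ := T.π₁
  π₁_comp := T.π₂_comp
  π₂_comp := T.π₁_comp
  nonconstant₁ := T.nonconstant₂
  nonconstant₂ := T.nonconstant₁
  separable₁ := T.separable₂
  separable₂ := T.separable₁

variable (T : SelfCorrespondence f) {K : Type u} [Field K] [Algebra k K]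

lemma genusD_eq_sum :
    T.genusD K = ∑ c : _root_.ConnectedComponents T.D, genus K ((component T.D c).ι ≫ T.str) :=
  finsum_eq_sum_of_fintype _

variable [IsAlgClosed K] [hf : IsCurve f]

lemma exists_target_fibre (p : Pt K f) : ∃ Z : Finset (Pt K T.str),
    (∀ z, z ∈ Z ↔ T.target z = p) ∧ ∑ z ∈ Z, T.e₂ z = T.d₂ := by
  have := fun c => (T.isCurve c).irreducibleSpace
  rw [d₂, finsum_eq_sum_of_fintype]
  exact exists_fibre_sum_ramIdx_eq_sum_degree T.π₂_comp T.nonconstant₂ T.separable₂ p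

lemma exists_source_fibre (p : Pt K f) : ∃ Z : Finset (Pt K T.str),
    (∀ z, z ∈ Z ↔ T.source z = p) ∧ ∑ z ∈ Z, T.e₁ z = T.d₁ :=
  T.swap.exists_target_fibre p

lemma e₂_pos (z : Pt K T.str) : 0 < T.e₂ z :=
  have := fun c => (T.isCurve c).irreducibleSpace
  ramIdx_pos_of_components T.π₂_comp T.nonconstant₂ T.separable₂ z

lemma e₁_pos (z : Pt K T.str) : 0 < T.e₁ z := T.swap.e₂_pos z

/-- Riemann-Hurwitz contributes `-2` for each component. The hypothesis `hd` excludes an empty `D`,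
for which the constant `-1` on the right would be wrong. -/
lemma sum_e₂_sub_one_le (hd : 0 < T.d₂) (Z : Finset (Pt K T.str)) :
    ∑ z ∈ Z, ((T.e₂ z : ℤ) - 1) ≤ 2 * ((T.genusD K : ℤ) - T.d₂ * genus K f + T.d₂ - 1) := by
  have := fun c => (T.isCurve c).irreducibleSpace
  have h := sum_ramIdx_sub_one_le_sum_genus T.π₂_comp T.nonconstant₂ T.separable₂ Z
  have h₂ : T.d₂ = ∑ c, degree ((component T.D c).ι ≫ T.π₂) := finsum_eq_sum_of_fintype _
  rw [← genusD_eq_sum, ← h₂] at h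
  have hcard : 0 < Fintype.card (_root_.ConnectedComponents T.D) := by
    rw [Fintype.card_pos_iff]
    by_contra hne
    rw [not_nonempty_iff] at hne
    rw [h₂, Finset.univ_eq_empty, Finset.sum_empty] at hd
    exact hd.false
  have hcard' : (1 : ℤ) ≤ Fintype.card (_root_.ConnectedComponents T.D) := by exact_mod_cast hcard
  refine h.trans ?_
  linarith

variable {S : Set (Pt K f)} (hS : S.Finite) (hb : T.BackwardComplete S)

include hS hb

lemma ncard_le_of_backwardComplete (hd : T.d₁ < T.d₂) : (S.ncard : ℝ) ≤
    2 * (((T.genusD K : ℝ) - T.d₂ * genus K f + T.d₂ - 1) / (T.d₂ - T.d₁)) := by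
  have h := mul_card_sub_mul_card_le (S := hS.toFinset) T.exists_source_fibre T.exists_target_fibre
    T.e₁_pos (fun z hz => hS.mem_toFinset.mpr (hb (hS.mem_toFinset.mp hz)))
    (T.sum_e₂_sub_one_le (Nat.zero_lt_of_lt hd))
  have hd' : (0 : ℝ) < T.d₂ - T.d₁ := sub_pos.mpr (by exact_mod_cast hd)
  have h' : ((T.d₂ : ℝ) - T.d₁) * hS.toFinset.card ≤
      2 * ((T.genusD K : ℝ) - T.d₂ * genus K f + T.d₂ - 1) := by exact_mod_cast h
  rw [Set.ncard_eq_toFinset_card S hS, ← mul_div_assoc, le_div_iff₀ hd']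
  linarith

lemma eq_empty_of_ramificationDecreasing (hd : T.d₁ < T.d₂) (hr : T.RamificationDecreasing S) :
    S = ∅ := by
  have h := mul_card_le_mul_card (S := hS.toFinset) T.exists_source_fibre T.exists_target_fibre
    (fun z hz => hS.mem_toFinset.mpr (hb (hS.mem_toFinset.mp hz)))
    fun z hz => hr z (hb (hS.mem_toFinset.mp hz)) (hS.mem_toFinset.mp hz)
  have hcard : hS.toFinset.card = 0 := by
    by_contra hne
    exact absurd (Nat.le_of_mul_le_mul_right h (Nat.pos_of_ne_zero hne)) (not_le.mpr hd)
  rwa [Finset.card_eq_zero, Set.Finite.toFinset_eq_empty] at hcard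

lemma complete_and_equiramified (hd : T.d₁ ≤ T.d₂) (hr : T.RamificationDecreasing S) :
    T.Complete S ∧ T.Equiramified S := by
  have h := eq_of_le_of_decreasing (S := hS.toFinset) T.exists_source_fibre T.exists_target_fibre
    T.e₁_pos (fun z hz => hS.mem_toFinset.mpr (hb (hS.mem_toFinset.mp hz))) hd
    fun z hz => hr z (hb (hS.mem_toFinset.mp hz)) (hS.mem_toFinset.mp hz)
  simp only [Set.Finite.mem_toFinset] at h
  exact ⟨⟨h.1, hb⟩, fun z _ hz => h.2 z hz⟩

omit hb in
-- An equiramified complete set is backward-complete and ramification-decreasing both for `T` and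
-- for its transpose, so a strict inequality in either direction would make it empty.
lemma d₁_eq_d₂ (hne : S.Nonempty) (hc : T.Complete S) (he : T.Equiramified S) : T.d₁ = T.d₂ := by
  by_contra hd
  obtain hd | hd := lt_or_gt_of_ne hd
  · exact hne.ne_empty (T.eq_empty_of_ramificationDecreasing hS hc.2 hd
      fun z h₁ h₂ => (he z h₁ h₂).ge)
  · exact hne.ne_empty (T.swap.eq_empty_of_ramificationDecreasing hS hc.1 hd
      fun z h₁ h₂ => (he z h₂ h₁).le)

omit hb in
lemma ncard_le_of_complete (hc : T.Complete S) (hd : T.d₁ ≠ T.d₂) : (S.ncard : ℝ) ≤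
    2 * (((T.genusD K : ℝ) - (max T.d₁ T.d₂ : ℕ) * genus K f + (max T.d₁ T.d₂ : ℕ) - 1) /
      |(T.d₂ : ℝ) - T.d₁|) := by
  obtain hd | hd := lt_or_gt_of_ne hd
  · have hd' : (0 : ℝ) < T.d₂ - T.d₁ := sub_pos.mpr (by exact_mod_cast hd)
    rw [max_eq_right hd.le, abs_of_pos hd']
    exact T.ncard_le_of_backwardComplete hS hc.2 hd
  · have hd' : (0 : ℝ) < T.d₁ - T.d₂ := sub_pos.mpr (by exact_mod_cast hd)
    rw [max_eq_left hd.le, abs_sub_comm, abs_of_pos hd']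
    exact T.swap.ncard_le_of_backwardComplete hS hc.1 hd

end SelfCorrespondence

end CurveCorr

end

theorem mainTheorem5 {k : Type u} [Field k] (K : Type u) [Field K] [Algebra k K]
    [IsAlgClosure k K] {C : AlgebraicGeometry.Scheme.{u}}
    (f : C ⟶ AlgebraicGeometry.Spec (.of k)) [CurveCorr.IsCurve f]
    (T : CurveCorr.SelfCorrespondence f) :
    (T.d₁ < T.d₂ → ∀ S : Set (CurveCorr.Pt K f), S.Finite → T.BackwardComplete S →
      (S.ncard : ℝ) ≤
          2 * (((T.genusD K : ℝ) - T.d₂ * CurveCorr.genus K f + T.d₂ - 1) / (T.d₂ - T.d₁)) ∧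
        (T.RamificationDecreasing S → S = ∅)) ∧
    (T.d₁ ≤ T.d₂ → ∀ S : Set (CurveCorr.Pt K f), S.Finite → T.BackwardComplete S →
      T.RamificationDecreasing S → T.Complete S ∧ T.Equiramified S) ∧
    ((∃ S : Set (CurveCorr.Pt K f), S.Finite ∧ S.Nonempty ∧ T.Complete S ∧ T.Equiramified S) →
      T.d₁ = T.d₂) ∧
    (T.d₁ ≠ T.d₂ → ∀ S : Set (CurveCorr.Pt K f), S.Finite → T.Complete S →
      (S.Nonempty → ¬ T.Equiramified S ∧ ¬ T.Etale S) ∧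
        (S.ncard : ℝ) ≤
          2 * (((T.genusD K : ℝ) - (max T.d₁ T.d₂ : ℕ) * CurveCorr.genus K f
            + (max T.d₁ T.d₂ : ℕ) - 1) / |(T.d₂ : ℝ) - T.d₁|)) := by
  have := IsAlgClosure.isAlgClosed k (K := K)
  refine ⟨fun hd S hS hb => ⟨T.ncard_le_of_backwardComplete hS hb hd,
      T.eq_empty_of_ramificationDecreasing hS hb hd⟩,
    fun hd S hS hb hr => T.complete_and_equiramified hS hb hd hr, ?_, ?_⟩
  · rintro ⟨S, hS, hne, hc, he⟩
    exact T.d₁_eq_d₂ hS hne hc he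
  · intro hd S hS hc
    have h : S.Nonempty → ¬ T.Equiramified S := fun hne he => hd (T.d₁_eq_d₂ hS hne hc he)
    exact ⟨fun hne => ⟨h hne, fun het => h hne fun z h₁ h₂ =>
      (het z h₁ h₂).1.trans (het z h₁ h₂).2.symm⟩, T.ncard_le_of_complete hS hc hd⟩
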